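/- \textbf{Setting.} Let $T>0$, $d,m\in\mathbb N$, $0<\alpha<\tfrac12$. Here $|\cdot|$ is the Euclidean norm (on matrices: the Frobenius norm), and "measurable" means Borel measurable. \textbf{Spaces.} $W_0^{\alpha,\infty}(0,T;\mathbb R^d)$ is the set of measurable $f:[0,T]\to\mathbb R^d$ with $$\|f\|_{\alpha,\infty}=\sup_{t\in[0,T]}\Big(|f(t)|+\int_0^t\frac{|f(t)-f(s)|}{(t-s)^{\alpha+1}}\,ds\Big)<\infty .$$ $C^{\lambda}(0,T;\mathbb R^d)$ is the set of $f:[0,T]\to\mathbb R^d$ with $\sup_{[0,T]}|f|+\sup_{0\le s<t\le T}|f(t)-f(s)|(t-s)^{-\lambda}<\infty$. $W_T^{1-\alpha,\infty}(0,T;\mathbb R^m)$ is the set of measurable $g:[0,T]\to\mathbb R^m$ with $$\sup_{0<s<t<T}\Big(\frac{|g(t)-g(s)|}{(t-s)^{1-\alpha}}+\int_s^t\frac{|g(y)-g(s)|}{(y-s)^{2-\alpha}}\,dy\Big)<\infty .$$ $W_0^{\alpha,1}(0,T)$ is the set of measurable $f:[0,T]\to\mathbb R$ with $\int_0^T\frac{|f(s)|}{s^\alpha}ds+\int_0^T\int_0^s\frac{|f(s)-f(y)|}{(s-y)^{\alpha+1}}dy\,ds<\infty$.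 \textbf{Integral.} For $f\in W_0^{\alpha,1}(0,T)$ and real-valued $g\in W_T^{1-\alpha,\infty}(0,T;\mathbb R)$ the generalized Stieltjes integral (Z\"ahle) is $$\int_0^t f\,dg=\int_0^T f\,\mathbf 1_{(0,t)}\,dg,\qquad \int_0^T F\,dg=(-1)^{\alpha}\int_0^T D_{0+}^{\alpha}F(x)\,D_{T-}^{1-\alpha}g_{T-}(x)\,dx,\qquad g_{T-}(x)=g(x)-g(T-),$$ with the Weyl derivatives $$D_{0+}^{\alpha}F(x)=\frac1{\Gamma(1-\alpha)}\Big(\frac{F(x)}{x^{\alpha}}+\alpha\int_0^x\frac{F(x)-F(y)}{(x-y)^{\alpha+1}}dy\Big),$$ $$D_{T-}^{1-\alpha}h(x)=\frac{(-1)^{1-\alpha}}{\Gamma(\alpha)}\Big(\frac{h(x)}{(T-x)^{1-\alpha}}+(1-\alpha)\int_x^T\frac{h(x)-h(y)}{(y-x)^{2-\alpha}}dy\Big),$$ where $(-1)^\alpha(-1)^{1-\alpha}=-1$. For matrix-valued integrands and vector-valued $g$ the integral is $\big(\int_0^t A\,dg\big)_i=\sum_j\int_0^tA_{ij}\,dg^j$.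 \textbf{(H1)} $\sigma:[0,T]^2\times\mathbb R^d\to\mathbb R^{d\times m}$ is measurable, the derivatives $\partial_{x_i}\sigma$, $\partial_t\sigma$ and $\partial^2_{x_i,t}\sigma=\partial_{x_i}(\partial_t\sigma)$ exist everywhere ($\partial_t$ is one-sided at $t=0,T$), and, for given $0<\beta,\mu,\delta\le1$, there are $K>0$ and, for every $N\ge0$, $K_N>0$ such that for all $t,t_1,t_2,s,s_1,s_2\in[0,T]$, $x,y\in\mathbb R^d$, $i=1,\dots,d$: \begin{enumerate} \item $|\sigma(t,s,x)-\sigma(t,s,y)|+|\partial_t\sigma(t,s,x)-\partial_t\sigma(t,s,y)|\le K|x-y|$; \item $|\partial_{x_i}\sigma(t,s,x)-\partial_{x_i}\sigma(t,s,y)|+|\partial^2_{x_i,t}\sigma(t,s,x)-\partial^2_{x_i,t}\sigma(t,s,y)|\le K_N|x-y|^\delta$ if $|x|,|y|\le N$; \item $|\sigma(t_1,s,x)-\sigma(t_2,s,x)|+|\partial_{x_i}\sigma(t_1,s,x)-\partial_{x_i}\sigma(t_2,s,x)|\le K|t_1-t_2|^\mu$; \item $|\sigma(t,s_1,x)-\sigma(t,s_2,x)|+|\partial_t\sigma(t,s_1,x)-\partial_t\sigma(t,s_2,x)|\le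 K|s_1-s_2|^\beta$; \item $|\partial^2_{x_i,t}\sigma(t,s_1,x)-\partial^2_{x_i,t}\sigma(t,s_2,x)|+|\partial_{x_i}\sigma(t,s_1,x)-\partial_{x_i}\sigma(t,s_2,x)|\le K|s_1-s_2|^\beta$. \end{enumerate} \textbf{(H2)} (with $\rho\ge2$ and the same $\mu$) $b:[0,T]^2\times\mathbb R^d\to\mathbb R^d$ is measurable and there are $L,L_0>0$, a real-valued $b_0\in L^\rho([0,T]^2)$ and, for every $N\ge0$, $L_N'>0$ such that for all $t,t_1,t_2,s\in[0,T]$, $x,y\in\mathbb R^d$: \begin{enumerate} \item $|b(t,s,x)-b(t,s,y)|\le L_N'|x-y|$ if $|x|,|y|\le N$; \item $|b(t_1,s,x)-b(t_2,s,x)|\le L|t_1-t_2|^\mu$; \item $|b(t,s,x)|\le L_0|x|+b_0(t,s)$; \item $|b(t_1,s,x)-b(t_1,s,y)-b(t_2,s,x)+b(t_2,s,y)|\le L_N'|t_1-t_2||x-y|$ if $|x|,|y|\le N$. \end{enumerate} \textbf{Theorem.} Let $g\in W_T^{1-\alpha,\infty}(0,T;\mathbb R^m)$ and $x_0\in\mathbb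 R^d$. Assume that $\sigma$ satisfies (H1) and $b$ satisfies (H2) with $\rho=1/\alpha$, that $\min\{\beta,\frac{\delta}{1+\delta}\}>1-\mu$, and that $$0<\alpha,\qquad 1-\mu<\alpha<\alpha_0:=\min\Big\{\frac12,\beta,\frac{\delta}{1+\delta}\Big\}.$$ Then the equation $$x(t)=x_0+\int_0^tb(t,s,x(s))\,ds+\int_0^t\sigma(t,s,x(s))\,dg_s,\qquad t\in[0,T],$$ has a unique solution $x\in W_0^{\alpha,\infty}(0,T;\mathbb R^d)\cap C^{1-\alpha}(0,T;\mathbb R^d)$. Here a solution is a function for which both integrals are well defined for every $t\in[0,T]$ (that is, $b(t,\cdot,x(\cdot))$ is integrable on $(0,t)$ and the entries of $\sigma(t,\cdot,x(\cdot))$ belong to $W_0^{\alpha,1}(0,T)$) and the equation holds for every $t\in[0,T]$. -/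

import Mathlib

open MeasureTheory Set

open scoped ENNReal

noncomputable section

namespace Volterra

/-- Euclidean space `ℝⁿ`. -/
abbrev E (n : ℕ) : Type := EuclideanSpace ℝ (Fin n)

section FunctionSpaces

variable {F : Type*} [NormedAddCommGroup F] [MeasurableSpace F]

/-- `‖f‖_{α,∞} = sup_{t ∈ [0,T]} ( |f(t)| + ∫_0^t |f(t) - f(s)| / (t - s)^{α+1} ds )`,
as an extended nonnegative number. -/
def normW0 (α T : ℝ) (f : ℝ → F) : ℝ≥0∞ :=
  ⨆ t ∈ Icc (0 : ℝ) T,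
    (ENNReal.ofReal ‖f t‖ +
      ∫⁻ s in Ioo 0 t, ENNReal.ofReal (‖f t - f s‖ / (t - s) ^ (α + 1)))

/-- `f ∈ W_0^{α,∞}(0,T)`: `f` is measurable on `[0,T]` and `‖f‖_{α,∞} < ∞`. -/
def MemW0 (α T : ℝ) (f : ℝ → F) : Prop :=
  Measurable (fun t : Icc (0 : ℝ) T => f t) ∧ normW0 α T f < ∞

/-- `‖f‖_λ = sup_{[0,T]} |f| + sup_{0 ≤ s < t ≤ T} |f(t) - f(s)| / (t - s)^λ`. -/
def normHolder (lam T : ℝ) (f : ℝ → F) : ℝ≥0∞ :=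
  (⨆ s ∈ Icc (0 : ℝ) T, ENNReal.ofReal ‖f s‖) +
    ⨆ s ∈ Icc (0 : ℝ) T, ⨆ t ∈ Ioc s T, ENNReal.ofReal (‖f t - f s‖ / (t - s) ^ lam)

/-- `f ∈ C^λ(0,T)`: `f` is `λ`-Hölder continuous on `[0,T]`. -/
def MemHolder (lam T : ℝ) (f : ℝ → F) : Prop :=
  normHolder lam T f < ∞

/-- `‖g‖_{1-α,∞,T} =
sup_{0 < s < t < T} ( |g(t) - g(s)| / (t - s)^{1-α} + ∫_s^t |g(y) - g(s)| / (y - s)^{2-α} dy )`. -/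
def normWT (α T : ℝ) (g : ℝ → F) : ℝ≥0∞ :=
  ⨆ s ∈ Ioo (0 : ℝ) T, ⨆ t ∈ Ioo s T,
    (ENNReal.ofReal (‖g t - g s‖ / (t - s) ^ (1 - α)) +
      ∫⁻ y in Ioo s t, ENNReal.ofReal (‖g y - g s‖ / (y - s) ^ (2 - α)))

/-- `g ∈ W_T^{1-α,∞}(0,T)`: `g` is measurable on `[0,T]` and `‖g‖_{1-α,∞,T} < ∞`. -/
def MemWT (α T : ℝ) (g : ℝ → F) : Prop :=
  Measurable (fun t : Icc (0 : ℝ) T => g t) ∧ normWT α T g < ∞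

/-- `‖f‖_{α,1} = ∫_0^T |f(s)| / s^α ds + ∫_0^T ∫_0^s |f(s) - f(y)| / (s - y)^{α+1} dy ds`. -/
def normW01 (α T : ℝ) (f : ℝ → F) : ℝ≥0∞ :=
  (∫⁻ s in Ioo 0 T, ENNReal.ofReal (‖f s‖ / s ^ α)) +
    ∫⁻ s in Ioo 0 T, ∫⁻ y in Ioo 0 s, ENNReal.ofReal (‖f s - f y‖ / (s - y) ^ (α + 1))

/-- `f ∈ W_0^{α,1}(0,T)`: `f` is measurable on `[0,T]` and `‖f‖_{α,1} < ∞`. -/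
def MemW01 (α T : ℝ) (f : ℝ → F) : Prop :=
  Measurable (fun t : Icc (0 : ℝ) T => f t) ∧ normW01 α T f < ∞

end FunctionSpaces

section StieltjesIntegral

/-- The left-sided Weyl (Marchaud) fractional derivative of order `α` on `(a, ·)`:
`D_{a+}^α f (x) = Γ(1-α)⁻¹ ( f(x) / (x-a)^α + α ∫_a^x (f(x) - f(y)) / (x-y)^{α+1} dy )`. -/
def leftFracDeriv (α a : ℝ) (f : ℝ → ℝ) (x : ℝ) : ℝ :=
  (Real.Gamma (1 - α))⁻¹ *
    (f x / (x - a) ^ α + α * ∫ y in a..x, (f x - f y) / (x - y) ^ (α + 1))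

/-- The right-sided Weyl (Marchaud) fractional derivative of order `α` on `(·, b)`, without its
conventional factor `(-1)^α`:
`Γ(1-α)⁻¹ ( f(x) / (b-x)^α + α ∫_x^b (f(x) - f(y)) / (y-x)^{α+1} dy )`. -/
def rightFracDeriv (α b : ℝ) (f : ℝ → ℝ) (x : ℝ) : ℝ :=
  (Real.Gamma (1 - α))⁻¹ *
    (f x / (b - x) ^ α + α * ∫ y in x..b, (f x - f y) / (y - x) ^ (α + 1))

/-- Zähle's generalized Stieltjes integral
`∫_a^b f dg = (-1)^α ∫_a^b D_{a+}^α f (x) D_{b-}^{1-α} g_{b-} (x) dx`, where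
`g_{b-}(x) = g(x) - g(b-)`. The factor `(-1)^α` and the factor `(-1)^{1-α}` of `D_{b-}^{1-α}`
multiply to `-1`. -/
def zahleIntegral (α a b : ℝ) (f g : ℝ → ℝ) : ℝ :=
  -∫ x in a..b,
    leftFracDeriv α a f x * rightFracDeriv (1 - α) b (fun u => g u - Function.leftLim g b) x

/-- `∫_0^t f dg = ∫_0^T f 1_{(0,t)} dg`, for functions `f`, `g` on `[0,T]`. -/
def stieltjesUpTo (α T t : ℝ) (f g : ℝ → ℝ) : ℝ :=
  zahleIntegral α 0 T ((Ioo 0 t).indicator f) g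

/-- `∫_0^t A(s) dg_s` for a matrix-valued `A` and a vector-valued `g`: the vector whose
`i`-th coordinate is `∑ j, ∫_0^t A_{ij}(s) dg^j_s`. -/
def matrixStieltjesUpTo {d m : ℕ} (α T t : ℝ) (A : ℝ → Matrix (Fin d) (Fin m) ℝ)
    (g : ℝ → E m) : E d :=
  WithLp.toLp 2 fun i => ∑ j, stieltjesUpTo α T t (fun s => A s i j) (fun s => g s j)

end StieltjesIntegral

section Hypotheses

attribute [local instance] Matrix.frobeniusNormedAddCommGroup

variable {d m : ℕ}

/-- `∂_t σ(t,s,x)` (one-sided at the endpoints of `[0,T]`), entry by entry. -/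
def partialT (T : ℝ) (σ : ℝ → ℝ → E d → Matrix (Fin d) (Fin m) ℝ)
    (t s : ℝ) (x : E d) : Matrix (Fin d) (Fin m) ℝ :=
  Matrix.of fun k j => derivWithin (fun r => σ r s x k j) (Icc 0 T) t

/-- `∂_{x_i} σ(t,s,x)`, entry by entry. -/
def partialX (i : Fin d) (σ : ℝ → ℝ → E d → Matrix (Fin d) (Fin m) ℝ)
    (t s : ℝ) (x : E d) : Matrix (Fin d) (Fin m) ℝ :=
  Matrix.of fun k j => lineDeriv ℝ (fun z => σ t s z k j) x (EuclideanSpace.single i 1)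

/-- `∂²_{x_i,t} σ = ∂_{x_i} (∂_t σ)`. -/
def partialXT (T : ℝ) (i : Fin d) (σ : ℝ → ℝ → E d → Matrix (Fin d) (Fin m) ℝ) :
    ℝ → ℝ → E d → Matrix (Fin d) (Fin m) ℝ :=
  partialX i (partialT T σ)

/-- Hypothesis (H1) on the coefficient `σ : [0,T]² × ℝ^d → ℝ^{d×m}`; `‖·‖` on matrices is the
Euclidean (Frobenius) norm. -/
structure HypH1 (T β μ δ : ℝ) (σ : ℝ → ℝ → E d → Matrix (Fin d) (Fin m) ℝ) : Prop where
  β_pos : 0 < β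
  β_le : β ≤ 1
  μ_pos : 0 < μ
  μ_le : μ ≤ 1
  δ_pos : 0 < δ
  δ_le : δ ≤ 1
  measurable : ∀ k j,
    Measurable fun p : Icc (0 : ℝ) T × Icc (0 : ℝ) T × E d => σ p.1 p.2.1 p.2.2 k j
  exists_partialT : ∀ t ∈ Icc 0 T, ∀ s ∈ Icc 0 T, ∀ x k j,
    DifferentiableWithinAt ℝ (fun r => σ r s x k j) (Icc 0 T) t
  exists_partialX : ∀ t ∈ Icc 0 T, ∀ s ∈ Icc 0 T, ∀ x (i : Fin d) k j,
    LineDifferentiableAt ℝ (fun z => σ t s z k j) x (EuclideanSpace.single i 1)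
  exists_partialXT : ∀ t ∈ Icc 0 T, ∀ s ∈ Icc 0 T, ∀ x (i : Fin d) k j,
    LineDifferentiableAt ℝ (fun z => partialT T σ t s z k j) x (EuclideanSpace.single i 1)
  exists_const : ∃ K : ℝ, 0 < K ∧
    (∀ t ∈ Icc 0 T, ∀ s ∈ Icc 0 T, ∀ x y,
      ‖σ t s x - σ t s y‖ + ‖partialT T σ t s x - partialT T σ t s y‖ ≤ K * ‖x - y‖) ∧
    (∀ t₁ ∈ Icc 0 T, ∀ t₂ ∈ Icc 0 T, ∀ s ∈ Icc 0 T, ∀ x (i : Fin d),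
      ‖σ t₁ s x - σ t₂ s x‖ + ‖partialX i σ t₁ s x - partialX i σ t₂ s x‖
        ≤ K * |t₁ - t₂| ^ μ) ∧
    (∀ t ∈ Icc 0 T, ∀ s₁ ∈ Icc 0 T, ∀ s₂ ∈ Icc 0 T, ∀ x,
      ‖σ t s₁ x - σ t s₂ x‖ + ‖partialT T σ t s₁ x - partialT T σ t s₂ x‖
        ≤ K * |s₁ - s₂| ^ β) ∧
    (∀ t ∈ Icc 0 T, ∀ s₁ ∈ Icc 0 T, ∀ s₂ ∈ Icc 0 T, ∀ x (i : Fin d),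
      ‖partialXT T i σ t s₁ x - partialXT T i σ t s₂ x‖
          + ‖partialX i σ t s₁ x - partialX i σ t s₂ x‖
        ≤ K * |s₁ - s₂| ^ β)
  exists_localConst : ∀ N : ℝ, 0 ≤ N → ∃ KN : ℝ, 0 < KN ∧
    ∀ t ∈ Icc 0 T, ∀ s ∈ Icc 0 T, ∀ x y, ‖x‖ ≤ N → ‖y‖ ≤ N → ∀ i : Fin d,
      ‖partialX i σ t s x - partialX i σ t s y‖
          + ‖partialXT T i σ t s x - partialXT T i σ t s y‖
        ≤ KN * ‖x - y‖ ^ δ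

/-- Hypothesis (H2) on the coefficient `b : [0,T]² × ℝ^d → ℝ^d`. -/
structure HypH2 (T ρ μ : ℝ) (b : ℝ → ℝ → E d → E d) : Prop where
  ρ_ge : 2 ≤ ρ
  μ_pos : 0 < μ
  μ_le : μ ≤ 1
  measurable :
    Measurable fun p : Icc (0 : ℝ) T × Icc (0 : ℝ) T × E d => b p.1 p.2.1 p.2.2
  exists_holderConst : ∃ L : ℝ, 0 < L ∧
    ∀ t₁ ∈ Icc 0 T, ∀ t₂ ∈ Icc 0 T, ∀ s ∈ Icc 0 T, ∀ x,
      ‖b t₁ s x - b t₂ s x‖ ≤ L * |t₁ - t₂| ^ μ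
  exists_growth : ∃ (L₀ : ℝ) (b₀ : ℝ → ℝ → ℝ), 0 < L₀ ∧
    MemLp (fun p : ℝ × ℝ => b₀ p.1 p.2) (ENNReal.ofReal ρ)
      (volume.restrict (Icc 0 T ×ˢ Icc 0 T)) ∧
    ∀ t ∈ Icc 0 T, ∀ s ∈ Icc 0 T, ∀ x, ‖b t s x‖ ≤ L₀ * ‖x‖ + b₀ t s
  exists_localConst : ∀ N : ℝ, 0 ≤ N → ∃ LN : ℝ, 0 < LN ∧
    (∀ t ∈ Icc 0 T, ∀ s ∈ Icc 0 T, ∀ x y, ‖x‖ ≤ N → ‖y‖ ≤ N →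
      ‖b t s x - b t s y‖ ≤ LN * ‖x - y‖) ∧
    (∀ t₁ ∈ Icc 0 T, ∀ t₂ ∈ Icc 0 T, ∀ s ∈ Icc 0 T, ∀ x₁ x₂, ‖x₁‖ ≤ N → ‖x₂‖ ≤ N →
      ‖b t₁ s x₁ - b t₁ s x₂ - b t₂ s x₁ + b t₂ s x₂‖ ≤ LN * |t₁ - t₂| * ‖x₁ - x₂‖)

end Hypotheses

/-- `x` solves `x(t) = x₀ + ∫_0^t b(t,s,x(s)) ds + ∫_0^t σ(t,s,x(s)) dg_s` for all `t ∈ [0,T]`,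
both integrals being well defined. -/
structure IsSolution {d m : ℕ} (α T : ℝ) (b : ℝ → ℝ → E d → E d)
    (σ : ℝ → ℝ → E d → Matrix (Fin d) (Fin m) ℝ) (g : ℝ → E m) (x₀ : E d)
    (x : ℝ → E d) : Prop where
  drift_integrable : ∀ t ∈ Icc 0 T, IntervalIntegrable (fun s => b t s (x s)) volume 0 t
  diffusion_mem : ∀ t ∈ Icc 0 T, ∀ i j, MemW01 α T (fun s => σ t s (x s) i j)
  equation : ∀ t ∈ Icc 0 T,
    x t = x₀ + (∫ s in (0 : ℝ)..t, b t s (x s)) +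
      matrixStieltjesUpTo α T t (fun s => σ t s (x s)) g

end Volterra

end

/-!
The proof is a Picard iteration carried out entirely in Hölder spaces.

Fix `γ` with `α < γ < 1 - α`, `γ ≤ β` and `γ ≤ (1 - α) δ`; this is possible because
`α < min {1/2, β, δ / (1 + δ)}`. The generalized Stieltjes integral `∫_0^T F dg` pairs
`D_{0+}^α F` with the fractional derivative of `g`, which is bounded for `g` of class
`W_T^{1-α,∞}` (`MemWT.fracIntegrator`), so only `∫_0^T |D_{0+}^α F|` has to be estimated. For
`F = f 1_{(s,t)}`, with `f` and its `γ`-Hölder quotient bounded by `A (t-r)^{-κ}` at `r`, this is at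
most a constant times `A (t-s)^{1-α-κ}` (`lintegral_leftFracMajorant_indicator_le`). The
contribution of the points `x > t`, where `F` vanishes but `D_{0+}^α F` does not, is covered by
the same bound, and therefore the identity `∫_0^T f 1_{(s,t)} dg = ∫_s^t f dg` is never needed.

Hölder bounds carry weights `a₀ + a₁ e^{λr}`. Since `e^{λr} ≤ λ^{-κ} e^{λt} (t-r)^{-κ}` for `r < t`
(`exp_le_rpow_mul_exp`), integration gains the factor `λ^{-κ}`. With `κ = 1 - α - γ` the weighted
`γ`-Hölder norm of the right-hand side of the equation is controlled by that of `x` with a factor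
that is small for large `λ`. As the coefficients grow linearly, a ball of this norm is invariant,
and with `κ = 0` its image is bounded in `C^{1-α}` (`exists_picard_invariant`). On functions with a
common `(1-α)`-Hölder constant, differences contract for another, larger `λ`
(`exists_picard_contraction`). Here the second-order differences of `σ` and of `∂_t σ` enter
(`abs_four_point_le`): the Hölder continuity of the partial derivatives produces
`|x(r) - x(u)|^δ ≤ C (r-u)^{(1-α)δ}`, which is admissible because `(1-α)δ ≥ γ`.

The drift is handled by Hölder's inequality in `L^{1/α}`, after replacing `b₀(t,s)` by a bound
`h(s)` independent of `t` (`HypH2.exists_uniform_growth`).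
-/

namespace Volterra

/-! ### Integrals of power functions -/

theorem lintegral_Ioo_rpow_sub_left {a b p : ℝ} (hab : a ≤ b) (hp : -1 < p) :
    ∫⁻ y in Ioo a b, ENNReal.ofReal ((b - y) ^ p)
      = ENNReal.ofReal ((b - a) ^ (p + 1) / (p + 1)) := by
  have hint : IntervalIntegrable (fun y => (b - y) ^ p) volume a b := by
    have := (intervalIntegral.intervalIntegrable_rpow' (a := b - a) (b := 0) hp).comp_sub_left b
    simpa using this
  have hI : ∫ y in a..b, (b - y) ^ p = (b - a) ^ (p + 1) / (p + 1) := by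
    rw [intervalIntegral.integral_comp_sub_left (fun x => x ^ p) b, integral_rpow (Or.inl hp)]
    simp [Real.zero_rpow (by linarith : p + 1 ≠ 0)]
  rw [← ofReal_integral_eq_lintegral_ofReal, ← integral_Ioc_eq_integral_Ioo,
    ← intervalIntegral.integral_of_le hab, hI]
  · exact ((intervalIntegrable_iff_integrableOn_Ioc_of_le hab).1 hint).mono_set Ioo_subset_Ioc_self
  · refine (ae_restrict_iff' measurableSet_Ioo).2 (Filter.Eventually.of_forall fun y hy => ?_)
    exact Real.rpow_nonneg (by linarith [hy.2]) _

theorem lintegral_Ioo_rpow_sub_right {a b p : ℝ} (hab : a ≤ b) (hp : -1 < p) :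
    ∫⁻ y in Ioo a b, ENNReal.ofReal ((y - a) ^ p)
      = ENNReal.ofReal ((b - a) ^ (p + 1) / (p + 1)) := by
  have hint : IntervalIntegrable (fun y => (y - a) ^ p) volume a b := by
    have := (intervalIntegral.intervalIntegrable_rpow' (a := 0) (b := b - a) hp).comp_sub_right a
    simpa using this
  have hI : ∫ y in a..b, (y - a) ^ p = (b - a) ^ (p + 1) / (p + 1) := by
    rw [intervalIntegral.integral_comp_sub_right (fun x => x ^ p) a, integral_rpow (Or.inl hp)]
    simp [Real.zero_rpow (by linarith : p + 1 ≠ 0)]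
  rw [← ofReal_integral_eq_lintegral_ofReal, ← integral_Ioc_eq_integral_Ioo,
    ← intervalIntegral.integral_of_le hab, hI]
  · exact ((intervalIntegrable_iff_integrableOn_Ioc_of_le hab).1 hint).mono_set Ioo_subset_Ioc_self
  · refine (ae_restrict_iff' measurableSet_Ioo).2 (Filter.Eventually.of_forall fun y hy => ?_)
    exact Real.rpow_nonneg (by linarith [hy.1]) _

theorem lintegral_Ioo_rpow_singular_right_le {α y t T : ℝ} (hα : 0 < α) (hyt : y < t) :
    ∫⁻ x in Ioo t T, ENNReal.ofReal ((x - y) ^ (-(α + 1)))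
      ≤ ENNReal.ofReal ((t - y) ^ (-α) / α) := by
  rcases le_or_gt T t with h | h
  · simp [Ioo_eq_empty_of_le h]
  have h0 : (0 : ℝ) ∉ uIcc (t - y) (T - y) := by
    rw [uIcc_of_le (by linarith)]; intro hh; linarith [hh.1]
  have hint : IntervalIntegrable (fun x => (x - y) ^ (-(α + 1))) volume t T := by
    have := (intervalIntegral.intervalIntegrable_rpow (r := -(α + 1)) (μ := volume)
      (Or.inr h0)).comp_sub_right y
    simpa using this
  have hI : ∫ x in t..T, (x - y) ^ (-(α + 1)) ≤ (t - y) ^ (-α) / α := by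
    rw [intervalIntegral.integral_comp_sub_right (fun x => x ^ (-(α + 1))) y,
      integral_rpow (Or.inr ⟨by linarith, h0⟩)]
    have e : -(α + 1) + 1 = -α := by ring
    rw [e, div_neg, ← neg_div, neg_sub]
    gcongr
    linarith [Real.rpow_nonneg (by linarith : 0 ≤ T - y) (-α)]
  rw [← ofReal_integral_eq_lintegral_ofReal, ← integral_Ioc_eq_integral_Ioo,
    ← intervalIntegral.integral_of_le h.le]
  · exact ENNReal.ofReal_le_ofReal hI
  · exact ((intervalIntegrable_iff_integrableOn_Ioc_of_le h.le).1 hint).mono_set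
      Ioo_subset_Ioc_self
  · refine (ae_restrict_iff' measurableSet_Ioo).2 (Filter.Eventually.of_forall fun x hx => ?_)
    exact Real.rpow_nonneg (by linarith [hx.1]) _

theorem lintegral_Ioo_rpow_singular_left_le {α a c x : ℝ} (hα : 0 < α) (hcx : c < x) :
    ∫⁻ y in Ioo a c, ENNReal.ofReal ((x - y) ^ (-(α + 1)))
      ≤ ENNReal.ofReal ((x - c) ^ (-α) / α) := by
  have h := lintegral_Ioo_rpow_singular_right_le (T := -a) hα (neg_lt_neg hcx)
  have e : -c - -x = x - c := by ring
  rw [e] at h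
  refine le_trans (le_of_eq ?_) h
  rw [← lintegral_indicator measurableSet_Ioo, ← lintegral_indicator measurableSet_Ioo,
    ← lintegral_neg_eq_self]
  congr 1
  ext y
  by_cases hy : y ∈ Ioo (-c) (-a)
  · rw [indicator_of_mem hy, indicator_of_mem (by constructor <;> linarith [hy.1, hy.2])]
    congr 2; ring
  · rw [indicator_of_notMem hy, indicator_of_notMem]
    rintro ⟨h1, h2⟩
    exact hy ⟨by linarith, by linarith⟩

theorem rpow_neg_mul_rpow_neg_le {x y a b : ℝ} (hx : 0 < x) (hy : 0 < y) (ha : 0 ≤ a)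
    (hb : 0 ≤ b) : x ^ (-a) * y ^ (-b) ≤ x ^ (-(a + b)) + y ^ (-(a + b)) := by
  have e1 : x ^ (-(a + b)) = x ^ (-a) * x ^ (-b) := by
    rw [← Real.rpow_add hx]; ring_nf
  have e2 : y ^ (-(a + b)) = y ^ (-a) * y ^ (-b) := by
    rw [← Real.rpow_add hy]; ring_nf
  rcases le_total x y with h | h
  · have : y ^ (-b) ≤ x ^ (-b) := Real.rpow_le_rpow_of_nonpos hx h (by linarith)
    have := mul_le_mul_of_nonneg_left this (Real.rpow_nonneg hx.le (-a))
    linarith [Real.rpow_nonneg hy.le (-(a + b))]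
  · have : x ^ (-a) ≤ y ^ (-a) := Real.rpow_le_rpow_of_nonpos hy h (by linarith)
    have := mul_le_mul_of_nonneg_right this (Real.rpow_nonneg hy.le (-b))
    linarith [Real.rpow_nonneg hx.le (-(a + b))]

theorem lintegral_Ioo_rpow_mul_rpow_le {a b p q : ℝ} (hab : a ≤ b) (hp : 0 ≤ p) (hq : 0 ≤ q)
    (hpq : p + q < 1) :
    ∫⁻ y in Ioo a b, ENNReal.ofReal ((b - y) ^ (-p) * (y - a) ^ (-q))
      ≤ ENNReal.ofReal (2 / (1 - p - q) * (b - a) ^ (1 - p - q)) := by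
  calc ∫⁻ y in Ioo a b, ENNReal.ofReal ((b - y) ^ (-p) * (y - a) ^ (-q))
      ≤ ∫⁻ y in Ioo a b, (ENNReal.ofReal ((b - y) ^ (-(p + q)))
          + ENNReal.ofReal ((y - a) ^ (-(p + q)))) := by
        refine setLIntegral_mono (by fun_prop) fun y hy => ?_
        have h1 : 0 < b - y := by linarith [hy.2]
        have h2 : 0 < y - a := by linarith [hy.1]
        rw [← ENNReal.ofReal_add (by positivity) (by positivity)]
        exact ENNReal.ofReal_le_ofReal (rpow_neg_mul_rpow_neg_le h1 h2 hp hq)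
    _ = _ := by
        rw [lintegral_add_left (by fun_prop), lintegral_Ioo_rpow_sub_left hab (by linarith),
          lintegral_Ioo_rpow_sub_right hab (by linarith), ← ENNReal.ofReal_add]
        · have e : -(p + q) + 1 = 1 - p - q := by ring
          rw [e]; congr 1; ring
        all_goals
          exact div_nonneg (Real.rpow_nonneg (by linarith) _) (by linarith)

/-! ### The left-sided fractional derivative of a truncated function -/

/-- The majorant `|F(x)| x^{-α} + α ∫_0^x |F(x) - F(y)| (x-y)^{-α-1} dy` of
`Γ(1-α) |D_{0+}^α F(x)|`. -/
noncomputable def leftFracMajorant (α : ℝ) (F : ℝ → ℝ) (x : ℝ) : ℝ≥0∞ :=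
  ‖F x‖ₑ * ENNReal.ofReal (x ^ (-α))
    + ENNReal.ofReal α * ∫⁻ y in Ioo 0 x, ‖(F x - F y) / (x - y) ^ (α + 1)‖ₑ

theorem enorm_leftFracDeriv_le {α x : ℝ} (hα : 0 < α) (hα1 : α < 1) (hx : 0 < x) (F : ℝ → ℝ) :
    ‖leftFracDeriv α 0 F x‖ₑ
      ≤ ENNReal.ofReal (Real.Gamma (1 - α))⁻¹ * leftFracMajorant α F x := by
  have hΓ : 0 < (Real.Gamma (1 - α))⁻¹ := inv_pos.2 (Real.Gamma_pos_of_pos (by linarith))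
  unfold leftFracDeriv leftFracMajorant
  rw [enorm_mul, Real.enorm_of_nonneg hΓ.le]
  gcongr
  refine (enorm_add_le _ _).trans ?_
  rw [sub_zero, div_eq_mul_inv, ← Real.rpow_neg hx.le, enorm_mul, enorm_mul,
    Real.enorm_of_nonneg (Real.rpow_nonneg hx.le _), Real.enorm_of_nonneg hα.le]
  gcongr
  rw [intervalIntegral.integral_of_le hx.le, integral_Ioc_eq_integral_Ioo]
  exact enorm_integral_le_lintegral_enorm _

theorem enorm_div_rpow_le {a c z p : ℝ} (hz : 0 < z) (h : |a| ≤ c) :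
    ‖a / z ^ p‖ₑ ≤ ENNReal.ofReal (c * z ^ (-p)) := by
  rw [div_eq_mul_inv, ← Real.rpow_neg hz.le, ← ofReal_norm, norm_mul, Real.norm_eq_abs,
    Real.norm_of_nonneg (Real.rpow_nonneg hz.le _)]
  exact ENNReal.ofReal_le_ofReal (mul_le_mul_of_nonneg_right h (Real.rpow_nonneg hz.le _))

section Majorant

variable {α γ κ T s t A : ℝ} {f : ℝ → ℝ}

theorem leftFracMajorant_indicator_of_lt {x : ℝ} (hx : x < s) :
    leftFracMajorant α ((Ioo s t).indicator f) x = 0 := by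
  have h : ∀ y ≤ x, (Ioo s t).indicator f y = 0 := fun y hy =>
    indicator_of_notMem (fun hh => by linarith [hh.1]) _
  unfold leftFracMajorant
  rw [setLIntegral_congr_fun (g := fun _ => 0) measurableSet_Ioo]
  · simp [h x le_rfl]
  · intro y hy
    simp [h x le_rfl, h y hy.2.le]

theorem leftFracMajorant_indicator_of_mem {x : ℝ} (hα : 0 < α) (hγ : α < γ) (hs : 0 ≤ s)
    (ht : t ≤ T) (hx : x ∈ Ioo s t) (hA : 0 ≤ A)
    (hf : |f x| ≤ A) (hf' : ∀ u ∈ Ioo s x, |f x - f u| ≤ A * (x - u) ^ γ) :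
    leftFracMajorant α ((Ioo s t).indicator f) x
      ≤ ENNReal.ofReal ((2 + α * T ^ γ / (γ - α)) * A * (x - s) ^ (-α)) := by
  have hxs : 0 < x - s := by linarith [hx.1]
  have hx0 : 0 < x := by linarith
  have hga : 0 < γ - α := by linarith
  have hp : 0 ≤ (x - s) ^ (-α) := Real.rpow_nonneg hxs.le _
  have h1 : ∫⁻ y in Ioo 0 s, ‖((Ioo s t).indicator f x - (Ioo s t).indicator f y)
      / (x - y) ^ (α + 1)‖ₑ ≤ ENNReal.ofReal (A * ((x - s) ^ (-α) / α)) := by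
    calc _ ≤ ∫⁻ y in Ioo 0 s, ENNReal.ofReal A * ENNReal.ofReal ((x - y) ^ (-(α + 1))) := by
          refine setLIntegral_mono (by fun_prop) fun y hy => ?_
          rw [indicator_of_mem hx, indicator_of_notMem (fun hh => by linarith [hh.1, hy.2]),
            sub_zero, ← ENNReal.ofReal_mul hA]
          exact enorm_div_rpow_le (by linarith [hy.2]) hf
      _ ≤ _ := by
          rw [lintegral_const_mul _ (by fun_prop), ENNReal.ofReal_mul hA]
          gcongr
          exact lintegral_Ioo_rpow_singular_left_le hα hx.1
  have h2 : ∫⁻ y in Ioo s x, ‖((Ioo s t).indicator f x - (Ioo s t).indicator f y)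
      / (x - y) ^ (α + 1)‖ₑ ≤ ENNReal.ofReal (A * ((x - s) ^ (γ - α) / (γ - α))) := by
    calc _ ≤ ∫⁻ y in Ioo s x, ENNReal.ofReal A * ENNReal.ofReal ((x - y) ^ (γ - α - 1)) := by
          refine setLIntegral_mono (by fun_prop) fun y hy => ?_
          have hxy : 0 < x - y := by linarith [hy.2]
          rw [indicator_of_mem hx,
            indicator_of_mem (show y ∈ Ioo s t from ⟨hy.1, hy.2.trans hx.2⟩),
            ← ENNReal.ofReal_mul hA]
          refine (enorm_div_rpow_le hxy (hf' y hy)).trans (le_of_eq ?_)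
          rw [mul_assoc, ← Real.rpow_add hxy]
          ring_nf
      _ = _ := by
          rw [lintegral_const_mul _ (by fun_prop),
            lintegral_Ioo_rpow_sub_left hx.1.le (by linarith), ENNReal.ofReal_mul hA]
          ring_nf
  have h3 : ∫⁻ y in Ioo 0 x, ‖((Ioo s t).indicator f x - (Ioo s t).indicator f y)
      / (x - y) ^ (α + 1)‖ₑ ≤ ENNReal.ofReal (A * ((x - s) ^ (-α) / α)) +
        ENNReal.ofReal (A * ((x - s) ^ (γ - α) / (γ - α))) := by
    refine le_trans ?_ (add_le_add h1 h2)
    rw [setLIntegral_congr (Ioo_ae_eq_Ioc (a := (0 : ℝ)) (b := s))]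
    refine (lintegral_mono_set ?_).trans (lintegral_union_le _ _ _)
    intro y hy
    rcases le_or_gt y s with h | h
    · exact Or.inl ⟨hy.1, h⟩
    · exact Or.inr ⟨h, hy.2⟩
  have h4 : ‖(Ioo s t).indicator f x‖ₑ * ENNReal.ofReal (x ^ (-α))
      ≤ ENNReal.ofReal (A * (x - s) ^ (-α)) := by
    rw [indicator_of_mem hx, ENNReal.ofReal_mul hA, ← ofReal_norm]
    exact mul_le_mul' (ENNReal.ofReal_le_ofReal hf) (ENNReal.ofReal_le_ofReal
      (Real.rpow_le_rpow_of_nonpos hxs (by linarith) (by linarith)))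
  have h5 : (x - s) ^ (γ - α) ≤ T ^ γ * (x - s) ^ (-α) := by
    rw [sub_eq_add_neg γ, Real.rpow_add hxs]
    exact mul_le_mul_of_nonneg_right
      (Real.rpow_le_rpow hxs.le (by linarith [hx.2]) (by linarith)) hp
  unfold leftFracMajorant
  refine (add_le_add h4 (mul_le_mul' le_rfl h3)).trans ?_
  rw [← ENNReal.ofReal_add (by positivity) (by positivity), ← ENNReal.ofReal_mul hα.le,
    ← ENNReal.ofReal_add (by positivity) (by positivity)]
  refine ENNReal.ofReal_le_ofReal ?_
  have e1 : α * (A * ((x - s) ^ (-α) / α) + A * ((x - s) ^ (γ - α) / (γ - α)))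
      = A * (x - s) ^ (-α) + α * A / (γ - α) * (x - s) ^ (γ - α) := by
    field_simp
  have h6 := mul_le_mul_of_nonneg_left h5 (show 0 ≤ α * A / (γ - α) by positivity)
  have e2 : (2 + α * T ^ γ / (γ - α)) * A * (x - s) ^ (-α) = A * (x - s) ^ (-α) +
      (A * (x - s) ^ (-α) + α * A / (γ - α) * (T ^ γ * (x - s) ^ (-α))) := by ring
  rw [e1, e2]
  linarith

theorem leftFracMajorant_indicator_of_gt {x : ℝ} (hs : 0 ≤ s) (hx : t < x)
    (hf : ∀ r ∈ Ioo s t, |f r| ≤ A * (t - r) ^ (-κ)) :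
    leftFracMajorant α ((Ioo s t).indicator f) x
      ≤ ENNReal.ofReal α * ∫⁻ y in Ioo s t, ENNReal.ofReal (A * (t - y) ^ (-κ)) *
          ENNReal.ofReal ((x - y) ^ (-(α + 1))) := by
  have hx' : (Ioo s t).indicator f x = 0 := indicator_of_notMem (fun hh => by linarith [hh.2]) _
  unfold leftFracMajorant
  rw [hx', enorm_zero, zero_mul, zero_add]
  refine mul_le_mul' le_rfl ?_
  rw [← lintegral_indicator measurableSet_Ioo, ← lintegral_indicator measurableSet_Ioo]
  refine lintegral_mono fun y => ?_
  by_cases hy : y ∈ Ioo s t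
  · rw [indicator_of_mem (s := Ioo s t) hy, indicator_of_mem (s := Ioo 0 x)
      ⟨hs.trans_lt hy.1, hy.2.trans hx⟩]
    have h0 : 0 ≤ A * (t - y) ^ (-κ) := (abs_nonneg _).trans (hf y hy)
    rw [zero_sub, indicator_of_mem hy, ← ENNReal.ofReal_mul h0]
    exact enorm_div_rpow_le (by linarith [hy.2]) (by rw [abs_neg]; exact hf y hy)
  · rw [indicator_of_notMem (s := Ioo s t) hy]
    by_cases hy' : y ∈ Ioo 0 x
    · rw [indicator_of_mem hy', indicator_of_notMem hy]
      simp
    · rw [indicator_of_notMem hy']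

/-- The tail `x > t`, where the truncated function vanishes but its fractional derivative does
not. Tonelli's theorem turns it into an integral over `(s, t)` with weight `(t-y)^{-α}`. -/
theorem lintegral_tail_le (hα : 0 < α) (hακ : α + κ < 1) (hst : s < t) (hA : 0 ≤ A) :
    ∫⁻ x in Ioo t T, ENNReal.ofReal α * ∫⁻ y in Ioo s t, ENNReal.ofReal (A * (t - y) ^ (-κ)) *
          ENNReal.ofReal ((x - y) ^ (-(α + 1)))
      ≤ ENNReal.ofReal (1 / (1 - α - κ) * A * (t - s) ^ (1 - α - κ)) := by
  rw [lintegral_const_mul' _ _ ENNReal.ofReal_ne_top, lintegral_lintegral_swap]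
  swap
  · refine Measurable.aemeasurable ?_
    unfold Function.uncurry
    fun_prop
  calc _ ≤ ENNReal.ofReal α * ∫⁻ y in Ioo s t, ENNReal.ofReal (A / α) *
          ENNReal.ofReal ((t - y) ^ (-(α + κ))) := by
        refine mul_le_mul' le_rfl ?_
        refine setLIntegral_mono (by fun_prop) fun y hy => ?_
        have hty : 0 < t - y := by linarith [hy.2]
        rw [lintegral_const_mul' _ _ ENNReal.ofReal_ne_top]
        refine (mul_le_mul' le_rfl (lintegral_Ioo_rpow_singular_right_le hα hy.2)).trans
          (le_of_eq ?_)
        rw [← ENNReal.ofReal_mul (by positivity), ← ENNReal.ofReal_mul (by positivity)]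
        congr 1
        rw [neg_add, Real.rpow_add hty]
        ring
    _ = _ := by
        rw [lintegral_const_mul _ (by fun_prop), lintegral_Ioo_rpow_sub_left hst.le (by linarith),
          ← ENNReal.ofReal_mul (by positivity), ← ENNReal.ofReal_mul hα.le]
        congr 1
        have e : -(α + κ) + 1 = 1 - α - κ := by ring
        rw [e]
        field_simp

/-- The total mass of the fractional derivative of `f 1_{(s,t)}`, for `f` and its `γ`-Hölder
constant bounded by the weight `A (t-r)^{-κ}`. -/
theorem lintegral_leftFracMajorant_indicator_le (hα : 0 < α) (hγ : α < γ) (hκ : 0 ≤ κ)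
    (hακ : α + κ < 1) (hs : 0 ≤ s) (hst : s < t) (ht : t ≤ T) (hA : 0 ≤ A)
    (hf : ∀ r ∈ Ioo s t, |f r| ≤ A * (t - r) ^ (-κ))
    (hf' : ∀ r ∈ Ioo s t, ∀ u ∈ Ioo s r, |f r - f u| ≤ A * (t - r) ^ (-κ) * (r - u) ^ γ) :
    ∫⁻ x in Ioo 0 T, leftFracMajorant α ((Ioo s t).indicator f) x
      ≤ ENNReal.ofReal (((2 + α * T ^ γ / (γ - α)) * 2 + 1) / (1 - α - κ) * A
          * (t - s) ^ (1 - α - κ)) := by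
  have hT : 0 ≤ T := by linarith
  have hga : 0 < γ - α := by linarith
  have hk : 0 < 1 - α - κ := by linarith
  have hts : 0 < t - s := by linarith
  set c := 2 + α * T ^ γ / (γ - α) with hc
  have hc0 : 0 ≤ c := by positivity
  have h1 : ∫⁻ x in Ioo 0 s, leftFracMajorant α ((Ioo s t).indicator f) x = 0 := by
    rw [setLIntegral_congr_fun (g := fun _ => 0) measurableSet_Ioo]
    · simp
    · intro x hx
      exact leftFracMajorant_indicator_of_lt hx.2
  have h2 : ∫⁻ x in Ioo s t, leftFracMajorant α ((Ioo s t).indicator f) x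
      ≤ ENNReal.ofReal (c * A * (2 / (1 - α - κ) * (t - s) ^ (1 - α - κ))) := by
    calc _ ≤ ∫⁻ x in Ioo s t, ENNReal.ofReal (c * A) *
            ENNReal.ofReal ((t - x) ^ (-κ) * (x - s) ^ (-α)) := by
          refine setLIntegral_mono (by fun_prop) fun x hx => ?_
          have htx : 0 < t - x := by linarith [hx.2]
          refine (leftFracMajorant_indicator_of_mem hα hγ hs ht hx (by positivity)
            (hf x hx) (hf' x hx)).trans (le_of_eq ?_)
          rw [← ENNReal.ofReal_mul (by positivity)]
          congr 1
          ring
      _ ≤ _ := by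
          rw [lintegral_const_mul _ (by fun_prop), ENNReal.ofReal_mul (mul_nonneg hc0 hA)]
          refine mul_le_mul' le_rfl ?_
          refine (lintegral_Ioo_rpow_mul_rpow_le hst.le hκ hα.le (by linarith)).trans
            (le_of_eq ?_)
          rw [sub_right_comm]
  have h3 : ∫⁻ x in Ioo t T, leftFracMajorant α ((Ioo s t).indicator f) x
      ≤ ENNReal.ofReal (1 / (1 - α - κ) * A * (t - s) ^ (1 - α - κ)) := by
    refine le_trans (setLIntegral_mono' measurableSet_Ioo fun x hx =>
      leftFracMajorant_indicator_of_gt hs hx.1 hf) ?_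
    exact lintegral_tail_le hα hακ hst hA
  calc _ ≤ ∫⁻ x in Ioc 0 s ∪ (Ioc s t ∪ Ioo t T),
          leftFracMajorant α ((Ioo s t).indicator f) x := by
        refine lintegral_mono_set fun x hx => ?_
        rcases le_or_gt x s with h | h
        · exact Or.inl ⟨hx.1, h⟩
        rcases le_or_gt x t with h' | h'
        · exact Or.inr (Or.inl ⟨h, h'⟩)
        · exact Or.inr (Or.inr ⟨h', hx.2⟩)
    _ ≤ 0 + (ENNReal.ofReal (c * A * (2 / (1 - α - κ) * (t - s) ^ (1 - α - κ)))
          + ENNReal.ofReal (1 / (1 - α - κ) * A * (t - s) ^ (1 - α - κ))) := by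
        refine (lintegral_union_le _ _ _).trans (add_le_add ?_
          ((lintegral_union_le _ _ _).trans (add_le_add ?_ h3)))
        · rw [setLIntegral_congr (Ioo_ae_eq_Ioc (a := (0 : ℝ)) (b := s)).symm, h1]
        · rwa [setLIntegral_congr (Ioo_ae_eq_Ioc (a := s) (b := t)).symm]
    _ = _ := by
        rw [zero_add, ← ENNReal.ofReal_add (by positivity) (by positivity)]
        congr 1
        ring

end Majorant

/-! ### Linearity and boundedness of the generalized Stieltjes integral -/

section Regular

variable {α T : ℝ} {F G : ℝ → ℝ}

/-- Integrands on which the generalized Stieltjes integral is linear: the fractional derivative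
is integrable on `(0,T)`, and the integral defining it converges absolutely almost everywhere. -/
structure FracIntegrable (α T : ℝ) (F : ℝ → ℝ) : Prop where
  inner : ∀ᵐ x ∂volume.restrict (Ioo 0 T),
    IntegrableOn (fun y => (F x - F y) / (x - y) ^ (α + 1)) (Ioo 0 x)
  outer : IntegrableOn (leftFracDeriv α 0 F) (Ioo 0 T)

theorem measurable_truncated_quotient (hF : Measurable F) :
    Measurable (fun p : ℝ × ℝ => (Ioo 0 p.1).indicator
      (fun y => (F p.1 - F y) / (p.1 - y) ^ (α + 1)) p.2) := by
  have hS : MeasurableSet {p : ℝ × ℝ | 0 < p.2 ∧ p.2 < p.1} :=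
    (measurableSet_lt measurable_const measurable_snd).inter
      (measurableSet_lt measurable_snd measurable_fst)
  have hm : Measurable (fun p : ℝ × ℝ => (F p.1 - F p.2) / (p.1 - p.2) ^ (α + 1)) := by
    fun_prop
  exact hm.indicator hS

theorem FracIntegrable.of_lintegral_ne_top (hα : 0 < α) (hα1 : α < 1) (hF : Measurable F)
    (h : ∫⁻ x in Ioo 0 T, leftFracMajorant α F x ≠ ∞) : FracIntegrable α T F := by
  have hm := measurable_truncated_quotient (α := α) hF
  have hJ : Measurable fun x => ∫⁻ y in Ioo 0 x, ‖(F x - F y) / (x - y) ^ (α + 1)‖ₑ := by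
    have := hm.enorm.lintegral_prod_right' (ν := volume)
    convert this using 1
    ext x
    rw [← lintegral_indicator measurableSet_Ioo]
    congr 1
    ext y
    by_cases hy : y ∈ Ioo 0 x <;> simp [hy]
  have hM : Measurable (leftFracMajorant α F) := by
    unfold leftFracMajorant
    fun_prop
  constructor
  · filter_upwards [ae_lt_top hM h] with x hx
    have hx' : ∫⁻ y in Ioo 0 x, ‖(F x - F y) / (x - y) ^ (α + 1)‖ₑ < ∞ := by
      have h1 := (le_add_self.trans_lt hx)
      exact (ENNReal.mul_lt_top_iff.1 h1).elim (fun h => h.2) (fun h => h.elim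
        (fun h => absurd h (ENNReal.ofReal_pos.2 hα).ne') (fun h => h ▸ ENNReal.zero_lt_top))
    refine ⟨?_, hx'⟩
    have : Measurable fun y => (F x - F y) / (x - y) ^ (α + 1) := by fun_prop
    exact this.aestronglyMeasurable
  · constructor
    · have hI : Measurable fun x => ∫ y, (Ioo 0 x).indicator
          (fun y => (F x - F y) / (x - y) ^ (α + 1)) y :=
        (hm.stronglyMeasurable.integral_prod_right' (ν := volume)).measurable
      have : Measurable fun x => (Real.Gamma (1 - α))⁻¹ * (F x / (x - 0) ^ α + α *
          ∫ y, (Ioo 0 x).indicator (fun y => (F x - F y) / (x - y) ^ (α + 1)) y) := by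
        fun_prop
      refine this.aestronglyMeasurable.congr ?_
      refine (ae_restrict_iff' measurableSet_Ioo).2 (Filter.Eventually.of_forall fun x hx => ?_)
      simp only [leftFracDeriv]
      rw [intervalIntegral.integral_of_le hx.1.le, integral_Ioc_eq_integral_Ioo,
        integral_indicator measurableSet_Ioo]
    · calc ∫⁻ x in Ioo 0 T, ‖leftFracDeriv α 0 F x‖ₑ
          ≤ ∫⁻ x in Ioo 0 T, ENNReal.ofReal (Real.Gamma (1 - α))⁻¹ * leftFracMajorant α F x :=
            setLIntegral_mono' measurableSet_Ioo fun x hx =>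
              enorm_leftFracDeriv_le hα hα1 hx.1 F
        _ < ∞ := by
            rw [lintegral_const_mul _ hM]
            exact ENNReal.mul_lt_top ENNReal.ofReal_lt_top h.lt_top

theorem FracIntegrable.leftFracDeriv_sub (hF : FracIntegrable α T F) (hG : FracIntegrable α T G) :
    ∀ᵐ x ∂volume.restrict (Ioo 0 T), leftFracDeriv α 0 (fun y => F y - G y) x
      = leftFracDeriv α 0 F x - leftFracDeriv α 0 G x := by
  filter_upwards [hF.inner, hG.inner, ae_restrict_mem measurableSet_Ioo] with x h1 h2 hx
  simp only [leftFracDeriv]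
  rw [intervalIntegral.integral_of_le hx.1.le, intervalIntegral.integral_of_le hx.1.le,
    intervalIntegral.integral_of_le hx.1.le, integral_Ioc_eq_integral_Ioo,
    integral_Ioc_eq_integral_Ioo, integral_Ioc_eq_integral_Ioo]
  have : ∀ y, (F x - G x - (F y - G y)) / (x - y) ^ (α + 1) =
      (F x - F y) / (x - y) ^ (α + 1) - (G x - G y) / (x - y) ^ (α + 1) := fun y => by ring
  simp only [this]
  rw [integral_sub h1 h2]
  ring

theorem leftFracDeriv_congr_ae (h : F =ᵐ[volume] G) :
    leftFracDeriv α 0 F =ᵐ[volume] leftFracDeriv α 0 G := by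
  filter_upwards [h] with x hx
  simp only [leftFracDeriv]
  rw [hx]
  congr 3
  refine intervalIntegral.integral_congr_ae ?_
  filter_upwards [h] with y hy _
  rw [hy]

end Regular

/-- Integrators of the generalized Stieltjes integral: the right-sided fractional derivative of
order `1-α` of `g - g(T-)` is measurable and bounded by `Λ` on `(0,T)`. -/
structure FracIntegrator (α T Λ : ℝ) (g : ℝ → ℝ) : Prop where
  nonneg : 0 ≤ Λ
  aesm : AEStronglyMeasurable
    (rightFracDeriv (1 - α) T (fun u => g u - Function.leftLim g T)) (volume.restrict (Ioo 0 T))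
  bound : ∀ x ∈ Ioo 0 T,
    ‖rightFracDeriv (1 - α) T (fun u => g u - Function.leftLim g T) x‖ ≤ Λ

section Zahle

variable {α T Λ : ℝ} {F G g : ℝ → ℝ}

theorem zahleIntegral_eq (hT : 0 ≤ T) : zahleIntegral α 0 T F g = -∫ x in Ioo 0 T,
    leftFracDeriv α 0 F x *
      rightFracDeriv (1 - α) T (fun u => g u - Function.leftLim g T) x := by
  rw [zahleIntegral, intervalIntegral.integral_of_le hT, integral_Ioc_eq_integral_Ioo]

theorem FracIntegrator.integrable_mul (hg : FracIntegrator α T Λ g)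
    (hF : FracIntegrable α T F) : IntegrableOn (fun x => leftFracDeriv α 0 F x *
      rightFracDeriv (1 - α) T (fun u => g u - Function.leftLim g T) x) (Ioo 0 T) :=
  hF.outer.mul_bdd hg.aesm
    ((ae_restrict_iff' measurableSet_Ioo).2 (Filter.Eventually.of_forall hg.bound))

theorem zahleIntegral_sub (hT : 0 ≤ T) (hg : FracIntegrator α T Λ g)
    (hF : FracIntegrable α T F) (hG : FracIntegrable α T G) :
    zahleIntegral α 0 T (fun y => F y - G y) g
      = zahleIntegral α 0 T F g - zahleIntegral α 0 T G g := by
  rw [zahleIntegral_eq hT, zahleIntegral_eq hT, zahleIntegral_eq hT, neg_sub_neg,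
    ← integral_sub (hg.integrable_mul hG) (hg.integrable_mul hF), ← integral_neg]
  refine integral_congr_ae ?_
  filter_upwards [hF.leftFracDeriv_sub hG] with x hx
  rw [hx]
  ring

theorem zahleIntegral_congr_ae (hT : 0 ≤ T) (h : F =ᵐ[volume] G) :
    zahleIntegral α 0 T F g = zahleIntegral α 0 T G g := by
  rw [zahleIntegral_eq hT, zahleIntegral_eq hT]
  congr 1
  refine integral_congr_ae ?_
  filter_upwards [ae_restrict_of_ae (leftFracDeriv_congr_ae (α := α) h)] with x hx
  rw [hx]

theorem abs_zahleIntegral_le (hα : 0 < α) (hα1 : α < 1) (hT : 0 ≤ T)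
    (hg : FracIntegrator α T Λ g) {c : ℝ} (hc : 0 ≤ c)
    (h : ∫⁻ x in Ioo 0 T, leftFracMajorant α F x ≤ ENNReal.ofReal c) :
    |zahleIntegral α 0 T F g| ≤ (Real.Gamma (1 - α))⁻¹ * Λ * c := by
  have hΓ : 0 < (Real.Gamma (1 - α))⁻¹ := inv_pos.2 (Real.Gamma_pos_of_pos (by linarith))
  have hΛ := hg.nonneg
  rw [← Real.norm_eq_abs, ← ENNReal.ofReal_le_ofReal_iff (by positivity), ofReal_norm,
    zahleIntegral_eq hT, enorm_neg]
  calc _ ≤ ∫⁻ x in Ioo 0 T, ENNReal.ofReal ((Real.Gamma (1 - α))⁻¹ * Λ)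
          * leftFracMajorant α F x := by
        refine (enorm_integral_le_lintegral_enorm _).trans
          (setLIntegral_mono' measurableSet_Ioo fun x hx => ?_)
        rw [enorm_mul, ENNReal.ofReal_mul hΓ.le, mul_right_comm]
        refine mul_le_mul' (enorm_leftFracDeriv_le hα hα1 hx.1 F) ?_
        rw [← ofReal_norm]
        exact ENNReal.ofReal_le_ofReal (hg.bound x hx)
    _ ≤ _ := by
        rw [lintegral_const_mul' _ _ ENNReal.ofReal_ne_top,
          ENNReal.ofReal_mul (p := (Real.Gamma (1 - α))⁻¹ * Λ) (by positivity)]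
        exact mul_le_mul' le_rfl h

end Zahle

/-! ### Functions of class `W_T^{1-α,∞}` as integrators -/

section Integrator

variable {α T : ℝ} {m : ℕ} {g : ℝ → E m}

theorem MemWT.exists_bound (hg : MemWT α T g) : ∃ M : ℝ, 0 ≤ M ∧
    (∀ s t, 0 < s → s < t → t < T → ‖g t - g s‖ ≤ M * (t - s) ^ (1 - α)) ∧
    (∀ s t, 0 < s → s < t → t < T →
      ∫⁻ y in Ioo s t, ENNReal.ofReal (‖g y - g s‖ / (y - s) ^ (2 - α)) ≤ ENNReal.ofReal M) := by
  have hfin := hg.2.ne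
  refine ⟨(normWT α T g).toReal, ENNReal.toReal_nonneg, ?_⟩
  have key : ∀ s t, 0 < s → s < t → t < T →
      ENNReal.ofReal (‖g t - g s‖ / (t - s) ^ (1 - α)) +
      ∫⁻ y in Ioo s t, ENNReal.ofReal (‖g y - g s‖ / (y - s) ^ (2 - α)) ≤ normWT α T g := by
    intro s t hs hst ht
    exact le_iSup₂_of_le s ⟨hs, hst.trans ht⟩ (le_iSup₂_of_le t ⟨hst, ht⟩ le_rfl)
  constructor
  · intro s t hs hst ht
    have h := le_self_add.trans (key s t hs hst ht)
    have hp : 0 < (t - s) ^ (1 - α) := Real.rpow_pos_of_pos (by linarith) _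
    rw [← div_le_iff₀ hp]
    exact (ENNReal.ofReal_le_iff_le_toReal hfin).1 h
  · intro s t hs hst ht
    rw [ENNReal.ofReal_toReal hfin]
    exact le_add_self.trans (key s t hs hst ht)

/-- The integral bound of `W_T^{1-α,∞}` persists at the right end point `T`. -/
theorem lintegral_Ioo_le_of_forall_lt {h : ℝ → ℝ≥0∞} {s T : ℝ} {c : ℝ≥0∞}
    (H : ∀ t, s < t → t < T → ∫⁻ y in Ioo s t, h y ≤ c) : ∫⁻ y in Ioo s T, h y ≤ c := by
  rcases le_or_gt T s with hTs | hTs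
  · simp [Ioo_eq_empty_of_le hTs]
  obtain ⟨u, hu, huT, hlim⟩ := exists_seq_strictMono_tendsto' hTs
  have hU : Ioo s T = ⋃ n, Ioo s (u n) := by
    ext y
    simp only [mem_iUnion, mem_Ioo]
    constructor
    · rintro ⟨h1, h2⟩
      obtain ⟨n, hn⟩ := (hlim.eventually (lt_mem_nhds h2)).exists
      exact ⟨n, h1, hn⟩
    · rintro ⟨n, h1, h2⟩
      exact ⟨h1, h2.trans (huT n).2⟩
  rw [hU, setLIntegral_iUnion_of_directed]
  · exact iSup_le fun n => H _ (huT n).1 (huT n).2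
  · exact directed_of_isDirected_le fun i j hij => Ioo_subset_Ioo_right (hu.monotone hij)

theorem exists_tendsto_left_of_holder {f : ℝ → ℝ} {M r : ℝ} (hT : 0 < T) (hr : 0 < r)
    (hM : 0 ≤ M) (hf : ∀ s t, 0 < s → s < t → t < T → |f t - f s| ≤ M * (t - s) ^ r) :
    ∃ c, Filter.Tendsto f (nhdsWithin T (Iio T)) (nhds c) := by
  have : Cauchy (Filter.map f (nhdsWithin T (Iio T))) := by
    rw [Metric.cauchy_iff]
    refine ⟨inferInstance, fun ε hε => ?_⟩
    have hc : Filter.Tendsto (fun x : ℝ => M * (T - x) ^ r) (nhdsWithin T (Iio T))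
        (nhds 0) := by
      have : ContinuousAt (fun x : ℝ => M * (T - x) ^ r) T := by
        refine ContinuousAt.mul continuousAt_const ?_
        exact ContinuousAt.rpow_const (by fun_prop) (Or.inr hr.le)
      have h := this.tendsto.mono_left (nhdsWithin_le_nhds (s := Iio T))
      simpa [Real.zero_rpow hr.ne'] using h
    have hev : ∀ᶠ x in nhdsWithin T (Iio T), x ∈ Ioo 0 T ∧ M * (T - x) ^ r < ε :=
      Filter.Eventually.and (Ioo_mem_nhdsLT hT) (hc.eventually (gt_mem_nhds hε))
    obtain ⟨a, ha, haε⟩ := hev.exists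
    have hlt : ∀ x y, a < x → x < y → y < T → dist (f x) (f y) < ε := by
      intro x y hx hxy hy
      rw [dist_comm, Real.dist_eq]
      refine (hf x y (by linarith [ha.1]) hxy hy).trans_lt (lt_of_le_of_lt ?_ haε)
      gcongr
    refine ⟨f '' Ioo a T, Filter.image_mem_map (Ioo_mem_nhdsLT ha.2), ?_⟩
    rintro _ ⟨x, hx, rfl⟩ _ ⟨y, hy, rfl⟩
    rcases lt_trichotomy x y with h | h | h
    · exact hlt x y hx.1 h hy.2
    · simpa [h] using hε
    · rw [dist_comm]
      exact hlt y x hy.1 h hx.2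
  obtain ⟨c, hc⟩ := CompleteSpace.complete this
  exact ⟨c, hc⟩

theorem measurable_indicator_of_subtype {β : Type*} [MeasurableSpace β] [Zero β] {s : Set ℝ}
    (hs : MeasurableSet s) {f : ℝ → β} (hf : Measurable fun t : s => f t) :
    Measurable (s.indicator f) := by
  refine measurable_of_restrict_of_restrict_compl hs ?_ ?_
  · convert hf using 1
    ext t
    simp [t.2]
  · convert (measurable_const : Measurable fun _ : ↑sᶜ => (0 : β)) using 1
    ext t
    simp [indicator_of_notMem t.2]

/-- Each coordinate of a function of class `W_T^{1-α,∞}` is an admissible integrator. -/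
theorem MemWT.fracIntegrator (hα : 0 < α) (hα1 : α < 1) (hT : 0 < T) (hg : MemWT α T g) :
    ∃ Λ, ∀ j, FracIntegrator α T Λ (fun s => g s j) := by
  obtain ⟨M, hM, h1, h2⟩ := hg.exists_bound
  have hΓ : 0 < (Real.Gamma (1 - (1 - α)))⁻¹ :=
    inv_pos.2 (Real.Gamma_pos_of_pos (by linarith))
  refine ⟨(Real.Gamma (1 - (1 - α)))⁻¹ * (M + (1 - α) * M), fun j => ?_⟩
  set f : ℝ → ℝ := fun s => g s j with hf
  have hle : ∀ s t, |f t - f s| ≤ ‖g t - g s‖ := fun s t => PiLp.norm_apply_le (g t - g s) j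
  have hf1 : ∀ s t, 0 < s → s < t → t < T → |f t - f s| ≤ M * (t - s) ^ (1 - α) :=
    fun s t hs hst ht => (hle s t).trans (h1 s t hs hst ht)
  obtain ⟨c, hc⟩ := exists_tendsto_left_of_holder hT (by linarith) hM hf1
  have hleft : Function.leftLim f T = c := leftLim_eq_of_tendsto hc
  refine ⟨by have : 0 < 1 - α := by linarith
             positivity, ?_, ?_⟩
  · have hmf : Measurable fun t : Icc (0 : ℝ) T => f t := by
      have hj : Measurable fun v : E m => v j := by fun_prop
      exact hj.comp hg.1
    set f₀ := (Icc 0 T).indicator f with hf₀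
    have hm₀ : Measurable f₀ := measurable_indicator_of_subtype measurableSet_Icc hmf
    have hS : MeasurableSet {p : ℝ × ℝ | p.1 < p.2 ∧ p.2 < T} :=
      (measurableSet_lt measurable_fst measurable_snd).inter
        (measurableSet_lt measurable_snd measurable_const)
    have hm₁ : Measurable (fun p : ℝ × ℝ => (Ioo p.1 T).indicator
        (fun y => (f₀ p.1 - f₀ y) / (y - p.1) ^ (1 - α + 1)) p.2) := by
      have hq : Measurable (fun p : ℝ × ℝ =>
          (f₀ p.1 - f₀ p.2) / (p.2 - p.1) ^ (1 - α + 1)) := by fun_prop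
      exact hq.indicator hS
    have hm₂ : Measurable fun x => ∫ y, (Ioo x T).indicator
        (fun y => (f₀ x - f₀ y) / (y - x) ^ (1 - α + 1)) y := by
      have := (hm₁.stronglyMeasurable.integral_prod_right' (ν := volume)).measurable
      exact this
    have hm₃ : Measurable fun x => (Real.Gamma (1 - (1 - α)))⁻¹ *
        ((f₀ x - c) / (T - x) ^ (1 - α) + (1 - α) * ∫ y, (Ioo x T).indicator
        (fun y => (f₀ x - f₀ y) / (y - x) ^ (1 - α + 1)) y) := by fun_prop
    refine hm₃.aestronglyMeasurable.congr ?_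
    refine (ae_restrict_iff' measurableSet_Ioo).2 (Filter.Eventually.of_forall fun x hx => ?_)
    have h0 : ∀ y ∈ Ioo 0 T, f₀ y = f y := fun y hy => by
      rw [hf₀, indicator_of_mem (Ioo_subset_Icc_self hy)]
    rw [hleft]
    simp only [rightFracDeriv]
    rw [intervalIntegral.integral_of_le hx.2.le, integral_Ioc_eq_integral_Ioo,
      integral_indicator measurableSet_Ioo, h0 x hx]
    congr 3
    refine setIntegral_congr_fun measurableSet_Ioo fun y hy => ?_
    have hy' : y ∈ Ioo 0 T := ⟨hx.1.trans hy.1, hy.2⟩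
    simp only [h0 y hy']
    congr 1
    ring
  · intro x hx
    have hTx : 0 < T - x := by linarith [hx.2]
    have hlim : |f x - c| ≤ M * (T - x) ^ (1 - α) := by
      have hA : Filter.Tendsto (fun t => |f t - f x|) (nhdsWithin T (Iio T)) (nhds |c - f x|) :=
        (hc.sub_const _).abs
      rw [abs_sub_comm]
      refine le_of_tendsto hA ?_
      filter_upwards [Ioo_mem_nhdsLT hx.2] with t ht
      refine (hf1 x t hx.1 ht.1 ht.2).trans ?_
      have : 0 ≤ t - x := by linarith [ht.1]
      have : t - x ≤ T - x := by linarith [ht.2]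
      gcongr
    have hint : ‖∫ y in x..T, (f x - c - (f y - c)) / (y - x) ^ (1 - α + 1)‖ ≤ M := by
      rw [← ENNReal.ofReal_le_ofReal_iff hM, ofReal_norm, intervalIntegral.integral_of_le hx.2.le,
        integral_Ioc_eq_integral_Ioo]
      refine (enorm_integral_le_lintegral_enorm _).trans ?_
      refine lintegral_Ioo_le_of_forall_lt fun t hxt ht => ?_
      refine (setLIntegral_mono' measurableSet_Ioo fun y hy => ?_).trans (h2 x t hx.1 hxt ht)
      have hyx : 0 < y - x := by linarith [hy.1]
      rw [← ofReal_norm, norm_div, Real.norm_of_nonneg (Real.rpow_nonneg hyx.le _)]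
      refine ENNReal.ofReal_le_ofReal ?_
      rw [show 1 - α + 1 = 2 - α by ring]
      gcongr
      rw [show f x - c - (f y - c) = -(f y - f x) by ring, norm_neg]
      exact hle x y
    rw [hleft]
    unfold rightFracDeriv
    rw [norm_mul, Real.norm_of_nonneg hΓ.le]
    gcongr
    refine (norm_add_le _ _).trans (add_le_add ?_ ?_)
    · rw [norm_div, Real.norm_of_nonneg (Real.rpow_nonneg hTx.le _),
        div_le_iff₀ (Real.rpow_pos_of_pos hTx _)]
      exact hlim
    · rw [norm_mul, Real.norm_of_nonneg (by linarith)]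
      exact mul_le_mul_of_nonneg_left hint (by linarith)

end Integrator

/-! ### Hölder bounds with exponential weights -/

section Weights

variable {F : Type*} [NormedAddCommGroup F]

/-- `f` on `[0,T]` is bounded by the weight `w`, and its `γ`-Hölder quotient over `[u, r]` is
bounded by `w r`. -/
structure HolderLe (γ T : ℝ) (w : ℝ → ℝ) (f : ℝ → F) : Prop where
  norm_le : ∀ r ∈ Icc 0 T, ‖f r‖ ≤ w r
  sub_le : ∀ r ∈ Icc 0 T, ∀ u ∈ Ico 0 r, ‖f r - f u‖ ≤ w r * (r - u) ^ γ

/-- A Volterra kernel `ψ t r` that is controlled by the weight `w` as a function of `r` and whose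
increments in `t` are controlled by `(t-s)^{1-α} w`. -/
structure KernelLe (α γ T : ℝ) (w : ℝ → ℝ) (ψ : ℝ → ℝ → F) : Prop where
  at_time : ∀ t ∈ Icc 0 T, HolderLe γ T w (ψ t)
  increment : ∀ t ∈ Icc 0 T, ∀ s ∈ Ico 0 t,
    HolderLe γ T (fun r => (t - s) ^ (1 - α) * w r) (fun r => ψ t r - ψ s r)

/-- The weight `a₀ + a₁ e^{λ r}`. -/
noncomputable def expWeight (a₀ a₁ lam r : ℝ) : ℝ := a₀ + a₁ * Real.exp (lam * r)

theorem continuousOn_of_holder {f : ℝ → F} {γ T B : ℝ} (hγ : 0 < γ)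
    (hf : ∀ r ∈ Icc 0 T, ∀ u ∈ Ico 0 r, ‖f r - f u‖ ≤ B * (r - u) ^ γ) :
    ContinuousOn f (Icc 0 T) := by
  have hf' : ∀ r ∈ Icc 0 T, ∀ u ∈ Icc 0 T, ‖f u - f r‖ ≤ B * |u - r| ^ γ := by
    intro r hr u hu
    rcases lt_trichotomy u r with h | h | h
    · rw [norm_sub_rev, abs_sub_comm, abs_of_pos (by linarith)]
      exact hf r hr u ⟨hu.1, h⟩
    · simp [h, Real.zero_rpow hγ.ne']
    · rw [abs_of_pos (by linarith)]
      exact hf u hu r ⟨hr.1, h⟩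
  intro r hr
  rw [ContinuousWithinAt, tendsto_iff_norm_sub_tendsto_zero]
  have hc : Filter.Tendsto (fun u : ℝ => B * |u - r| ^ γ) (nhdsWithin r (Icc 0 T)) (nhds 0) := by
    have : ContinuousAt (fun u : ℝ => B * |u - r| ^ γ) r := by
      refine ContinuousAt.mul continuousAt_const ?_
      exact ContinuousAt.rpow_const (by fun_prop) (Or.inr hγ.le)
    have h := this.tendsto.mono_left (nhdsWithin_le_nhds (s := Icc 0 T))
    simpa [Real.zero_rpow hγ.ne'] using h
  refine squeeze_zero' (Filter.Eventually.of_forall fun _ => norm_nonneg _) ?_ hc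
  filter_upwards [self_mem_nhdsWithin] with u hu
  exact hf' r hr u hu

theorem expWeight_nonneg {a₀ a₁ lam r : ℝ} (h₀ : 0 ≤ a₀) (h₁ : 0 ≤ a₁) :
    0 ≤ expWeight a₀ a₁ lam r := by
  unfold expWeight; positivity

theorem expWeight_le {a₀ a₁ lam r T : ℝ} (h₁ : 0 ≤ a₁) (hl : 0 ≤ lam) (hr : r ≤ T) :
    expWeight a₀ a₁ lam r ≤ expWeight a₀ a₁ lam T := by
  unfold expWeight; gcongr

theorem HolderLe.continuousOn {γ T a₀ a₁ lam : ℝ} {f : ℝ → F} (hγ : 0 < γ)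
    (h₁ : 0 ≤ a₁) (hl : 0 ≤ lam) (hf : HolderLe γ T (expWeight a₀ a₁ lam) f) :
    ContinuousOn f (Icc 0 T) := by
  refine continuousOn_of_holder (B := expWeight a₀ a₁ lam T) hγ fun r hr u hu => ?_
  refine (hf.sub_le r hr u hu).trans ?_
  have : 0 ≤ (r - u) ^ γ := Real.rpow_nonneg (by linarith [hu.2]) _
  exact mul_le_mul_of_nonneg_right (expWeight_le h₁ hl hr.2) this

theorem rpow_le_exp {x κ : ℝ} (hx : 0 ≤ x) (hκ : 0 ≤ κ) (hκ1 : κ ≤ 1) : x ^ κ ≤ Real.exp x := by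
  rcases le_total x 1 with h | h
  · exact (Real.rpow_le_one hx h hκ).trans (Real.one_le_exp hx)
  · calc x ^ κ ≤ x ^ (1 : ℝ) := Real.rpow_le_rpow_of_exponent_le h hκ1
      _ = x := Real.rpow_one x
      _ ≤ Real.exp x := by linarith [Real.add_one_le_exp x]

/-- Trading exponential growth for a power singularity at `t`: the gain is the factor `λ^{-κ}`,
which makes the Picard map a contraction for large `λ`. -/
theorem exp_le_rpow_mul_exp {lam r t κ : ℝ} (hl : 0 < lam) (hrt : r < t) (hκ : 0 ≤ κ)
    (hκ1 : κ ≤ 1) :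
    Real.exp (lam * r) ≤ lam ^ (-κ) * Real.exp (lam * t) * (t - r) ^ (-κ) := by
  have htr : 0 < t - r := by linarith
  have h := rpow_le_exp (mul_pos hl htr).le hκ hκ1
  have hp : 0 < (lam * (t - r)) ^ κ := Real.rpow_pos_of_pos (mul_pos hl htr) _
  have e : lam ^ (-κ) * Real.exp (lam * t) * (t - r) ^ (-κ)
      = Real.exp (lam * t) / (lam * (t - r)) ^ κ := by
    rw [Real.mul_rpow hl.le htr.le, Real.rpow_neg hl.le, Real.rpow_neg htr.le]
    field_simp
  rw [e, le_div_iff₀ hp]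
  calc _ ≤ Real.exp (lam * r) * Real.exp (lam * (t - r)) := by gcongr
    _ = _ := by rw [← Real.exp_add]; ring_nf

theorem expWeight_le_rpow {a₀ a₁ lam r t T κ : ℝ} (h₀ : 0 ≤ a₀) (h₁ : 0 ≤ a₁) (hl : 0 < lam)
    (hr : 0 ≤ r) (hrt : r < t) (ht : t ≤ T) (hκ : 0 ≤ κ) (hκ1 : κ ≤ 1) :
    expWeight a₀ a₁ lam r
      ≤ (1 + T ^ κ) * (a₀ + a₁ * lam ^ (-κ)) * Real.exp (lam * t) * (t - r) ^ (-κ) := by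
  have htr : 0 < t - r := by linarith
  have hT : 0 ≤ T := by linarith
  have hq : 0 < (t - r) ^ (-κ) := Real.rpow_pos_of_pos htr _
  have hTk : 0 ≤ T ^ κ := Real.rpow_nonneg hT _
  have hlk : 0 ≤ lam ^ (-κ) := Real.rpow_nonneg hl.le _
  have he : 1 ≤ Real.exp (lam * t) := Real.one_le_exp (by nlinarith)
  have hA : 1 ≤ T ^ κ * (t - r) ^ (-κ) := by
    rw [Real.rpow_neg htr.le, ← div_eq_mul_inv, one_le_div (Real.rpow_pos_of_pos htr _)]
    exact Real.rpow_le_rpow htr.le (by linarith) hκ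
  have hB := exp_le_rpow_mul_exp hl hrt hκ hκ1
  unfold expWeight
  calc a₀ + a₁ * Real.exp (lam * r)
      ≤ a₀ * (T ^ κ * (t - r) ^ (-κ)) * Real.exp (lam * t)
        + a₁ * (lam ^ (-κ) * Real.exp (lam * t) * (t - r) ^ (-κ)) := by
        gcongr
        calc a₀ = a₀ * 1 * 1 := by ring
          _ ≤ _ := by gcongr
    _ ≤ _ := by
        have e : (1 + T ^ κ) * (a₀ + a₁ * lam ^ (-κ)) * Real.exp (lam * t) * (t - r) ^ (-κ)
          = (a₀ * (T ^ κ * (t - r) ^ (-κ)) * Real.exp (lam * t)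
            + a₁ * (lam ^ (-κ) * Real.exp (lam * t) * (t - r) ^ (-κ)))
            + (a₀ + T ^ κ * (a₁ * lam ^ (-κ))) * Real.exp (lam * t) * (t - r) ^ (-κ) := by ring
        rw [e]
        have : 0 ≤ (a₀ + T ^ κ * (a₁ * lam ^ (-κ))) * Real.exp (lam * t) * (t - r) ^ (-κ) := by
          positivity
        linarith

theorem one_sub_exp_neg_le_rpow {x p : ℝ} (hx : 0 ≤ x) (hp : 0 ≤ p) (hp1 : p ≤ 1) :
    1 - Real.exp (-x) ≤ x ^ p := by
  rcases le_total x 1 with h | h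
  · rcases hx.eq_or_lt with rfl | hx'
    · simpa using Real.rpow_nonneg le_rfl p
    · calc 1 - Real.exp (-x) ≤ x := by linarith [Real.add_one_le_exp (-x)]
        _ = x ^ (1 : ℝ) := (Real.rpow_one x).symm
        _ ≤ x ^ p := Real.rpow_le_rpow_of_exponent_ge hx' h hp1
  · exact (by linarith [Real.exp_pos (-x)] : 1 - Real.exp (-x) ≤ 1).trans (Real.one_le_rpow h hp)

theorem continuous_expWeight {a₀ a₁ lam : ℝ} : Continuous (expWeight a₀ a₁ lam) := by
  unfold expWeight; fun_prop

theorem integral_expWeight_le {a₀ a₁ lam s t T κ : ℝ} (h₀ : 0 ≤ a₀) (h₁ : 0 ≤ a₁) (hl : 0 < lam)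
    (hs : 0 ≤ s) (hst : s ≤ t) (ht : t ≤ T) (hκ : 0 ≤ κ) (hκ1 : κ ≤ 1) :
    ∫ r in s..t, expWeight a₀ a₁ lam r
      ≤ (1 + T ^ κ) * (a₀ + a₁ * lam ^ (-κ)) * Real.exp (lam * t) * (t - s) ^ (1 - κ) := by
  have hT : 0 ≤ T := by linarith
  have hts : 0 ≤ t - s := by linarith
  have hTk : 0 ≤ T ^ κ := Real.rpow_nonneg hT _
  have hlk : 0 ≤ lam ^ (-κ) := Real.rpow_nonneg hl.le _
  have hq : 0 ≤ (t - s) ^ (1 - κ) := Real.rpow_nonneg hts _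
  have he : 1 ≤ Real.exp (lam * t) := Real.one_le_exp (by nlinarith)
  have e : ∫ r in s..t, expWeight a₀ a₁ lam r = a₀ * (t - s)
      + a₁ * ((Real.exp (lam * t) - Real.exp (lam * s)) / lam) := by
    unfold expWeight
    rw [intervalIntegral.integral_add (by simp) (Continuous.intervalIntegrable (by fun_prop) _ _),
      intervalIntegral.integral_const_mul]
    congr 1
    · simp [mul_comm]
    · rw [intervalIntegral.integral_comp_mul_left (fun x => Real.exp x) hl.ne', integral_exp,
        smul_eq_mul]
      ring
  have e1 : t - s ≤ T ^ κ * (t - s) ^ (1 - κ) := by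
    rcases hts.eq_or_lt with h | h
    · rw [← h]; exact mul_nonneg hTk (Real.rpow_nonneg le_rfl _)
    · calc t - s = (t - s) ^ κ * (t - s) ^ (1 - κ) := by
            rw [← Real.rpow_add h]; simp
        _ ≤ _ := by gcongr; linarith
  have e2 : (Real.exp (lam * t) - Real.exp (lam * s)) / lam
      ≤ lam ^ (-κ) * Real.exp (lam * t) * (t - s) ^ (1 - κ) := by
    have h := one_sub_exp_neg_le_rpow (mul_nonneg hl.le hts) (by linarith : 0 ≤ 1 - κ)
      (by linarith)
    rw [div_le_iff₀ hl]
    have h2 : (lam * (t - s)) ^ (1 - κ) = lam ^ (-κ) * lam * (t - s) ^ (1 - κ) := by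
      rw [Real.mul_rpow hl.le hts, sub_eq_add_neg, add_comm, Real.rpow_add hl, Real.rpow_one]
    have h3 : Real.exp (lam * s) = Real.exp (lam * t) * Real.exp (-(lam * (t - s))) := by
      rw [← Real.exp_add]; ring_nf
    rw [h3]
    calc _ = Real.exp (lam * t) * (1 - Real.exp (-(lam * (t - s)))) := by ring
      _ ≤ Real.exp (lam * t) * (lam ^ (-κ) * lam * (t - s) ^ (1 - κ)) := by
          rw [← h2]; gcongr
      _ = _ := by ring
  rw [e]
  calc _ ≤ a₀ * (T ^ κ * (t - s) ^ (1 - κ)) * Real.exp (lam * t)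
        + a₁ * (lam ^ (-κ) * Real.exp (lam * t) * (t - s) ^ (1 - κ)) := by
        refine add_le_add ?_ (by gcongr)
        calc a₀ * (t - s) ≤ a₀ * (T ^ κ * (t - s) ^ (1 - κ)) * 1 := by rw [mul_one]; gcongr
          _ ≤ _ := by gcongr
    _ ≤ _ := by
        have e : (1 + T ^ κ) * (a₀ + a₁ * lam ^ (-κ)) * Real.exp (lam * t) * (t - s) ^ (1 - κ)
          = (a₀ * (T ^ κ * (t - s) ^ (1 - κ)) * Real.exp (lam * t)
            + a₁ * (lam ^ (-κ) * Real.exp (lam * t) * (t - s) ^ (1 - κ)))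
            + (a₀ + T ^ κ * (a₁ * lam ^ (-κ))) * Real.exp (lam * t) * (t - s) ^ (1 - κ) := by
          ring
        rw [e]
        have : 0 ≤ (a₀ + T ^ κ * (a₁ * lam ^ (-κ))) * Real.exp (lam * t) * (t - s) ^ (1 - κ) := by
          positivity
        linarith

end Weights

/-! ### Increments of Volterra integrals -/

section Increments

variable {α γ κ T Λ : ℝ}

theorem HolderLe.measurable_indicator {a₀ a₁ lam s t : ℝ} {f : ℝ → ℝ} (hγ : 0 < γ)
    (h₁ : 0 ≤ a₁) (hl : 0 ≤ lam) (hf : HolderLe γ T (expWeight a₀ a₁ lam) f) (hs : 0 ≤ s)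
    (ht : t ≤ T) : Measurable ((Ioo s t).indicator f) := by
  classical
  have hc : ContinuousOn f (Ioo s t) := (hf.continuousOn hγ h₁ hl).mono fun r hr =>
    ⟨hs.trans hr.1.le, hr.2.le.trans ht⟩
  have := hc.measurable_piecewise (g := fun _ => 0) continuousOn_const measurableSet_Ioo
  convert this using 1
  exact (piecewise_eq_indicator).symm

/-- The constant of `lintegral_leftFracMajorant_le_of_holderLe`. -/
noncomputable def fracConst (α γ κ T : ℝ) : ℝ :=
  ((2 + α * T ^ γ / (γ - α)) * 2 + 1) / (1 - α - κ) * (1 + T ^ κ)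

theorem fracConst_nonneg (hα : 0 < α) (hγ : α < γ) (hακ : α + κ < 1) (hT : 0 ≤ T) :
    0 ≤ fracConst α γ κ T := by
  have : 0 < γ - α := by linarith
  have : 0 < 1 - α - κ := by linarith
  unfold fracConst
  positivity

theorem lintegral_leftFracMajorant_le_of_holderLe {a₀ a₁ lam s t : ℝ} {f : ℝ → ℝ} (hα : 0 < α)
    (hγ : α < γ) (hκ : 0 ≤ κ) (hακ : α + κ < 1) (h₀ : 0 ≤ a₀) (h₁ : 0 ≤ a₁) (hl : 0 < lam)
    (hf : HolderLe γ T (expWeight a₀ a₁ lam) f) (hs : 0 ≤ s) (hst : s ≤ t) (ht : t ≤ T) :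
    ∫⁻ x in Ioo 0 T, leftFracMajorant α ((Ioo s t).indicator f) x
      ≤ ENNReal.ofReal (fracConst α γ κ T * (a₀ + a₁ * lam ^ (-κ)) * Real.exp (lam * t)
          * (t - s) ^ (1 - α - κ)) := by
  have hT : 0 ≤ T := by linarith
  rcases hst.eq_or_lt with rfl | hst
  · simp [leftFracMajorant]
  have hlk : 0 ≤ lam ^ (-κ) := Real.rpow_nonneg hl.le _
  have hw : ∀ r ∈ Ioo s t, expWeight a₀ a₁ lam r ≤ ((1 + T ^ κ) * (a₀ + a₁ * lam ^ (-κ))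
      * Real.exp (lam * t)) * (t - r) ^ (-κ) := fun r hr =>
    expWeight_le_rpow h₀ h₁ hl (by linarith [hr.1]) hr.2 ht hκ (by linarith)
  have hmem : ∀ r ∈ Ioo s t, r ∈ Icc 0 T := fun r hr =>
    ⟨by linarith [hr.1], by linarith [hr.2]⟩
  refine (lintegral_leftFracMajorant_indicator_le (κ := κ) hα hγ hκ hακ hs hst ht
    (A := (1 + T ^ κ) * (a₀ + a₁ * lam ^ (-κ)) * Real.exp (lam * t)) (by positivity)
    (fun r hr => (hf.norm_le r (hmem r hr)).trans (hw r hr)) ?_).trans (le_of_eq ?_)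
  · intro r hr u hu
    refine (hf.sub_le r (hmem r hr) u ⟨by linarith [hu.1], hu.2⟩).trans ?_
    exact mul_le_mul_of_nonneg_right (hw r hr) (Real.rpow_nonneg (by linarith [hu.2]) _)
  · unfold fracConst
    congr 1
    ring

theorem HolderLe.fracIntegrable {a₀ a₁ lam s t : ℝ} {f : ℝ → ℝ} (hα : 0 < α) (hα1 : α < 1)
    (hγ : α < γ) (h₀ : 0 ≤ a₀) (h₁ : 0 ≤ a₁) (hl : 0 < lam)
    (hf : HolderLe γ T (expWeight a₀ a₁ lam) f) (hs : 0 ≤ s) (hst : s ≤ t) (ht : t ≤ T) :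
    FracIntegrable α T ((Ioo s t).indicator f) :=
  FracIntegrable.of_lintegral_ne_top hα hα1
    (hf.measurable_indicator (hα.trans hγ) h₁ hl.le hs ht)
    (ne_top_of_le_ne_top ENNReal.ofReal_ne_top (lintegral_leftFracMajorant_le_of_holderLe
      (κ := 0) hα hγ le_rfl (by linarith) h₀ h₁ hl hf hs hst ht))

theorem HolderLe.abs_zahleIntegral_le {a₀ a₁ lam s t : ℝ} {f g : ℝ → ℝ}
    (hf : HolderLe γ T (expWeight a₀ a₁ lam) f) (hα : 0 < α)
    (hγ : α < γ) (hκ : 0 ≤ κ) (hακ : α + κ < 1) (hg : FracIntegrator α T Λ g)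
    (h₀ : 0 ≤ a₀) (h₁ : 0 ≤ a₁) (hl : 0 < lam)
    (hs : 0 ≤ s) (hst : s ≤ t) (ht : t ≤ T) :
    |zahleIntegral α 0 T ((Ioo s t).indicator f) g|
      ≤ (Real.Gamma (1 - α))⁻¹ * Λ * (fracConst α γ κ T * (a₀ + a₁ * lam ^ (-κ))
        * Real.exp (lam * t) * (t - s) ^ (1 - α - κ)) := by
  have hT : 0 ≤ T := by linarith
  have hlk : 0 ≤ lam ^ (-κ) := Real.rpow_nonneg hl.le _
  have hts : 0 ≤ t - s := by linarith
  have := fracConst_nonneg hα hγ hακ hT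
  exact Volterra.abs_zahleIntegral_le hα (by linarith) hT hg (by positivity)
    (lintegral_leftFracMajorant_le_of_holderLe hα hγ hκ hακ h₀ h₁ hl hf hs hst ht)

/-- Splitting of the increment `∫_0^t ψ(t,·) dg - ∫_0^s ψ(s,·) dg`. -/
theorem stieltjesUpTo_sub_eq {a₀ a₁ lam s t : ℝ} {ψ : ℝ → ℝ → ℝ} {g : ℝ → ℝ} (hα : 0 < α)
    (hα1 : α < 1) (hγ : α < γ) (hg : FracIntegrator α T Λ g) (h₀ : 0 ≤ a₀) (h₁ : 0 ≤ a₁)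
    (hl : 0 < lam) (hψ : KernelLe α γ T (expWeight a₀ a₁ lam) ψ) (hs : 0 ≤ s) (hst : s ≤ t)
    (ht : t ≤ T) :
    stieltjesUpTo α T t (ψ t) g - stieltjesUpTo α T s (ψ s) g
      = zahleIntegral α 0 T ((Ioo s t).indicator (ψ t)) g
        + zahleIntegral α 0 T ((Ioo 0 s).indicator (fun r => ψ t r - ψ s r)) g := by
  have hT : 0 ≤ T := by linarith
  have hψt := hψ.at_time t ⟨by linarith, ht⟩
  have hψs := hψ.at_time s ⟨hs, by linarith⟩
  have I1 := hψt.fracIntegrable hα hα1 hγ h₀ h₁ hl le_rfl (hs.trans hst) ht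
  have I2 := hψs.fracIntegrable hα hα1 hγ h₀ h₁ hl le_rfl hs (hst.trans ht)
  have I3 := hψt.fracIntegrable hα hα1 hγ h₀ h₁ hl hs hst ht
  have I4 := hψt.fracIntegrable hα hα1 hγ h₀ h₁ hl le_rfl hs (hst.trans ht)
  have e1 : zahleIntegral α 0 T ((Ioo 0 s).indicator (fun r => ψ t r - ψ s r)) g
      = zahleIntegral α 0 T ((Ioo 0 s).indicator (ψ t)) g
        - zahleIntegral α 0 T ((Ioo 0 s).indicator (ψ s)) g := by
    rw [← zahleIntegral_sub hT hg I4 I2]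
    congr 1
    ext r
    by_cases hr : r ∈ Ioo 0 s <;> simp [hr]
  -- the truncations to `(0,t)`, `(s,t)`, `(0,s)` match up off the null set `{s}`
  have e2 : zahleIntegral α 0 T ((Ioo s t).indicator (ψ t)) g
      = zahleIntegral α 0 T ((Ioo 0 t).indicator (ψ t)) g
        - zahleIntegral α 0 T ((Ioo 0 s).indicator (ψ t)) g := by
    rw [← zahleIntegral_sub hT hg I1 I4]
    refine zahleIntegral_congr_ae hT ?_
    filter_upwards [compl_mem_ae_iff.2 (measure_singleton s)] with r hr
    have hrs : r ≠ s := hr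
    rcases lt_or_gt_of_ne hrs with h | h
    · have h1 : r ∉ Ioo s t := fun hh => by linarith [hh.1]
      by_cases h2 : 0 < r
      · simp [h1, h, h2, h.trans_le hst]
      · simp [h1, h2]
    · have h1 : r ∉ Ioo 0 s := fun hh => by linarith [hh.2]
      by_cases h2 : r < t
      · simp [h, h2, hs.trans_lt h, h.not_gt]
      · simp [h2, h.not_gt]
  unfold stieltjesUpTo
  rw [e1, e2]
  ring

theorem rpow_sub_mul_le {s t p q T : ℝ} (hst : s ≤ t) (hts : t - s ≤ T)
    (hp : 0 ≤ p) (hq : 0 ≤ q) : (t - s) ^ (p + q) ≤ T ^ p * (t - s) ^ q := by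
  have h : 0 ≤ t - s := by linarith
  rw [Real.rpow_add_of_nonneg h hp hq]
  gcongr

/-- Increments of the generalized Stieltjes integral of a Volterra kernel. -/
theorem exists_stieltjesUpTo_sub_le (hα : 0 < α) (hγ : α < γ) (hκ : 0 ≤ κ) (hακ : α + κ < 1)
    (hT : 0 ≤ T) (Λ : ℝ) : ∃ C, 0 ≤ C ∧ ∀ (ψ : ℝ → ℝ → ℝ) (g : ℝ → ℝ) (a₀ a₁ lam : ℝ),
      FracIntegrator α T Λ g → 0 ≤ a₀ → 0 ≤ a₁ → 0 < lam →
      KernelLe α γ T (expWeight a₀ a₁ lam) ψ → ∀ t ∈ Icc 0 T, ∀ s ∈ Ico 0 t,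
      |stieltjesUpTo α T t (ψ t) g - stieltjesUpTo α T s (ψ s) g|
        ≤ C * (a₀ + a₁ * lam ^ (-κ)) * Real.exp (lam * t) * (t - s) ^ (1 - α - κ) := by
  set D := (Real.Gamma (1 - α))⁻¹ * |Λ| * fracConst α γ κ T with hD
  have hΓ : 0 < (Real.Gamma (1 - α))⁻¹ := inv_pos.2 (Real.Gamma_pos_of_pos (by linarith))
  have hf0 := fracConst_nonneg hα hγ hακ hT
  have hD0 : 0 ≤ D := by positivity
  refine ⟨D * (1 + T ^ κ * T ^ (1 - α - κ)), by positivity, ?_⟩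
  intro ψ g a₀ a₁ lam hg h₀ h₁ hl hψ t ht s hs
  have hΛ : |Λ| = Λ := abs_of_nonneg hg.nonneg
  have hlk : 0 ≤ lam ^ (-κ) := Real.rpow_nonneg hl.le _
  have hts : 0 ≤ t - s := by linarith [hs.2]
  rw [stieltjesUpTo_sub_eq hα (by linarith) hγ hg h₀ h₁ hl hψ hs.1 hs.2.le ht.2]
  have B1 := (hψ.at_time t ht).abs_zahleIntegral_le hα hγ hκ hακ hg h₀ h₁ hl hs.1 hs.2.le ht.2
  have hinc : HolderLe γ T (expWeight ((t - s) ^ (1 - α) * a₀) ((t - s) ^ (1 - α) * a₁) lam)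
      (fun r => ψ t r - ψ s r) := by
    convert hψ.increment t ht s hs using 1
    ext r
    unfold expWeight
    ring
  have hp : 0 ≤ (t - s) ^ (1 - α) := Real.rpow_nonneg hts _
  have B2 := hinc.abs_zahleIntegral_le hα hγ hκ hακ hg (mul_nonneg hp h₀) (mul_nonneg hp h₁) hl
    le_rfl hs.1 (hs.2.le.trans ht.2)
  have B3 : (t - s) ^ (1 - α) ≤ T ^ κ * (t - s) ^ (1 - α - κ) := by
    have := rpow_sub_mul_le (T := T) hs.2.le (by linarith [ht.2, hs.1]) hκ
      (by linarith : 0 ≤ 1 - α - κ)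
    rwa [show κ + (1 - α - κ) = 1 - α by ring] at this
  have B4 : Real.exp (lam * s) ≤ Real.exp (lam * t) := by
    gcongr; exact hs.2.le
  have B5 : (s - 0) ^ (1 - α - κ) ≤ T ^ (1 - α - κ) := by
    rw [sub_zero]
    exact Real.rpow_le_rpow hs.1 (hs.2.le.trans ht.2) (by linarith)
  have hs0 : 0 ≤ (s - 0) ^ (1 - α - κ) := Real.rpow_nonneg (by linarith [hs.1]) _
  refine (abs_add_le _ _).trans ((add_le_add B1 B2).trans ?_)
  have hΛ0 := hg.nonneg
  calc _ = D * (a₀ + a₁ * lam ^ (-κ)) * Real.exp (lam * t) * (t - s) ^ (1 - α - κ)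
        + D * (a₀ + a₁ * lam ^ (-κ)) * (Real.exp (lam * s) * (t - s) ^ (1 - α)
          * (s - 0) ^ (1 - α - κ)) := by rw [hD, hΛ]; ring
    _ ≤ D * (a₀ + a₁ * lam ^ (-κ)) * Real.exp (lam * t) * (t - s) ^ (1 - α - κ)
        + D * (a₀ + a₁ * lam ^ (-κ)) * (Real.exp (lam * t) * (T ^ κ * (t - s) ^ (1 - α - κ))
          * T ^ (1 - α - κ)) := by gcongr
    _ = _ := by ring

theorem intervalIntegrable_of_mem_Icc {F : Type*} [NormedAddCommGroup F] {f : ℝ → F} {a b : ℝ}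
    (ha : a ∈ Icc 0 T) (hb : b ∈ Icc 0 T) (hf : IntegrableOn f (Icc 0 T)) :
    IntervalIntegrable f volume a b :=
  (hf.mono_set (uIcc_subset_Icc ha hb)).intervalIntegrable

/-- Increments of the Lebesgue integral of a Volterra kernel. -/
theorem exists_integral_sub_le {F : Type*} [NormedAddCommGroup F] [NormedSpace ℝ F]
    (hα : 0 < α) (hκ : 0 ≤ κ) (hακ : α + κ < 1) (hT : 0 ≤ T) :
    ∃ C, 0 ≤ C ∧ ∀ (φ : ℝ → ℝ → F) (h : ℝ → ℝ) (a₀ a₁ c lam : ℝ),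
      0 ≤ a₀ → 0 ≤ a₁ → 0 ≤ c → 0 < lam →
      (∀ t ∈ Icc 0 T, IntegrableOn (φ t) (Icc 0 T)) → IntegrableOn h (Icc 0 T) →
      (∀ t ∈ Icc 0 T, ∀ s ∈ Ico 0 t, ∫ r in s..t, h r ≤ c * (t - s) ^ (1 - α)) →
      (∀ t ∈ Icc 0 T, ∀ r ∈ Icc 0 T, ‖φ t r‖ ≤ expWeight a₀ a₁ lam r + h r) →
      (∀ t ∈ Icc 0 T, ∀ s ∈ Ico 0 t, ∀ r ∈ Icc 0 T,
        ‖φ t r - φ s r‖ ≤ (t - s) ^ (1 - α) * expWeight a₀ a₁ lam r) →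
      ∀ t ∈ Icc 0 T, ∀ s ∈ Ico 0 t,
      ‖(∫ r in (0 : ℝ)..t, φ t r) - ∫ r in (0 : ℝ)..s, φ s r‖
        ≤ C * (a₀ + c + a₁ * lam ^ (-κ)) * Real.exp (lam * t) * (t - s) ^ (1 - α - κ) := by
  have hTk : 0 ≤ T ^ κ := Real.rpow_nonneg hT _
  refine ⟨(1 + T ^ κ) * T ^ α + T ^ κ + T ^ κ * ((1 + T ^ κ) * T ^ (1 - κ)), by positivity, ?_⟩
  intro φ h a₀ a₁ c lam h₀ h₁ hc hl hφi hhi hh hφ hφ' t ht s hs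
  have hts : 0 ≤ t - s := by linarith [hs.2]
  have hlk : 0 ≤ lam ^ (-κ) := Real.rpow_nonneg hl.le _
  have he : 1 ≤ Real.exp (lam * t) := Real.one_le_exp (mul_nonneg hl.le ht.1)
  have hsT : s ∈ Icc 0 T := ⟨hs.1, hs.2.le.trans ht.2⟩
  have h0T : (0 : ℝ) ∈ Icc 0 T := ⟨le_rfl, hT⟩
  have split : (∫ r in (0 : ℝ)..t, φ t r) - ∫ r in (0 : ℝ)..s, φ s r
      = (∫ r in s..t, φ t r) + ∫ r in (0 : ℝ)..s, (φ t r - φ s r) := by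
    rw [intervalIntegral.integral_sub (intervalIntegrable_of_mem_Icc h0T hsT (hφi t ht)) (intervalIntegrable_of_mem_Icc h0T hsT (hφi s hsT)),
      ← intervalIntegral.integral_add_adjacent_intervals (intervalIntegrable_of_mem_Icc h0T hsT (hφi t ht))
        (intervalIntegrable_of_mem_Icc hsT ht (hφi t ht))]
    abel
  have hw : ∀ a b, IntervalIntegrable (expWeight a₀ a₁ lam) volume a b := fun a b =>
    continuous_expWeight.intervalIntegrable _ _
  have B1 : ‖∫ r in s..t, φ t r‖ ≤ (∫ r in s..t, expWeight a₀ a₁ lam r) + ∫ r in s..t, h r := by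
    rw [← intervalIntegral.integral_add (hw _ _) (intervalIntegrable_of_mem_Icc hsT ht hhi)]
    refine intervalIntegral.norm_integral_le_of_norm_le hs.2.le
      (Filter.Eventually.of_forall fun r hr => ?_) ((hw _ _).add (intervalIntegrable_of_mem_Icc hsT ht hhi))
    exact hφ t ht r ⟨by linarith [hr.1, hs.1], hr.2.trans ht.2⟩
  have B2 : ‖∫ r in (0 : ℝ)..s, (φ t r - φ s r)‖
      ≤ (t - s) ^ (1 - α) * ∫ r in (0 : ℝ)..s, expWeight a₀ a₁ lam r := by
    rw [← intervalIntegral.integral_const_mul]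
    refine intervalIntegral.norm_integral_le_of_norm_le hs.1
      (Filter.Eventually.of_forall fun r hr => ?_) ((hw _ _).const_mul _)
    exact hφ' t ht s hs r ⟨hr.1.le, hr.2.trans hsT.2⟩
  have W1 := integral_expWeight_le h₀ h₁ hl hs.1 hs.2.le ht.2 hκ (by linarith)
  have W2 := integral_expWeight_le h₀ h₁ hl le_rfl hs.1 hsT.2 hκ (by linarith)
  have R1 : (t - s) ^ (1 - κ) ≤ T ^ α * (t - s) ^ (1 - α - κ) := by
    have := rpow_sub_mul_le (T := T) hs.2.le (by linarith [ht.2, hs.1]) hα.le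
      (by linarith : 0 ≤ 1 - α - κ)
    rwa [show α + (1 - α - κ) = 1 - κ by ring] at this
  have R2 : (t - s) ^ (1 - α) ≤ T ^ κ * (t - s) ^ (1 - α - κ) := by
    have := rpow_sub_mul_le (T := T) hs.2.le (by linarith [ht.2, hs.1]) hκ
      (by linarith : 0 ≤ 1 - α - κ)
    rwa [show κ + (1 - α - κ) = 1 - α by ring] at this
  have R3 : (s - 0) ^ (1 - κ) ≤ T ^ (1 - κ) := by
    rw [sub_zero]
    exact Real.rpow_le_rpow hs.1 hsT.2 (by linarith)
  have B4 : Real.exp (lam * s) ≤ Real.exp (lam * t) := by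
    gcongr; exact hs.2.le
  set Q := (t - s) ^ (1 - α - κ) with hQ
  have hQ0 : 0 ≤ Q := Real.rpow_nonneg hts _
  set X := Real.exp (lam * t) with hX
  set a := a₀ + a₁ * lam ^ (-κ) with ha
  have ha0 : 0 ≤ a := by positivity
  have hp : 0 ≤ (t - s) ^ (1 - α) := Real.rpow_nonneg hts _
  have hs0 : 0 ≤ (s - 0) ^ (1 - κ) := Real.rpow_nonneg (by linarith [hs.1]) _
  rw [split]
  calc _ ≤ ((1 + T ^ κ) * a * X * (t - s) ^ (1 - κ) + c * (t - s) ^ (1 - α))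
        + (t - s) ^ (1 - α) * ((1 + T ^ κ) * a * Real.exp (lam * s) * (s - 0) ^ (1 - κ)) := by
        refine (norm_add_le _ _).trans (add_le_add (B1.trans (add_le_add W1 (hh t ht s hs)))
          (B2.trans (mul_le_mul_of_nonneg_left W2 hp)))
    _ ≤ ((1 + T ^ κ) * a * X * (T ^ α * Q) + c * (T ^ κ * Q) * X)
        + T ^ κ * Q * ((1 + T ^ κ) * a * X * T ^ (1 - κ)) := by
        refine add_le_add (add_le_add (by gcongr) ?_) (by gcongr)
        calc c * (t - s) ^ (1 - α) ≤ c * (T ^ κ * Q) * 1 := by rw [mul_one]; gcongr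
          _ ≤ _ := by gcongr
    _ ≤ ((1 + T ^ κ) * (a + c) * X * (T ^ α * Q) + (a + c) * (T ^ κ * Q) * X)
        + T ^ κ * Q * ((1 + T ^ κ) * (a + c) * X * T ^ (1 - κ)) := by
        gcongr <;> linarith
    _ = _ := by rw [ha]; ring

end Increments

/-! ### Second-order differences of functions with Hölder partial derivatives -/

section FourPoint

variable {d : ℕ}

/-- The point with the coordinates of `x` in `S` and those of `y` off `S`. -/
noncomputable def mixCoords (S : Finset (Fin d)) (x y : E d) : E d :=
  WithLp.toLp 2 fun i => if i ∈ S then x i else y i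

theorem mixCoords_sub (S : Finset (Fin d)) (x₁ y₁ x₂ y₂ : E d) :
    mixCoords S x₁ y₁ - mixCoords S x₂ y₂ = mixCoords S (x₁ - x₂) (y₁ - y₂) := by
  ext i
  by_cases h : i ∈ S <;> simp [mixCoords, h]

theorem norm_mixCoords_le (S : Finset (Fin d)) (x y : E d) :
    ‖mixCoords S x y‖ ≤ ‖x‖ + ‖y‖ := by
  refine abs_le_of_sq_le_sq' ?_ (by positivity) |>.2
  have h : ‖mixCoords S x y‖ ^ 2 ≤ ‖x‖ ^ 2 + ‖y‖ ^ 2 := by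
    rw [EuclideanSpace.norm_sq_eq, EuclideanSpace.norm_sq_eq, EuclideanSpace.norm_sq_eq,
      ← Finset.sum_add_distrib]
    refine Finset.sum_le_sum fun i _ => ?_
    by_cases h : i ∈ S <;> simp [mixCoords, h, sq_nonneg]
  nlinarith [norm_nonneg x, norm_nonneg y]

theorem mixCoords_insert {S : Finset (Fin d)} {i : Fin d} (hi : i ∉ S) (x y : E d) :
    mixCoords (insert i S) x y
      = mixCoords S x y + (x i - y i) • EuclideanSpace.single i (1 : ℝ) := by
  ext j
  by_cases hj : j = i
  · subst hj; simp [mixCoords, hi]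
  · simp [mixCoords, hj]

theorem hasDerivAt_comp_line {p : E d → ℝ} {v z : E d} (a θ : ℝ)
    (hp : LineDifferentiableAt ℝ p (z + (θ * a) • v) v) :
    HasDerivAt (fun τ : ℝ => p (z + (τ * a) • v)) (a * lineDeriv ℝ p (z + (θ * a) • v) v) θ := by
  have h1 := hp.hasLineDerivAt
  unfold HasLineDerivAt at h1
  have h2 : HasDerivAt (fun τ : ℝ => (τ - θ) * a) a θ := by
    simpa using ((hasDerivAt_id θ).sub_const θ).mul_const a
  have h3 : HasDerivAt (fun t : ℝ => p (z + (θ * a) • v + t • v))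
      (lineDeriv ℝ p (z + (θ * a) • v) v) ((θ - θ) * a) := by
    simpa using h1
  have h4 := h3.comp θ h2
  rw [mul_comm a (lineDeriv ℝ _ _ _)]
  refine h4.congr_of_eventuallyEq (Filter.Eventually.of_forall fun τ => ?_)
  have e : z + (τ * a) • v = z + (θ * a) • v + ((τ - θ) * a) • v := by
    rw [add_assoc, ← add_smul]
    congr 2
    ring
  simp only [Function.comp, ← e]

theorem norm_single_one (i : Fin d) : ‖(EuclideanSpace.single i (1 : ℝ) : E d)‖ = 1 := by simp

theorem abs_lineDeriv_le {q : E d → ℝ} {K : ℝ} (hK : 0 ≤ K)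
    (hq : ∀ x y, |q x - q y| ≤ K * ‖x - y‖) (i : Fin d) (x : E d) :
    |lineDeriv ℝ q x (EuclideanSpace.single i 1)| ≤ K := by
  have hL : LipschitzWith ⟨K, hK⟩ q := LipschitzWith.of_dist_le_mul fun x y => by
    rw [Real.dist_eq, dist_eq_norm]; exact hq x y
  have := norm_lineDeriv_le_of_lipschitz ℝ hL (x₀ := x) (v := EuclideanSpace.single i (1 : ℝ))
  rw [norm_single_one, mul_one] at this
  exact this

/-- The second-order difference along one coordinate direction. -/
theorem abs_coordinate_difference_le {p q : E d → ℝ} {K B : ℝ} {i : Fin d} (hK : 0 ≤ K)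
    (hp : ∀ x, LineDifferentiableAt ℝ p x (EuclideanSpace.single i 1))
    (hq : ∀ x, LineDifferentiableAt ℝ q x (EuclideanSpace.single i 1))
    (hqK : ∀ x y, |q x - q y| ≤ K * ‖x - y‖) (z w : E d) (a a' : ℝ)
    (hB : ∀ θ ∈ Icc (0 : ℝ) 1,
      |lineDeriv ℝ p (z + (θ * a) • EuclideanSpace.single i 1) (EuclideanSpace.single i 1)
      - lineDeriv ℝ q (w + (θ * a') • EuclideanSpace.single i 1) (EuclideanSpace.single i 1)|
        ≤ B) :
    |(p (z + a • EuclideanSpace.single i 1) - p z)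
      - (q (w + a' • EuclideanSpace.single i 1) - q w)| ≤ K * |a - a'| + |a| * B := by
  set v : E d := EuclideanSpace.single i 1 with hv
  have key := norm_image_sub_le_of_norm_deriv_le_segment_01'
    (f := fun τ : ℝ => p (z + (τ * a) • v) - q (w + (τ * a') • v))
    (f' := fun τ => a * lineDeriv ℝ p (z + (τ * a) • v) v
      - a' * lineDeriv ℝ q (w + (τ * a') • v) v) (C := K * |a - a'| + |a| * B)
    (fun θ _ => ((hasDerivAt_comp_line a θ (hp _)).sub
      (hasDerivAt_comp_line a' θ (hq _))).hasDerivWithinAt) ?_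
  · simp only [one_mul, zero_mul, zero_smul, add_zero, Real.norm_eq_abs] at key
    refine le_trans (le_of_eq ?_) key
    congr 1
    ring
  · intro θ hθ
    have h1 := hB θ ⟨hθ.1, hθ.2.le⟩
    have h2 := abs_lineDeriv_le hK hqK i (w + (θ * a') • v)
    set X := lineDeriv ℝ p (z + (θ * a) • v) v
    set Y := lineDeriv ℝ q (w + (θ * a') • v) v
    rw [Real.norm_eq_abs, show a * X - a' * Y = Y * (a - a') + a * (X - Y) by ring]
    refine (abs_add_le _ _).trans (add_le_add ?_ ?_)
    · rw [abs_mul]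
      exact mul_le_mul_of_nonneg_right h2 (abs_nonneg _)
    · rw [abs_mul]
      exact mul_le_mul_of_nonneg_left h1 (abs_nonneg _)

theorem abs_apply_le_norm (x : E d) (i : Fin d) : |x i| ≤ ‖x‖ := PiLp.norm_apply_le x i

/-- The second-order difference of two functions whose partial derivatives are close to each
other and Hölder continuous. Passing from `y` to `x` one coordinate at a time needs only the
existence of partial derivatives. -/
theorem abs_four_point_le {p q : E d → ℝ} {K K₁ KN N δ η : ℝ} (hK : 0 ≤ K)
    (hKN : 0 ≤ KN) (hδ : 0 < δ)
    (hp : ∀ (i : Fin d) x, LineDifferentiableAt ℝ p x (EuclideanSpace.single i 1))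
    (hq : ∀ (i : Fin d) x, LineDifferentiableAt ℝ q x (EuclideanSpace.single i 1))
    (hqK : ∀ x y, |q x - q y| ≤ K * ‖x - y‖)
    (hpq : ∀ (i : Fin d) x, |lineDeriv ℝ p x (EuclideanSpace.single i 1)
      - lineDeriv ℝ q x (EuclideanSpace.single i 1)| ≤ K₁)
    (hpN : ∀ (i : Fin d) x y, ‖x‖ ≤ 4 * N → ‖y‖ ≤ 4 * N →
      |lineDeriv ℝ p x (EuclideanSpace.single i 1)
      - lineDeriv ℝ p y (EuclideanSpace.single i 1)| ≤ KN * ‖x - y‖ ^ δ)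
    {x₁ y₁ x₂ y₂ : E d} (hx₁ : ‖x₁‖ ≤ N) (hy₁ : ‖y₁‖ ≤ N) (hx₂ : ‖x₂‖ ≤ N) (hy₂ : ‖y₂‖ ≤ N)
    (hη : ‖x₁ - x₂‖ + ‖y₁ - y₂‖ ≤ η) :
    |(p x₁ - p y₁) - (q x₂ - q y₂)|
      ≤ d * (K * ‖(x₁ - y₁) - (x₂ - y₂)‖ + ‖x₁ - y₁‖ * (KN * (2 * η) ^ δ + K₁)) := by
  set B := KN * (2 * η) ^ δ + K₁ with hBdef
  set R := K * ‖(x₁ - y₁) - (x₂ - y₂)‖ + ‖x₁ - y₁‖ * B with hR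
  have hη0 : 0 ≤ η := le_trans (by positivity) hη
  have step : ∀ S : Finset (Fin d), |(p (mixCoords S x₁ y₁) - p y₁)
      - (q (mixCoords S x₂ y₂) - q y₂)| ≤ S.card * R := by
    intro S
    induction S using Finset.induction_on with
    | empty => simp [mixCoords]
    | insert i S hi ih =>
      have ha : ∀ x y : E d, |x i - y i| ≤ ‖x - y‖ := fun x y => abs_apply_le_norm (x - y) i
      have hB0 : 0 ≤ B := by
        have : 0 ≤ K₁ := (abs_nonneg _).trans (hpq i 0)
        positivity
      have hsm : ∀ θ ∈ Icc (0 : ℝ) 1, ∀ c : ℝ,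
          ‖(θ * c) • (EuclideanSpace.single i (1 : ℝ) : E d)‖ ≤ |c| := by
        intro θ hθ c
        rw [norm_smul, norm_single_one, mul_one, Real.norm_eq_abs, abs_mul, abs_of_nonneg hθ.1]
        exact mul_le_of_le_one_left (abs_nonneg _) hθ.2
      have hball : ∀ θ ∈ Icc (0 : ℝ) 1, ∀ x y : E d, ‖x‖ ≤ N → ‖y‖ ≤ N →
          ‖mixCoords S x y + (θ * (x i - y i)) • EuclideanSpace.single i (1 : ℝ)‖
            ≤ 4 * N := by
        intro θ hθ x y hx hy
        refine (norm_add_le _ _).trans ?_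
        have := norm_mixCoords_le S x y
        have := hsm θ hθ (x i - y i)
        have := ha x y
        have := norm_sub_le x y
        linarith
      -- the step from `mixCoords S` to `mixCoords (insert i S)` moves the coordinate `i` only
      have h1 := abs_coordinate_difference_le (B := B) hK (hp i) (hq i) hqK (mixCoords S x₁ y₁)
        (mixCoords S x₂ y₂) (x₁ i - y₁ i) (x₂ i - y₂ i) ?_
      · rw [mixCoords_insert hi, mixCoords_insert hi, Finset.card_insert_of_notMem hi]
        push_cast
        have h2 : |x₁ i - y₁ i - (x₂ i - y₂ i)| ≤ ‖(x₁ - y₁) - (x₂ - y₂)‖ :=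
          abs_apply_le_norm ((x₁ - y₁) - (x₂ - y₂)) i
        have h3 : K * |x₁ i - y₁ i - (x₂ i - y₂ i)| + |x₁ i - y₁ i| * B ≤ R := by
          rw [hR]
          gcongr
          exact ha x₁ y₁
        have h4 := abs_add_le _ _ |>.trans (add_le_add ih (h1.trans h3))
        refine le_trans (le_of_eq ?_) (h4.trans (le_of_eq (by ring)))
        congr 1
        ring
      · intro θ hθ
        set X := mixCoords S x₁ y₁ + (θ * (x₁ i - y₁ i)) • EuclideanSpace.single i (1 : ℝ)
          with hX
        set Y := mixCoords S x₂ y₂ + (θ * (x₂ i - y₂ i)) • EuclideanSpace.single i (1 : ℝ)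
          with hY
        have e : X - Y = mixCoords S (x₁ - x₂) (y₁ - y₂)
            + (θ * ((x₁ i - x₂ i) - (y₁ i - y₂ i))) • EuclideanSpace.single i (1 : ℝ) := by
          rw [← mixCoords_sub, hX, hY]
          module
        have hXY : ‖X - Y‖ ≤ 2 * η := by
          rw [e]
          refine (norm_add_le _ _).trans ?_
          have := norm_mixCoords_le S (x₁ - x₂) (y₁ - y₂)
          have := hsm θ hθ ((x₁ i - x₂ i) - (y₁ i - y₂ i))
          have := abs_sub (x₁ i - x₂ i) (y₁ i - y₂ i)
          have := ha x₁ x₂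
          have := ha y₁ y₂
          linarith
        have g1 := hpN i X Y (hball θ hθ x₁ y₁ hx₁ hy₁) (hball θ hθ x₂ y₂ hx₂ hy₂)
        have g2 := hpq i Y
        have g3 : KN * ‖X - Y‖ ^ δ ≤ KN * (2 * η) ^ δ := by gcongr
        refine (abs_sub_le _ (lineDeriv ℝ p Y (EuclideanSpace.single i 1)) _).trans ?_
        rw [hBdef]
        linarith
  have h := step Finset.univ
  have e : ∀ x y : E d, mixCoords Finset.univ x y = x := fun x y => by ext j; simp [mixCoords]
  rw [e, e, Finset.card_univ, Fintype.card_fin] at h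
  exact h

end FourPoint

/-! ### Kernels built from the diffusion coefficient -/

section Diffusion

variable {d : ℕ} {α β γ μ δ T K K₀ : ℝ} {KN : ℝ → ℝ}

/-- Spatial regularity of a scalar function `φ s x`: what (H1) says, for fixed `t`, of an entry of
`σ t` and of an entry of `∂_t σ t`. -/
structure SpatialReg (T β δ K : ℝ) (KN : ℝ → ℝ) (φ : ℝ → E d → ℝ) : Prop where
  lineDiff : ∀ s ∈ Icc 0 T, ∀ (i : Fin d) x,
    LineDifferentiableAt ℝ (φ s) x (EuclideanSpace.single i 1)
  lip : ∀ s ∈ Icc 0 T, ∀ x y, |φ s x - φ s y| ≤ K * ‖x - y‖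
  holder : ∀ s₁ ∈ Icc 0 T, ∀ s₂ ∈ Icc 0 T, ∀ x, |φ s₁ x - φ s₂ x| ≤ K * |s₁ - s₂| ^ β
  holder_lineDeriv : ∀ s₁ ∈ Icc 0 T, ∀ s₂ ∈ Icc 0 T, ∀ (i : Fin d) x,
    |lineDeriv ℝ (φ s₁) x (EuclideanSpace.single i 1)
      - lineDeriv ℝ (φ s₂) x (EuclideanSpace.single i 1)| ≤ K * |s₁ - s₂| ^ β
  local_lineDeriv : ∀ N, 0 ≤ N → ∀ s ∈ Icc 0 T, ∀ (i : Fin d) x y, ‖x‖ ≤ N → ‖y‖ ≤ N →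
    |lineDeriv ℝ (φ s) x (EuclideanSpace.single i 1)
      - lineDeriv ℝ (φ s) y (EuclideanSpace.single i 1)| ≤ KN N * ‖x - y‖ ^ δ

/-- A scalar entry `φ` of `σ`, with time derivative `χ`. -/
structure DiffusionEntry (T β μ δ K K₀ : ℝ) (KN : ℝ → ℝ) (φ χ : ℝ → ℝ → E d → ℝ) : Prop where
  reg : ∀ t ∈ Icc 0 T, SpatialReg T β δ K KN (φ t)
  reg_deriv : ∀ t ∈ Icc 0 T, SpatialReg T β δ K KN (χ t)
  hasDeriv : ∀ t ∈ Icc 0 T, ∀ s ∈ Icc 0 T, ∀ x,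
    HasDerivWithinAt (fun r => φ r s x) (χ t s x) (Icc 0 T) t
  holder_time : ∀ t₁ ∈ Icc 0 T, ∀ t₂ ∈ Icc 0 T, ∀ s ∈ Icc 0 T, ∀ x,
    |φ t₁ s x - φ t₂ s x| ≤ K * |t₁ - t₂| ^ μ
  zero_le : |φ 0 0 0| ≤ K₀

theorem rpow_le_mul_rpow {τ p q T : ℝ} (h0 : 0 ≤ τ) (hT : τ ≤ T) (hq : 0 ≤ q) (hqp : q ≤ p) :
    τ ^ p ≤ T ^ (p - q) * τ ^ q := by
  have := Real.rpow_add_of_nonneg h0 (by linarith : 0 ≤ p - q) hq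
  rw [sub_add_cancel] at this
  rw [this]
  gcongr

/-- The increments of a kernel in time, by the mean value inequality. -/
theorem KernelLe.of_hasDerivWithinAt {ψ χ : ℝ → ℝ → ℝ} {w : ℝ → ℝ} (hα : 0 ≤ α)
    (hw : ∀ r ∈ Icc 0 T, 0 ≤ w r) (hψ : ∀ t ∈ Icc 0 T, HolderLe γ T w (ψ t))
    (hinc : ∀ t ∈ Icc 0 T, ∀ s ∈ Ico 0 t, ∀ r ∈ Icc 0 T,
      |ψ t r - ψ s r| ≤ (t - s) ^ (1 - α) * w r)
    (hd : ∀ r ∈ Icc 0 T, ∀ t ∈ Icc 0 T,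
      HasDerivWithinAt (fun τ => ψ τ r) (χ t r) (Icc 0 T) t)
    (hχ : ∀ t ∈ Icc 0 T, ∀ r ∈ Icc 0 T, ∀ u ∈ Ico 0 r,
      |χ t r - χ t u| ≤ w r * (r - u) ^ γ) :
    KernelLe α γ T (fun r => (1 + T ^ α) * w r) ψ := by
  have hTα : ∀ t ∈ Icc 0 T, 0 ≤ T ^ α := fun t ht => Real.rpow_nonneg (ht.1.trans ht.2) _
  have hle : ∀ t ∈ Icc 0 T, ∀ r ∈ Icc 0 T, w r ≤ (1 + T ^ α) * w r := fun t ht r hr => by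
    have := mul_nonneg (hTα t ht) (hw r hr); linarith
  constructor
  · intro t ht
    refine ⟨fun r hr => ((hψ t ht).norm_le r hr).trans (hle t ht r hr), fun r hr u hu =>
      ((hψ t ht).sub_le r hr u hu).trans (mul_le_mul_of_nonneg_right (hle t ht r hr)
        (Real.rpow_nonneg (by linarith [hu.2]) _))⟩
  · intro t ht s hs
    have hts : 0 < t - s := by linarith [hs.2]
    have hp : 0 ≤ (t - s) ^ (1 - α) := Real.rpow_nonneg hts.le _
    refine ⟨fun r hr => (hinc t ht s hs r hr).trans
      (mul_le_mul_of_nonneg_left (hle t ht r hr) hp), fun r hr u hu => ?_⟩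
    have hu' : u ∈ Icc 0 T := ⟨hu.1, hu.2.le.trans hr.2⟩
    have hq : 0 ≤ (r - u) ^ γ := Real.rpow_nonneg (by linarith [hu.2]) _
    have h := (convex_Icc (0 : ℝ) T).norm_image_sub_le_of_norm_hasDerivWithin_le
      (f := fun τ => ψ τ r - ψ τ u) (f' := fun τ => χ τ r - χ τ u) (C := w r * (r - u) ^ γ)
      (fun τ hτ => (hd r hr τ hτ).sub (hd u hu' τ hτ))
      (fun τ hτ => hχ τ hτ r hr u hu) (x := s) (y := t) ⟨hs.1, hs.2.le.trans ht.2⟩ ht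
    have e : t - s ≤ T ^ α * (t - s) ^ (1 - α) := by
      calc t - s = (t - s) ^ α * (t - s) ^ (1 - α) := by
            rw [← Real.rpow_add hts]; simp
        _ ≤ _ := by gcongr; linarith [ht.2, hs.1]
    rw [Real.norm_of_nonneg hts.le] at h
    calc ‖ψ t r - ψ s r - (ψ t u - ψ s u)‖ = ‖ψ t r - ψ t u - (ψ s r - ψ s u)‖ := by
          congr 1; ring
      _ ≤ w r * (r - u) ^ γ * (t - s) := h
      _ ≤ w r * (r - u) ^ γ * (T ^ α * (t - s) ^ (1 - α)) := by
          have := hw r hr; gcongr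
      _ ≤ w r * (r - u) ^ γ * ((1 + T ^ α) * (t - s) ^ (1 - α)) := by
          have := hw r hr; gcongr; linarith
      _ = _ := by ring

/-- Linear growth of the kernel `φ t r (x r)` in the weighted Hölder norm of `x`. -/
theorem exists_kernelLe_comp (hT : 0 < T) (hα : 0 < α) (hα1 : α < 1) (hγ : 0 < γ) (hγβ : γ ≤ β)
    (hμ : 1 - α ≤ μ) (hK : 0 ≤ K) (hK₀ : 0 ≤ K₀) :
    ∃ C, 0 ≤ C ∧ ∀ (φ χ : ℝ → ℝ → E d → ℝ) (x : ℝ → E d) (e₀ e₁ lam : ℝ),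
      DiffusionEntry T β μ δ K K₀ KN φ χ → 0 ≤ e₀ → 0 ≤ e₁ → 0 < lam →
      HolderLe γ T (expWeight e₀ e₁ lam) x →
      KernelLe α γ T (expWeight (C * (1 + e₀)) (C * e₁) lam) (fun t r => φ t r (x r)) := by
  set C := K₀ + K * T ^ μ + K * T ^ β + K * T ^ (β - γ) + K + K * T ^ (μ - (1 - α)) with hC
  have hC0 : 0 ≤ C := by positivity
  have p1 : 0 ≤ K * T ^ μ := by positivity
  have p2 : 0 ≤ K * T ^ β := by positivity
  have p3 : 0 ≤ K * T ^ (β - γ) := by positivity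
  have p4 : 0 ≤ K * T ^ (μ - (1 - α)) := by positivity
  refine ⟨(1 + T ^ α) * C, by positivity, ?_⟩
  intro φ χ x e₀ e₁ lam hφ he₀ he₁ hl hx
  have h0 : (0 : ℝ) ∈ Icc 0 T := ⟨le_rfl, hT.le⟩
  have hw0 : ∀ r, 0 ≤ expWeight e₀ e₁ lam r := fun r => expWeight_nonneg he₀ he₁
  set w := fun r => C * (1 + expWeight e₀ e₁ lam r) with hw
  have hsub : ∀ ρ : ℝ → E d → ℝ, SpatialReg T β δ K KN ρ → ∀ r ∈ Icc 0 T, ∀ u ∈ Ico 0 r,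
      |ρ r (x r) - ρ u (x u)| ≤ w r * (r - u) ^ γ := by
    intro ρ hρ r hr u hu
    have hu' : u ∈ Icc 0 T := ⟨hu.1, hu.2.le.trans hr.2⟩
    have hru : 0 < r - u := by linarith [hu.2]
    have g1 := hρ.holder r hr u hu' (x r)
    have g2 := hρ.lip u hu' (x r) (x u)
    have g3 := hx.sub_le r hr u hu
    have g4 := rpow_le_mul_rpow (p := β) (q := γ) hru.le
      (by linarith [hr.2, hu.1] : r - u ≤ T) hγ.le hγβ
    rw [abs_of_pos hru] at g1
    have hq : 0 ≤ (r - u) ^ γ := Real.rpow_nonneg hru.le _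
    calc |ρ r (x r) - ρ u (x u)|
        ≤ |ρ r (x r) - ρ u (x r)| + |ρ u (x r) - ρ u (x u)| := abs_sub_le _ _ _
      _ ≤ K * (T ^ (β - γ) * (r - u) ^ γ) + K * (expWeight e₀ e₁ lam r * (r - u) ^ γ) := by
          gcongr
          · exact g1.trans (by gcongr)
          · exact g2.trans (by gcongr)
      _ = (K * T ^ (β - γ) + K * expWeight e₀ e₁ lam r) * (r - u) ^ γ := by ring
      _ ≤ w r * (r - u) ^ γ := by
          have := hw0 r
          have h1 : K * T ^ (β - γ) ≤ C := by rw [hC]; linarith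
          have h2 : K ≤ C := by rw [hC]; linarith
          have h3 := mul_le_mul_of_nonneg_right h2 this
          refine mul_le_mul_of_nonneg_right ?_ hq
          rw [hw]
          linarith
  have key := KernelLe.of_hasDerivWithinAt (α := α) (γ := γ) (T := T) (w := w)
    (ψ := fun t r => φ t r (x r)) (χ := fun t r => χ t r (x r)) hα.le
    (fun r _ => by have := hw0 r; positivity) ?_ ?_ ?_ ?_
  · convert key using 1
    ext r
    rw [hw]
    unfold expWeight
    ring
  · intro t ht
    refine ⟨fun r hr => ?_, hsub _ (hφ.reg t ht)⟩
    have g1 := (hφ.reg t ht).lip r hr (x r) 0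
    have g2 := (hφ.reg t ht).holder r hr 0 h0 0
    have g3 := hφ.holder_time t ht 0 h0 0 h0 0
    have g4 := hφ.zero_le
    have g5 := hx.norm_le r hr
    rw [sub_zero] at g1 g2 g3
    rw [abs_of_nonneg hr.1] at g2
    rw [abs_of_nonneg ht.1] at g3
    have hμ0 : 0 ≤ μ := by linarith
    have hβ0 : 0 ≤ β := by linarith
    have g6 : K * r ^ β ≤ K * T ^ β := by
      have := hr.1; have := hr.2; gcongr
    have g7 : K * t ^ μ ≤ K * T ^ μ := by
      have := ht.1; have := ht.2; gcongr
    have g8 : K * ‖x r‖ ≤ K * expWeight e₀ e₁ lam r := by gcongr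
    have g9 : K * expWeight e₀ e₁ lam r ≤ C * expWeight e₀ e₁ lam r :=
      mul_le_mul_of_nonneg_right (by rw [hC]; linarith) (hw0 r)
    rw [Real.norm_eq_abs, hw]
    have e : φ t r (x r) = (φ t r (x r) - φ t r 0) + (φ t r 0 - φ t 0 0)
      + (φ t 0 0 - φ 0 0 0) + φ 0 0 0 := by ring
    have a1 := abs_add_le ((φ t r (x r) - φ t r 0) + (φ t r 0 - φ t 0 0)
      + (φ t 0 0 - φ 0 0 0)) (φ 0 0 0)
    have a2 := abs_add_le ((φ t r (x r) - φ t r 0) + (φ t r 0 - φ t 0 0)) (φ t 0 0 - φ 0 0 0)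
    have a3 := abs_add_le (φ t r (x r) - φ t r 0) (φ t r 0 - φ t 0 0)
    rw [← e] at a1
    have : C * (1 + expWeight e₀ e₁ lam r) = C + C * expWeight e₀ e₁ lam r := by ring
    have : K₀ + K * T ^ μ + K * T ^ β ≤ C := by rw [hC]; linarith
    simp only
    linarith
  · intro t ht s hs r hr
    have hts : 0 < t - s := by linarith [hs.2]
    have g1 := hφ.holder_time t ht s ⟨hs.1, hs.2.le.trans ht.2⟩ r hr (x r)
    rw [abs_of_pos hts] at g1
    have g2 := rpow_le_mul_rpow (p := μ) (q := 1 - α) hts.le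
      (by linarith [ht.2, hs.1] : t - s ≤ T) (by linarith) hμ
    have hp : 0 ≤ (t - s) ^ (1 - α) := Real.rpow_nonneg hts.le _
    calc _ ≤ K * (T ^ (μ - (1 - α)) * (t - s) ^ (1 - α)) := g1.trans (by gcongr)
      _ = (t - s) ^ (1 - α) * (K * T ^ (μ - (1 - α))) := by ring
      _ ≤ _ := by
          refine mul_le_mul_of_nonneg_left ?_ hp
          have := mul_nonneg hC0 (hw0 r)
          rw [hw]
          simp only [mul_add, mul_one]
          have : K * T ^ (μ - (1 - α)) ≤ C := by rw [hC]; linarith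
          linarith
  · intro r hr t ht
    exact hφ.hasDeriv t ht r hr (x r)
  · intro t ht
    exact hsub _ (hφ.reg_deriv t ht)

/-- Local Lipschitz continuity of the kernel `φ t r (x r)` in the weighted Hölder norm, on
`(1-α)`-Hölder functions with a common constant `M`. -/
theorem exists_kernelLe_sub (hT : 0 < T) (hα : 0 < α) (hα1 : α < 1) (hγ : 0 < γ) (hγβ : γ ≤ β)
    (hδ : 0 < δ) (hγδ : γ ≤ (1 - α) * δ) (hK : 0 ≤ K) (hKN : ∀ N, 0 ≤ N → 0 ≤ KN N) {M : ℝ}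
    (hM : 0 ≤ M) :
    ∃ C, 0 ≤ C ∧ ∀ (φ χ : ℝ → ℝ → E d → ℝ) (x y : ℝ → E d) (D lam : ℝ),
      DiffusionEntry T β μ δ K K₀ KN φ χ → 0 ≤ D → 0 < lam →
      HolderLe (1 - α) T (fun _ => M) x → HolderLe (1 - α) T (fun _ => M) y →
      HolderLe γ T (expWeight 0 D lam) (fun r => x r - y r) →
      KernelLe α γ T (expWeight 0 (C * D) lam) (fun t r => φ t r (x r) - φ t r (y r)) := by
  set B := K + KN (4 * M) * ((4 * M) ^ δ * T ^ ((1 - α) * δ - γ)) + K * T ^ (β - γ) with hB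
  have hKN' := hKN (4 * M) (by positivity)
  have hB0 : 0 ≤ B := by positivity
  set C := K * (1 + T ^ α) + d * B with hC
  have hC0 : 0 ≤ C := by positivity
  refine ⟨(1 + T ^ α) * C, by positivity, ?_⟩
  intro φ χ x y D lam hφ hD hl hx hy hz
  have hw0 : ∀ r, 0 ≤ expWeight 0 D lam r := fun r => expWeight_nonneg le_rfl hD
  set w := fun r => C * expWeight 0 D lam r with hw
  have hsub : ∀ ρ : ℝ → E d → ℝ, SpatialReg T β δ K KN ρ → ∀ r ∈ Icc 0 T, ∀ u ∈ Ico 0 r,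
      |(ρ r (x r) - ρ r (y r)) - (ρ u (x u) - ρ u (y u))| ≤ w r * (r - u) ^ γ := by
    intro ρ hρ r hr u hu
    have hu' : u ∈ Icc 0 T := ⟨hu.1, hu.2.le.trans hr.2⟩
    have hru : 0 < r - u := by linarith [hu.2]
    have hruT : r - u ≤ T := by linarith [hr.2, hu.1]
    set Q := (r - u) ^ (1 - α) with hQ
    have hQ0 : 0 ≤ Q := Real.rpow_nonneg hru.le _
    have h4 := abs_four_point_le (K := K) (K₁ := K * (r - u) ^ β) (KN := KN (4 * M)) (N := M)
      (δ := δ) (η := 2 * (M * Q)) hK hKN' hδ (hρ.lineDiff r hr) (hρ.lineDiff u hu')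
      (hρ.lip u hu')
      (fun i z => by
        have := hρ.holder_lineDeriv r hr u hu' i z
        rwa [abs_of_pos hru] at this)
      (hρ.local_lineDeriv (4 * M) (by positivity) r hr) (hx.norm_le r hr) (hy.norm_le r hr)
      (hx.norm_le u hu') (hy.norm_le u hu')
      (by linarith [hx.sub_le r hr u hu, hy.sub_le r hr u hu])
    have g1 := rpow_le_mul_rpow (p := β) (q := γ) hru.le hruT hγ.le hγβ
    have g2 := rpow_le_mul_rpow (p := (1 - α) * δ) (q := γ) hru.le hruT hγ.le hγδ
    have g3 : (2 * (2 * (M * Q))) ^ δ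
        ≤ (4 * M) ^ δ * T ^ ((1 - α) * δ - γ) * (r - u) ^ γ := by
      rw [show 2 * (2 * (M * Q)) = (4 * M) * Q by ring, Real.mul_rpow (by positivity) hQ0, hQ,
        ← Real.rpow_mul hru.le, mul_assoc]
      gcongr
    have g4 := hz.norm_le r hr
    have g5 := hz.sub_le r hr u hu
    have hq : 0 ≤ (r - u) ^ γ := Real.rpow_nonneg hru.le _
    have hwr := hw0 r
    refine h4.trans ?_
    calc _ ≤ (d : ℝ) * (K * (expWeight 0 D lam r * (r - u) ^ γ) + expWeight 0 D lam r *
          (KN (4 * M) * ((4 * M) ^ δ * T ^ ((1 - α) * δ - γ) * (r - u) ^ γ)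
            + K * (T ^ (β - γ) * (r - u) ^ γ))) := by gcongr
      _ = d * B * expWeight 0 D lam r * (r - u) ^ γ := by rw [hB]; ring
      _ ≤ w r * (r - u) ^ γ := by
          have h1 : 0 ≤ K * (1 + T ^ α) := by positivity
          have h2 : d * B ≤ C := by rw [hC]; linarith
          exact mul_le_mul_of_nonneg_right (mul_le_mul_of_nonneg_right h2 hwr) hq
  have hle : ∀ ρ : ℝ → E d → ℝ, SpatialReg T β δ K KN ρ → ∀ r ∈ Icc 0 T,
      |ρ r (x r) - ρ r (y r)| ≤ K * expWeight 0 D lam r := by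
    intro ρ hρ r hr
    have := hz.norm_le r hr
    exact (hρ.lip r hr _ _).trans (by gcongr)
  have hdB : 0 ≤ d * B := by positivity
  have key := KernelLe.of_hasDerivWithinAt (α := α) (γ := γ) (T := T) (w := w)
    (ψ := fun t r => φ t r (x r) - φ t r (y r))
    (χ := fun t r => χ t r (x r) - χ t r (y r)) hα.le
    (fun r _ => by have := hw0 r; positivity) ?_ ?_ ?_ ?_
  · convert key using 1
    ext r
    rw [hw]
    unfold expWeight
    ring
  · intro t ht
    refine ⟨fun r hr => (hle _ (hφ.reg t ht) r hr).trans ?_, hsub _ (hφ.reg t ht)⟩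
    rw [hw]
    have h1 : K ≤ C := by
      have : 0 ≤ K * T ^ α := by positivity
      rw [hC]; linarith
    exact mul_le_mul_of_nonneg_right h1 (hw0 r)
  · intro t ht s hs r hr
    have hts : 0 < t - s := by linarith [hs.2]
    have h := (convex_Icc (0 : ℝ) T).norm_image_sub_le_of_norm_hasDerivWithin_le
      (f := fun τ => φ τ r (x r) - φ τ r (y r)) (f' := fun τ => χ τ r (x r) - χ τ r (y r))
      (C := K * expWeight 0 D lam r)
      (fun τ hτ => (hφ.hasDeriv τ hτ r hr (x r)).sub (hφ.hasDeriv τ hτ r hr (y r)))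
      (fun τ hτ => hle _ (hφ.reg_deriv τ hτ) r hr) (x := s) (y := t)
      ⟨hs.1, hs.2.le.trans ht.2⟩ ht
    rw [Real.norm_of_nonneg hts.le] at h
    have e := rpow_le_mul_rpow (p := 1) (q := 1 - α) hts.le
      (by linarith [ht.2, hs.1] : t - s ≤ T) (by linarith) (by linarith)
    rw [Real.rpow_one, show (1 : ℝ) - (1 - α) = α by ring] at e
    have hwr := hw0 r
    have hp : 0 ≤ (t - s) ^ (1 - α) := Real.rpow_nonneg hts.le _
    calc _ ≤ K * expWeight 0 D lam r * (T ^ α * (t - s) ^ (1 - α)) := by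
          refine le_trans h ?_
          gcongr
      _ = (t - s) ^ (1 - α) * (K * T ^ α * expWeight 0 D lam r) := by ring
      _ ≤ _ := by
          rw [hw]
          simp only
          gcongr
          rw [hC]
          linarith
  · intro r hr t ht
    exact (hφ.hasDeriv t ht r hr (x r)).sub (hφ.hasDeriv t ht r hr (y r))
  · intro t ht
    exact hsub _ (hφ.reg_deriv t ht)

end Diffusion

section FromHypothesis

attribute [local instance] Matrix.frobeniusNormedAddCommGroup

theorem abs_entry_le_frobenius {d m : ℕ} (A : Matrix (Fin d) (Fin m) ℝ) (k : Fin d) (j : Fin m) :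
    |A k j| ≤ ‖A‖ := by
  have h : ‖A‖ = ‖(WithLp.toLp 2 fun i => WithLp.toLp 2 (A i) : PiLp 2 fun _ : Fin d =>
    PiLp 2 fun _ : Fin m => ℝ)‖ := rfl
  rw [h]
  exact (PiLp.norm_apply_le (WithLp.toLp 2 (A k) : PiLp 2 fun _ : Fin m => ℝ) j).trans
    (PiLp.norm_apply_le (WithLp.toLp 2 fun i => WithLp.toLp 2 (A i) : PiLp 2 fun _ : Fin d =>
    PiLp 2 fun _ : Fin m => ℝ) k)

/-- The entries of a coefficient satisfying (H1), with common constants. -/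
theorem HypH1.exists_diffusionEntry {d m : ℕ} {T β μ δ : ℝ}
    {σ : ℝ → ℝ → E d → Matrix (Fin d) (Fin m) ℝ} (h : HypH1 T β μ δ σ) :
    ∃ (K K₀ : ℝ) (KN : ℝ → ℝ), 0 ≤ K ∧ 0 ≤ K₀ ∧ (∀ N, 0 ≤ N → 0 ≤ KN N) ∧
      ∀ k j, DiffusionEntry T β μ δ K K₀ KN (fun t s x => σ t s x k j)
        (fun t s x => partialT T σ t s x k j) := by
  obtain ⟨K, hK, h1, h3, h4, h5⟩ := h.exists_const
  choose KN hKN h2 using h.exists_localConst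
  classical
  set KN' : ℝ → ℝ := fun N => if hN : 0 ≤ N then KN N hN else 0 with hKN'
  have hle : ∀ (A B : Matrix (Fin d) (Fin m) ℝ) k j, |A k j - B k j| ≤ ‖A - B‖ :=
    fun A B k j => abs_entry_le_frobenius (A - B) k j
  refine ⟨K, ‖σ 0 0 0‖, KN', hK.le, norm_nonneg _, fun N hN => ?_, fun k j => ?_⟩
  · simp only [hKN', hN, dif_pos]
    exact (hKN N hN).le
  · refine ⟨fun t ht => ⟨?_, ?_, ?_, ?_, ?_⟩, fun t ht => ⟨?_, ?_, ?_, ?_, ?_⟩, ?_, ?_, ?_⟩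
    · intro s hs i x
      exact h.exists_partialX t ht s hs x i k j
    · intro s hs x y
      exact (hle _ _ k j).trans ((le_add_of_nonneg_right (norm_nonneg _)).trans (h1 t ht s hs x y))
    · intro s₁ hs₁ s₂ hs₂ x
      exact (hle _ _ k j).trans
        ((le_add_of_nonneg_right (norm_nonneg _)).trans (h4 t ht s₁ hs₁ s₂ hs₂ x))
    · intro s₁ hs₁ s₂ hs₂ i x
      exact (hle (partialX i σ t s₁ x) (partialX i σ t s₂ x) k j).trans
        ((le_add_of_nonneg_left (norm_nonneg _)).trans (h5 t ht s₁ hs₁ s₂ hs₂ x i))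
    · intro N hN s hs i x y hx hy
      simp only [hKN', hN, dif_pos]
      exact (hle (partialX i σ t s x) (partialX i σ t s y) k j).trans
        ((le_add_of_nonneg_right (norm_nonneg _)).trans (h2 N hN t ht s hs x y hx hy i))
    · intro s hs i x
      exact h.exists_partialXT t ht s hs x i k j
    · intro s hs x y
      exact (hle _ _ k j).trans ((le_add_of_nonneg_left (norm_nonneg _)).trans (h1 t ht s hs x y))
    · intro s₁ hs₁ s₂ hs₂ x
      exact (hle _ _ k j).trans
        ((le_add_of_nonneg_left (norm_nonneg _)).trans (h4 t ht s₁ hs₁ s₂ hs₂ x))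
    · intro s₁ hs₁ s₂ hs₂ i x
      exact (hle (partialXT T i σ t s₁ x) (partialXT T i σ t s₂ x) k j).trans
        ((le_add_of_nonneg_right (norm_nonneg _)).trans (h5 t ht s₁ hs₁ s₂ hs₂ x i))
    · intro N hN s hs i x y hx hy
      simp only [hKN', hN, dif_pos]
      exact (hle (partialXT T i σ t s x) (partialXT T i σ t s y) k j).trans
        ((le_add_of_nonneg_left (norm_nonneg _)).trans (h2 N hN t ht s hs x y hx hy i))
    · intro t ht s hs x
      exact (h.exists_partialT t ht s hs x k j).hasDerivWithinAt
    · intro t₁ ht₁ t₂ ht₂ s hs x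
      rcases isEmpty_or_nonempty (Fin d) with hd | ⟨⟨i⟩⟩
      · exact hd.elim k
      · exact (hle _ _ k j).trans
          ((le_add_of_nonneg_right (norm_nonneg _)).trans (h3 t₁ ht₁ t₂ ht₂ s hs x i))
    · exact abs_entry_le_frobenius _ k j

end FromHypothesis

/-! ### The drift integral -/

section Drift

variable {d : ℕ} {α γ μ T : ℝ} {b : ℝ → ℝ → E d → E d}

theorem integral_norm_le_of_memLp {f : ℝ → ℝ} {s t : ℝ} (hα : 0 < α) (hα1 : α < 1)
    (hf : MemLp f (ENNReal.ofReal (1 / α)) (volume.restrict (Icc 0 T))) (hs : 0 ≤ s)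
    (hst : s ≤ t) (ht : t ≤ T) :
    ∫ r in s..t, ‖f r‖ ≤ (eLpNorm f (ENNReal.ofReal (1 / α))
      (volume.restrict (Icc 0 T))).toReal * (t - s) ^ (1 - α) := by
  have hsub : Ioc s t ⊆ Icc 0 T := fun r hr => ⟨hs.trans hr.1.le, hr.2.trans ht⟩
  have hle : volume.restrict (Ioc s t) ≤ volume.restrict (Icc (0 : ℝ) T) :=
    Measure.restrict_mono hsub le_rfl
  have haes : AEStronglyMeasurable f (volume.restrict (Ioc s t)) := hf.1.mono_measure hle
  have hp : (1 : ℝ≥0∞) ≤ ENNReal.ofReal (1 / α) := by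
    rw [ENNReal.one_le_ofReal, le_div_iff₀ hα]; linarith
  have h := eLpNorm_le_eLpNorm_mul_rpow_measure_univ hp haes
  have hts : 0 ≤ t - s := by linarith
  have e : (1 : ℝ) / (1 : ℝ≥0∞).toReal - 1 / (ENNReal.ofReal (1 / α)).toReal = 1 - α := by
    rw [ENNReal.toReal_ofReal (by positivity)]; simp
  rw [e, Measure.restrict_apply_univ, Real.volume_Ioc,
    ENNReal.ofReal_rpow_of_nonneg hts (by linarith)] at h
  have h2 := h.trans (mul_le_mul' (eLpNorm_mono_measure f hle) le_rfl)
  rw [eLpNorm_one_eq_lintegral_enorm] at h2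
  rw [intervalIntegral.integral_of_le hst, integral_norm_eq_lintegral_enorm haes]
  have h3 := ENNReal.toReal_mono (ENNReal.mul_ne_top hf.2.ne ENNReal.ofReal_ne_top) h2
  rwa [ENNReal.toReal_mul, ENNReal.toReal_ofReal (Real.rpow_nonneg hts _)] at h3

/-- A growth bound for `b` whose inhomogeneous part does not depend on `t`: one slice
`b₀(t_*, ·) ∈ L^{1/α}` serves for all times, because `b` is Hölder continuous in `t`. -/
theorem HypH2.exists_uniform_growth (hT : 0 < T) (hα : 0 < α) (hα1 : α < 1)
    (hb : HypH2 T (1 / α) μ b) :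
    ∃ (L₀ c : ℝ) (h : ℝ → ℝ), 0 ≤ L₀ ∧ 0 ≤ c ∧ IntegrableOn h (Icc 0 T) ∧
      (∀ t ∈ Icc 0 T, ∀ s ∈ Ico 0 t, ∫ r in s..t, h r ≤ c * (t - s) ^ (1 - α)) ∧
      ∀ t ∈ Icc 0 T, ∀ r ∈ Icc 0 T, ∀ x, ‖b t r x‖ ≤ L₀ * ‖x‖ + h r := by
  obtain ⟨L₀, b₀, hL₀, hmem, hgrow⟩ := hb.exists_growth
  obtain ⟨L, hL, hLb⟩ := hb.exists_holderConst
  have hα' : 0 < 1 / α := by positivity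
  have hp0 : ENNReal.ofReal (1 / α) ≠ 0 := (ENNReal.ofReal_pos.2 hα').ne'
  have hmeas : (volume.restrict (Icc (0 : ℝ) T ×ˢ Icc (0 : ℝ) T) : Measure (ℝ × ℝ))
      = (volume.restrict (Icc 0 T)).prod (volume.restrict (Icc 0 T)) := by
    rw [Measure.prod_restrict, Measure.volume_eq_prod]
  rw [hmeas] at hmem
  have hslice : ∀ᵐ t ∂volume.restrict (Icc (0 : ℝ) T),
      MemLp (b₀ t) (ENNReal.ofReal (1 / α)) (volume.restrict (Icc 0 T)) := by
    filter_upwards [(hmem.integrable_norm_rpow hp0 ENNReal.ofReal_ne_top).prod_right_ae,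
      hmem.1.prodMk_left] with t h1 h2
    exact (integrable_norm_rpow_iff h2 hp0 ENNReal.ofReal_ne_top).1 h1
  have hne : (ae (volume.restrict (Icc (0 : ℝ) T))).NeBot := by
    rw [ae_neBot, Ne, Measure.restrict_eq_zero, Real.volume_Icc]
    simpa using hT
  obtain ⟨t₀, ht₀, hf⟩ := ((ae_restrict_mem measurableSet_Icc).and hslice).exists
  set c₀ := (eLpNorm (b₀ t₀) (ENNReal.ofReal (1 / α)) (volume.restrict (Icc 0 T))).toReal
  have hint : IntegrableOn (fun r => ‖b₀ t₀ r‖) (Icc 0 T) := by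
    refine (hf.integrable ?_).norm
    rw [ENNReal.one_le_ofReal, le_div_iff₀ hα]; linarith
  have hμ := hb.μ_pos
  refine ⟨L₀, c₀ + L * T ^ μ * T ^ α, fun r => ‖b₀ t₀ r‖ + L * T ^ μ, hL₀.le, by positivity,
    hint.add (integrableOn_const (by simp)), ?_, ?_⟩
  · intro t ht s hs
    have hts : 0 ≤ t - s := by linarith [hs.2]
    have i1 : IntervalIntegrable (fun r => ‖b₀ t₀ r‖) volume s t :=
      intervalIntegrable_of_mem_Icc ⟨hs.1, hs.2.le.trans ht.2⟩ ht hint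
    rw [intervalIntegral.integral_add i1 (by simp), intervalIntegral.integral_const, smul_eq_mul]
    have h1 := integral_norm_le_of_memLp hα hα1 hf hs.1 hs.2.le ht.2
    have h2 := rpow_le_mul_rpow (p := 1) (q := 1 - α) hts
      (by linarith [ht.2, hs.1] : t - s ≤ T) (by linarith) (by linarith)
    rw [Real.rpow_one, show (1 : ℝ) - (1 - α) = α by ring] at h2
    have h3 := mul_le_mul_of_nonneg_left h2 (by positivity : 0 ≤ L * T ^ μ)
    calc _ ≤ c₀ * (t - s) ^ (1 - α) + L * T ^ μ * (T ^ α * (t - s) ^ (1 - α)) := by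
          rw [mul_comm (t - s)]
          exact add_le_add h1 h3
      _ = _ := by ring
  · intro t ht r hr x
    have h1 := hLb t ht t₀ ht₀ r hr x
    have h2 := hgrow t₀ ht₀ r hr x
    have h3 : |t - t₀| ^ μ ≤ T ^ μ := by
      refine Real.rpow_le_rpow (abs_nonneg _) ?_ hμ.le
      rw [abs_le]; constructor <;> linarith [ht.1, ht.2, ht₀.1, ht₀.2]
    have h4 : ‖b t r x‖ ≤ ‖b t₀ r x‖ + ‖b t r x - b t₀ r x‖ := by
      have := norm_add_le (b t₀ r x) (b t r x - b t₀ r x)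
      rwa [add_sub_cancel] at this
    have h5 := mul_le_mul_of_nonneg_left h3 hL.le
    have h6 := Real.le_norm_self (b₀ t₀ r)
    linarith

theorem HypH2.aestronglyMeasurable_comp (hb : HypH2 T (1 / α) μ b) {x : ℝ → E d}
    (hx : ContinuousOn x (Icc 0 T)) {t : ℝ} (ht : t ∈ Icc 0 T) :
    AEStronglyMeasurable (fun r => b t r (x r)) (volume.restrict (Icc 0 T)) := by
  have h1 : Measurable fun r : Icc (0 : ℝ) T =>
      ((⟨t, ht⟩, r, x r) : Icc (0 : ℝ) T × Icc (0 : ℝ) T × E d) :=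
    measurable_const.prodMk (measurable_id.prodMk hx.domRestrict.measurable)
  have h2 := measurable_indicator_of_subtype (f := fun r => b t r (x r)) measurableSet_Icc
    (hb.measurable.comp h1)
  refine h2.aestronglyMeasurable.congr ?_
  filter_upwards [ae_restrict_mem measurableSet_Icc] with r hr
  rw [indicator_of_mem hr]

theorem HypH2.integrableOn_comp (hT : 0 < T) (hα : 0 < α) (hα1 : α < 1)
    (hb : HypH2 T (1 / α) μ b) {x : ℝ → E d} (hx : ContinuousOn x (Icc 0 T)) {t : ℝ}
    (ht : t ∈ Icc 0 T) : IntegrableOn (fun r => b t r (x r)) (Icc 0 T) := by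
  obtain ⟨L₀, c, h, -, -, hint, -, hle⟩ := hb.exists_uniform_growth hT hα hα1
  refine Integrable.mono' (g := fun r => L₀ * ‖x r‖ + h r) ?_
    (hb.aestronglyMeasurable_comp hx ht) ?_
  · exact ((hx.norm.integrableOn_Icc).const_mul L₀).add hint
  · filter_upwards [ae_restrict_mem measurableSet_Icc] with r hr
    exact hle t ht r hr (x r)

/-- Increments of the drift integral in the weighted Hölder norm: linear growth. -/
theorem HypH2.exists_drift_sub_le {κ : ℝ} (hT : 0 < T) (hα : 0 < α) (hγ : 0 < γ) (hκ : 0 ≤ κ)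
    (hακ : α + κ < 1) (hμ : 1 - α ≤ μ) (hb : HypH2 T (1 / α) μ b) :
    ∃ C, 0 ≤ C ∧ ∀ (x : ℝ → E d) (e₀ e₁ lam : ℝ), 0 ≤ e₀ → 0 ≤ e₁ → 0 < lam →
      HolderLe γ T (expWeight e₀ e₁ lam) x → ∀ t ∈ Icc 0 T, ∀ s ∈ Ico 0 t,
      ‖(∫ r in (0 : ℝ)..t, b t r (x r)) - ∫ r in (0 : ℝ)..s, b s r (x r)‖
        ≤ C * (1 + e₀ + e₁ * lam ^ (-κ)) * Real.exp (lam * t) * (t - s) ^ (1 - α - κ) := by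
  obtain ⟨L₀, c, h, hL₀, hc, hint, hh, hle⟩ := hb.exists_uniform_growth hT hα (by linarith)
  obtain ⟨L, hL, hLb⟩ := hb.exists_holderConst
  obtain ⟨C, hC, H⟩ := exists_integral_sub_le (F := E d) hα hκ hακ hT.le
  -- `|t-s|^μ ≤ T^{μ-(1-α)} |t-s|^{1-α}` since `1 - α ≤ μ`
  set A := L₀ + L * T ^ (μ - (1 - α)) with hA
  have hA' : 0 ≤ L * T ^ (μ - (1 - α)) := by positivity
  have hA0 : 0 ≤ A := by positivity
  refine ⟨C * (A + c), by positivity, ?_⟩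
  intro x e₀ e₁ lam he₀ he₁ hl hx t ht s hs
  have hxc := hx.continuousOn hγ he₁ hl.le
  have hlk : 0 ≤ lam ^ (-κ) := Real.rpow_nonneg hl.le _
  have hts : 0 ≤ t - s := by linarith [hs.2]
  have hw : ∀ r, expWeight (A * (1 + e₀)) (A * e₁) lam r = A + A * expWeight e₀ e₁ lam r :=
    fun r => by unfold expWeight; ring
  have key := H (fun t r => b t r (x r)) h (A * (1 + e₀)) (A * e₁) c lam (by positivity)
    (by positivity) hc hl (fun t ht => hb.integrableOn_comp hT hα (by linarith) hxc ht) hint hh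
    ?_ ?_ t ht s hs
  · refine key.trans ?_
    have hq : 0 ≤ (t - s) ^ (1 - α - κ) := Real.rpow_nonneg hts _
    have : A * (1 + e₀) + c + A * e₁ * lam ^ (-κ)
        ≤ (A + c) * (1 + e₀ + e₁ * lam ^ (-κ)) := by
      have : 0 ≤ c * (e₀ + e₁ * lam ^ (-κ)) := by positivity
      linarith
    calc _ ≤ C * ((A + c) * (1 + e₀ + e₁ * lam ^ (-κ))) * Real.exp (lam * t)
          * (t - s) ^ (1 - α - κ) := by gcongr
      _ = _ := by ring
  · intro t ht r hr
    have h1 := hle t ht r hr (x r)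
    have h2 := mul_le_mul_of_nonneg_left (hx.norm_le r hr) hL₀
    have h3 : L₀ * expWeight e₀ e₁ lam r ≤ A * expWeight e₀ e₁ lam r :=
      mul_le_mul_of_nonneg_right (by rw [hA]; linarith) (expWeight_nonneg he₀ he₁)
    rw [hw]
    linarith
  · intro t ht s hs r hr
    have hts : 0 < t - s := by linarith [hs.2]
    have h1 := hLb t ht s ⟨hs.1, hs.2.le.trans ht.2⟩ r hr (x r)
    rw [abs_of_pos hts] at h1
    have h2 := rpow_le_mul_rpow (p := μ) (q := 1 - α) hts.le
      (by linarith [ht.2, hs.1] : t - s ≤ T) (by linarith) hμ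
    have hp : 0 ≤ (t - s) ^ (1 - α) := Real.rpow_nonneg hts.le _
    calc _ ≤ L * (T ^ (μ - (1 - α)) * (t - s) ^ (1 - α)) := h1.trans (by gcongr)
      _ = (t - s) ^ (1 - α) * (L * T ^ (μ - (1 - α))) := by ring
      _ ≤ _ := by
          refine mul_le_mul_of_nonneg_left ?_ hp
          rw [hw]
          have := mul_nonneg hA0 (expWeight_nonneg (r := r) (lam := lam) he₀ he₁)
          linarith

/-- Increments of the difference of two drift integrals. -/
theorem HypH2.exists_drift_sub_sub_le {κ : ℝ} (hT : 0 < T) (hα : 0 < α) (hκ : 0 ≤ κ)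
    (hακ : α + κ < 1) (hb : HypH2 T (1 / α) μ b) {M : ℝ} (hM : 0 ≤ M) :
    ∃ C, 0 ≤ C ∧ ∀ (x y : ℝ → E d) (D lam : ℝ), 0 ≤ D → 0 < lam →
      HolderLe (1 - α) T (fun _ => M) x → HolderLe (1 - α) T (fun _ => M) y →
      HolderLe γ T (expWeight 0 D lam) (fun r => x r - y r) → ∀ t ∈ Icc 0 T, ∀ s ∈ Ico 0 t,
      ‖((∫ r in (0 : ℝ)..t, b t r (x r)) - ∫ r in (0 : ℝ)..t, b t r (y r))
        - ((∫ r in (0 : ℝ)..s, b s r (x r)) - ∫ r in (0 : ℝ)..s, b s r (y r))‖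
        ≤ C * (D * lam ^ (-κ)) * Real.exp (lam * t) * (t - s) ^ (1 - α - κ) := by
  obtain ⟨LN, hLN, h1, h2⟩ := hb.exists_localConst M hM
  obtain ⟨C, hC, H⟩ := exists_integral_sub_le (F := E d) hα hκ hακ hT.le
  refine ⟨C * (LN * (1 + T ^ α)), by positivity, ?_⟩
  intro x y D lam hD hl hx hy hz t ht s hs
  have hxc := continuousOn_of_holder (by linarith) hx.sub_le
  have hyc := continuousOn_of_holder (by linarith) hy.sub_le
  have hint : ∀ {x}, ContinuousOn x (Icc 0 T) → ∀ t ∈ Icc 0 T,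
      IntegrableOn (fun r => b t r (x r)) (Icc 0 T) := fun hx t ht =>
    hb.integrableOn_comp hT hα (by linarith) hx ht
  have h0 : (0 : ℝ) ∈ Icc 0 T := ⟨le_rfl, hT.le⟩
  have hs' : s ∈ Icc 0 T := ⟨hs.1, hs.2.le.trans ht.2⟩
  rw [← intervalIntegral.integral_sub (intervalIntegrable_of_mem_Icc h0 ht (hint hxc t ht))
      (intervalIntegrable_of_mem_Icc h0 ht (hint hyc t ht)),
    ← intervalIntegral.integral_sub (intervalIntegrable_of_mem_Icc h0 hs' (hint hxc s hs'))
      (intervalIntegrable_of_mem_Icc h0 hs' (hint hyc s hs'))]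
  have hw : ∀ r, expWeight 0 (LN * (1 + T ^ α) * D) lam r
      = LN * (1 + T ^ α) * expWeight 0 D lam r := fun r => by unfold expWeight; ring
  have hw0 : ∀ r, 0 ≤ expWeight 0 D lam r := fun r => expWeight_nonneg le_rfl hD
  have key := H (fun t r => b t r (x r) - b t r (y r)) (fun _ => 0) 0 (LN * (1 + T ^ α) * D) 0
    lam le_rfl (by positivity) le_rfl hl
    (fun t ht => (hint hxc t ht).sub (hint hyc t ht)) (by simp) (by simp) ?_ ?_ t ht s hs
  · refine key.trans (le_of_eq ?_)
    ring
  · intro t ht r hr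
    have g1 := h1 t ht r hr (x r) (y r) (hx.norm_le r hr) (hy.norm_le r hr)
    have g2 := mul_le_mul_of_nonneg_left (hz.norm_le r hr) hLN.le
    have g3 : 0 ≤ LN * T ^ α * expWeight 0 D lam r := by have := hw0 r; positivity
    rw [hw]
    linarith
  · intro t ht s hs r hr
    have hts : 0 < t - s := by linarith [hs.2]
    have g1 := h2 t ht s ⟨hs.1, hs.2.le.trans ht.2⟩ r hr (x r) (y r) (hx.norm_le r hr)
      (hy.norm_le r hr)
    rw [abs_of_pos hts] at g1
    have e := rpow_le_mul_rpow (p := 1) (q := 1 - α) hts.le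
      (by linarith [ht.2, hs.1] : t - s ≤ T) (by linarith) (by linarith)
    rw [Real.rpow_one, show (1 : ℝ) - (1 - α) = α by ring] at e
    have hp : 0 ≤ (t - s) ^ (1 - α) := Real.rpow_nonneg hts.le _
    have g2 := hz.norm_le r hr
    have hwr := hw0 r
    rw [hw]
    calc _ ≤ LN * (t - s) * ‖x r - y r‖ := by
          refine le_trans (le_of_eq ?_) g1
          congr 1
          abel
      _ ≤ LN * (T ^ α * (t - s) ^ (1 - α)) * expWeight 0 D lam r := by gcongr
      _ = (t - s) ^ (1 - α) * (LN * T ^ α * expWeight 0 D lam r) := by ring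
      _ ≤ _ := by
          gcongr
          linarith

end Drift

/-! ### Membership in the function spaces -/

section Spaces

variable {F : Type*} [NormedAddCommGroup F] {α γ T M : ℝ}

theorem HolderLe.mono {w w' : ℝ → ℝ} {f : ℝ → F} (hf : HolderLe γ T w f)
    (h : ∀ r ∈ Icc 0 T, w r ≤ w' r) : HolderLe γ T w' f :=
  ⟨fun r hr => (hf.norm_le r hr).trans (h r hr), fun r hr u hu => (hf.sub_le r hr u hu).trans
    (mul_le_mul_of_nonneg_right (h r hr) (Real.rpow_nonneg (by linarith [hu.2]) _))⟩

theorem HolderLe.congr {w : ℝ → ℝ} {f g : ℝ → F} (hf : HolderLe γ T w f)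
    (h : ∀ r ∈ Icc 0 T, f r = g r) : HolderLe γ T w g := by
  refine ⟨fun r hr => h r hr ▸ hf.norm_le r hr, fun r hr u hu => ?_⟩
  rw [← h r hr, ← h u ⟨hu.1, hu.2.le.trans hr.2⟩]
  exact hf.sub_le r hr u hu

theorem HolderLe.add {w w' : ℝ → ℝ} {f g : ℝ → F} (hf : HolderLe γ T w f)
    (hg : HolderLe γ T w' g) : HolderLe γ T (fun r => w r + w' r) (fun r => f r + g r) := by
  refine ⟨fun r hr => (norm_add_le _ _).trans (add_le_add (hf.norm_le r hr) (hg.norm_le r hr)),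
    fun r hr u hu => ?_⟩
  rw [add_sub_add_comm, add_mul]
  exact (norm_add_le _ _).trans (add_le_add (hf.sub_le r hr u hu) (hg.sub_le r hr u hu))

theorem HolderLe.of_tendsto {w : ℝ → ℝ} {f : ℕ → ℝ → F} {g : ℝ → F}
    (hf : ∀ n, HolderLe γ T w (f n))
    (h : ∀ r ∈ Icc 0 T, Filter.Tendsto (fun n => f n r) Filter.atTop (nhds (g r))) :
    HolderLe γ T w g := by
  refine ⟨fun r hr => le_of_tendsto (h r hr).norm
    (Filter.Eventually.of_forall fun n => (hf n).norm_le r hr), fun r hr u hu =>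
    le_of_tendsto ((h r hr).sub (h u ⟨hu.1, hu.2.le.trans hr.2⟩)).norm
    (Filter.Eventually.of_forall fun n => (hf n).sub_le r hr u hu)⟩

/-- A bound on the increments and on the initial value controls the whole function. -/
theorem HolderLe.of_increments {f : ℝ → F} {e D lam : ℝ} (hT : 0 ≤ T) (hγ : 0 ≤ γ) (he : 0 ≤ e)
    (hD : 0 ≤ D) (h0 : ‖f 0‖ ≤ e)
    (h : ∀ t ∈ Icc 0 T, ∀ s ∈ Ico 0 t, ‖f t - f s‖ ≤ D * Real.exp (lam * t) * (t - s) ^ γ) :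
    HolderLe γ T (expWeight e (D * (1 + T ^ γ)) lam) f := by
  have hTγ : 0 ≤ T ^ γ := Real.rpow_nonneg hT _
  constructor
  · intro r hr
    unfold expWeight
    have hE := Real.exp_pos (lam * r)
    rcases hr.1.eq_or_lt with rfl | hr0
    · have : 0 ≤ D * (1 + T ^ γ) * Real.exp (lam * 0) := by positivity
      linarith
    · have h1 := h r hr 0 ⟨le_rfl, hr0⟩
      rw [sub_zero] at h1
      have h2 : r ^ γ ≤ 1 + T ^ γ := by
        have := Real.rpow_le_rpow hr.1 hr.2 hγ
        linarith
      have h3 : D * Real.exp (lam * r) * r ^ γ ≤ D * (1 + T ^ γ) * Real.exp (lam * r) := by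
        calc _ ≤ D * Real.exp (lam * r) * (1 + T ^ γ) := by gcongr
          _ = _ := by ring
      have h4 : ‖f r‖ ≤ ‖f 0‖ + ‖f r - f 0‖ := by
        have := norm_add_le (f 0) (f r - f 0)
        rwa [add_sub_cancel] at this
      linarith
  · intro r hr u hu
    refine (h r hr u hu).trans ?_
    refine mul_le_mul_of_nonneg_right ?_ (Real.rpow_nonneg (by linarith [hu.2]) _)
    unfold expWeight
    have : 0 ≤ D * T ^ γ * Real.exp (lam * r) := by positivity
    linarith

theorem HolderLe.expWeight_of_const {f : ℝ → F} {lam : ℝ} (hγ : 0 ≤ γ) (hγα : γ ≤ 1 - α)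
    (hT : 0 < T) (hM : 0 ≤ M) (hf : HolderLe (1 - α) T (fun _ => M) f) :
    HolderLe γ T (expWeight (M * (1 + T ^ (1 - α - γ))) 0 lam) f := by
  have hp : 0 ≤ M * T ^ (1 - α - γ) := by positivity
  refine ⟨fun r hr => (hf.norm_le r hr).trans ?_, fun r hr u hu => (hf.sub_le r hr u hu).trans ?_⟩
  · unfold expWeight; linarith
  · have hru : 0 < r - u := by linarith [hu.2]
    have h1 := rpow_le_mul_rpow hru.le (by linarith [hr.2, hu.1] : r - u ≤ T) hγ hγα
    have hq : 0 ≤ (r - u) ^ γ := Real.rpow_nonneg hru.le _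
    unfold expWeight
    calc M * (r - u) ^ (1 - α) ≤ M * (T ^ (1 - α - γ) * (r - u) ^ γ) := by gcongr
      _ = (M * T ^ (1 - α - γ)) * (r - u) ^ γ := by ring
      _ ≤ _ := by
          refine mul_le_mul_of_nonneg_right ?_ hq
          linarith

theorem HolderLe.sub_expWeight_of_const {f g : ℝ → F} {lam : ℝ} (hγ : 0 ≤ γ) (hγα : γ ≤ 1 - α)
    (hT : 0 < T) (hM : 0 ≤ M) (hl : 0 ≤ lam) (hf : HolderLe (1 - α) T (fun _ => M) f)
    (hg : HolderLe (1 - α) T (fun _ => M) g) :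
    HolderLe γ T (expWeight 0 (2 * M * (1 + T ^ (1 - α - γ))) lam) (fun r => f r - g r) := by
  have h2 : HolderLe (1 - α) T (fun _ => 2 * M) (fun r => f r - g r) := by
    refine ⟨fun r hr => ?_, fun r hr u hu => ?_⟩
    · exact (norm_sub_le _ _).trans (by linarith [hf.norm_le r hr, hg.norm_le r hr])
    · rw [sub_sub_sub_comm]
      refine (norm_sub_le _ _).trans ?_
      have h1 := hf.sub_le r hr u hu
      have h2 := hg.sub_le r hr u hu
      linarith
  refine (h2.expWeight_of_const (lam := lam) hγ hγα hT (by positivity)).mono fun r hr => ?_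
  unfold expWeight
  have h3 : 1 ≤ Real.exp (lam * r) := Real.one_le_exp (mul_nonneg hl hr.1)
  have h4 : 0 ≤ 2 * M * (1 + T ^ (1 - α - γ)) := by positivity
  nlinarith

theorem MemHolder.exists_holderLe {f : ℝ → F} (hf : MemHolder (1 - α) T f) :
    ∃ M, 0 ≤ M ∧ HolderLe (1 - α) T (fun _ => M) f := by
  have hfin : normHolder (1 - α) T f ≠ ∞ := ne_of_lt hf
  refine ⟨(normHolder (1 - α) T f).toReal, ENNReal.toReal_nonneg, fun r hr => ?_,
    fun r hr u hu => ?_⟩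
  · refine (ENNReal.ofReal_le_iff_le_toReal hfin).1 (le_trans ?_ le_self_add)
    exact le_iSup₂_of_le r hr le_rfl
  · have hp : 0 < (r - u) ^ (1 - α) := Real.rpow_pos_of_pos (by linarith [hu.2]) _
    rw [← div_le_iff₀ hp]
    refine (ENNReal.ofReal_le_iff_le_toReal hfin).1 (le_trans ?_ le_add_self)
    exact le_iSup₂_of_le u ⟨hu.1, hu.2.le.trans hr.2⟩ (le_iSup₂_of_le r ⟨hu.2, hr.2⟩ le_rfl)

theorem HolderLe.memHolder {f : ℝ → F} (hf : HolderLe (1 - α) T (fun _ => M) f) :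
    MemHolder (1 - α) T f := by
  refine lt_of_le_of_lt (b := ENNReal.ofReal M + ENNReal.ofReal M) (add_le_add ?_ ?_)
    (ENNReal.add_lt_top.2 ⟨ENNReal.ofReal_lt_top, ENNReal.ofReal_lt_top⟩)
  · exact iSup₂_le fun s hs => ENNReal.ofReal_le_ofReal (hf.norm_le s hs)
  · refine iSup₂_le fun s hs => iSup₂_le fun t ht => ENNReal.ofReal_le_ofReal ?_
    rw [div_le_iff₀ (Real.rpow_pos_of_pos (by linarith [ht.1]) _)]
    exact hf.sub_le t ⟨hs.1.trans ht.1.le, ht.2⟩ s ⟨hs.1, ht.1⟩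

theorem HolderLe.memW0 [MeasurableSpace F] [BorelSpace F] {f : ℝ → F}
    (hα2 : α < 1 / 2) (hM : 0 ≤ M) (hf : HolderLe (1 - α) T (fun _ => M) f) : MemW0 α T f := by
  refine ⟨(continuousOn_of_holder (by linarith) hf.sub_le).domRestrict.measurable, ?_⟩
  refine lt_of_le_of_lt (b := ENNReal.ofReal M
    + ENNReal.ofReal M * ENNReal.ofReal (T ^ (-(2 * α) + 1) / (-(2 * α) + 1))) ?_
    (ENNReal.add_lt_top.2 ⟨ENNReal.ofReal_lt_top,
      ENNReal.mul_lt_top ENNReal.ofReal_lt_top ENNReal.ofReal_lt_top⟩)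
  refine iSup₂_le fun t ht => add_le_add (ENNReal.ofReal_le_ofReal (hf.norm_le t ht)) ?_
  calc _ ≤ ∫⁻ s in Ioo 0 t, ENNReal.ofReal M * ENNReal.ofReal ((t - s) ^ (-(2 * α))) := by
        refine setLIntegral_mono (by fun_prop) fun s hs => ?_
        have hts : 0 < t - s := by linarith [hs.2]
        rw [← ENNReal.ofReal_mul hM]
        refine ENNReal.ofReal_le_ofReal ?_
        rw [div_le_iff₀ (Real.rpow_pos_of_pos hts _), mul_assoc, ← Real.rpow_add hts,
          show -(2 * α) + (α + 1) = 1 - α by ring]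
        exact hf.sub_le t ht s ⟨hs.1.le, hs.2⟩
    _ ≤ _ := by
        rw [lintegral_const_mul _ (by fun_prop), lintegral_Ioo_rpow_sub_left ht.1 (by linarith),
          sub_zero]
        have h1 : 0 < -(2 * α) + 1 := by linarith
        refine mul_le_mul' le_rfl (ENNReal.ofReal_le_ofReal ?_)
        have := Real.rpow_le_rpow ht.1 ht.2 h1.le
        gcongr

theorem HolderLe.memW01 {f : ℝ → ℝ} {a₀ a₁ lam : ℝ} (hT : 0 ≤ T) (hα : 0 < α) (hα1 : α < 1)
    (hγ : α < γ) (h₀ : 0 ≤ a₀) (h₁ : 0 ≤ a₁) (hl : 0 < lam)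
    (hf : HolderLe γ T (expWeight a₀ a₁ lam) f) : MemW01 α T f := by
  refine ⟨(hf.continuousOn (hα.trans hγ) h₁ hl.le).domRestrict.measurable, ?_⟩
  have hfin : ∫⁻ x in Ioo 0 T, leftFracMajorant α ((Ioo 0 T).indicator f) x < ∞ :=
    lt_of_le_of_lt (lintegral_leftFracMajorant_le_of_holderLe (κ := 0) hα hγ le_rfl
      (by linarith) h₀ h₁ hl hf le_rfl hT le_rfl) ENNReal.ofReal_lt_top
  refine ENNReal.add_lt_top.2 ⟨lt_of_le_of_lt ?_ hfin, ?_⟩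
  · refine setLIntegral_mono' measurableSet_Ioo fun s hs => le_trans (le_of_eq ?_) le_self_add
    rw [indicator_of_mem hs, ← ofReal_norm, ← ENNReal.ofReal_mul (norm_nonneg _),
      Real.rpow_neg hs.1.le, div_eq_mul_inv]
  · have h1 : ENNReal.ofReal α * (∫⁻ s in Ioo 0 T, ∫⁻ y in Ioo 0 s,
        ENNReal.ofReal (‖f s - f y‖ / (s - y) ^ (α + 1))) < ∞ := by
      rw [← lintegral_const_mul' _ _ ENNReal.ofReal_ne_top]
      refine lt_of_le_of_lt ?_ hfin
      refine setLIntegral_mono' measurableSet_Ioo fun s hs => le_trans (le_of_eq ?_) le_add_self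
      congr 1
      refine setLIntegral_congr_fun measurableSet_Ioo fun y hy => ?_
      have hy' : y ∈ Ioo 0 T := ⟨hy.1, hy.2.trans hs.2⟩
      rw [indicator_of_mem hs, indicator_of_mem hy', ← ofReal_norm, norm_div,
        Real.norm_of_nonneg (Real.rpow_nonneg (by linarith [hy.2]) _)]
    exact ENNReal.lt_top_of_mul_ne_top_right h1.ne (ENNReal.ofReal_pos.2 hα).ne'

end Spaces

/-! ### The Picard map -/

section Picard

variable {d m : ℕ} {α β γ κ μ δ T : ℝ} {b : ℝ → ℝ → E d → E d}
  {σ : ℝ → ℝ → E d → Matrix (Fin d) (Fin m) ℝ} {g : ℝ → E m} {x₀ : E d}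

/-- The right-hand side of the Volterra equation. -/
noncomputable def picard (α T : ℝ) (b : ℝ → ℝ → E d → E d)
    (σ : ℝ → ℝ → E d → Matrix (Fin d) (Fin m) ℝ) (g : ℝ → E m) (x₀ : E d) (x : ℝ → E d)
    (t : ℝ) : E d :=
  x₀ + (∫ s in (0 : ℝ)..t, b t s (x s)) + matrixStieltjesUpTo α T t (fun s => σ t s (x s)) g

theorem picard_zero (x : ℝ → E d) : picard α T b σ g x₀ x 0 = x₀ := by
  have h : ∀ f k : ℝ → ℝ, stieltjesUpTo α T 0 f k = 0 := by
    intro f k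
    simp [stieltjesUpTo, zahleIntegral, leftFracDeriv]
  unfold picard matrixStieltjesUpTo
  simp only [intervalIntegral.integral_same, h, Finset.sum_const_zero, add_zero]
  ext i
  simp

theorem norm_le_card_mul {v : E d} {c : ℝ} (h : ∀ i, |v i| ≤ c) : ‖v‖ ≤ d * c := by
  have e : v = ∑ i, v i • (EuclideanSpace.single i (1 : ℝ) : E d) := by
    ext j
    simp [Pi.single_apply]
  calc ‖v‖ = ‖∑ i, v i • (EuclideanSpace.single i (1 : ℝ) : E d)‖ := by rw [← e]
    _ ≤ ∑ i, ‖v i • (EuclideanSpace.single i (1 : ℝ) : E d)‖ := norm_sum_le _ _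
    _ ≤ ∑ _i : Fin d, c := by
        refine Finset.sum_le_sum fun i _ => ?_
        rw [norm_smul, norm_single_one, mul_one]
        exact h i
    _ = d * c := by simp

/-- Linear growth of the increments of the Picard map. -/
theorem exists_picard_sub_le (hT : 0 < T) (hα : 0 < α) (hγ : α < γ) (hγβ : γ ≤ β)
    (hκ : 0 ≤ κ) (hακ : α + κ < 1) (hμ : 1 - α ≤ μ) (hg : MemWT α T g)
    (hσ : HypH1 T β μ δ σ) (hb : HypH2 T (1 / α) μ b) :
    ∃ C, 0 ≤ C ∧ ∀ (x : ℝ → E d) (e₀ e₁ lam : ℝ), 0 ≤ e₀ → 0 ≤ e₁ → 0 < lam →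
      HolderLe γ T (expWeight e₀ e₁ lam) x → ∀ t ∈ Icc 0 T, ∀ s ∈ Ico 0 t,
      ‖picard α T b σ g x₀ x t - picard α T b σ g x₀ x s‖
        ≤ C * (1 + e₀ + e₁ * lam ^ (-κ)) * Real.exp (lam * t) * (t - s) ^ (1 - α - κ) := by
  have hα1 : α < 1 := by linarith
  obtain ⟨C₁, hC₁, H₁⟩ := hb.exists_drift_sub_le hT hα (hα.trans hγ) hκ hακ hμ
  obtain ⟨K, K₀, KN, hK, hK₀, hKN, hent⟩ := hσ.exists_diffusionEntry
  obtain ⟨C₂, hC₂, H₂⟩ := exists_kernelLe_comp (d := d) (δ := δ) (KN := KN) hT hα hα1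
    (hα.trans hγ) hγβ hμ hK hK₀
  obtain ⟨Λ, hΛ⟩ := hg.fracIntegrator hα hα1 hT
  obtain ⟨C₃, hC₃, H₃⟩ := exists_stieltjesUpTo_sub_le hα hγ hκ hακ hT.le Λ
  refine ⟨C₁ + d * (m * (C₃ * C₂)), by positivity, ?_⟩
  intro x e₀ e₁ lam he₀ he₁ hl hx t ht s hs
  have hlk : 0 ≤ lam ^ (-κ) := Real.rpow_nonneg hl.le _
  have hq : 0 ≤ (t - s) ^ (1 - α - κ) := Real.rpow_nonneg (by linarith [hs.2]) _
  have h1 := H₁ x e₀ e₁ lam he₀ he₁ hl hx t ht s hs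
  set R := (1 + e₀ + e₁ * lam ^ (-κ)) * Real.exp (lam * t) * (t - s) ^ (1 - α - κ) with hR
  have h2 : ‖matrixStieltjesUpTo α T t (fun r => σ t r (x r)) g
      - matrixStieltjesUpTo α T s (fun r => σ s r (x r)) g‖ ≤ d * (m * (C₃ * C₂ * R)) := by
    refine norm_le_card_mul fun i => ?_
    simp only [matrixStieltjesUpTo, PiLp.sub_apply, ← Finset.sum_sub_distrib]
    refine (Finset.abs_sum_le_sum_abs _ _).trans ?_
    calc _ ≤ ∑ _j : Fin m, C₃ * C₂ * R := by
          refine Finset.sum_le_sum fun j _ => ?_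
          have hk := H₂ _ _ x e₀ e₁ lam (hent i j) he₀ he₁ hl hx
          refine (H₃ _ _ _ _ lam (hΛ j) (by positivity) (by positivity) hl hk t ht s hs).trans
            (le_of_eq ?_)
          rw [hR]
          ring
      _ = _ := by simp
  have e : picard α T b σ g x₀ x t - picard α T b σ g x₀ x s
      = ((∫ r in (0 : ℝ)..t, b t r (x r)) - ∫ r in (0 : ℝ)..s, b s r (x r))
        + (matrixStieltjesUpTo α T t (fun r => σ t r (x r)) g
          - matrixStieltjesUpTo α T s (fun r => σ s r (x r)) g) := by
    unfold picard
    abel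
  rw [e]
  refine (norm_add_le _ _).trans ((add_le_add h1 h2).trans (le_of_eq ?_))
  rw [hR]
  ring

/-- Increments of the difference of two images under the Picard map. -/
theorem exists_picard_sub_sub_le (hT : 0 < T) (hα : 0 < α) (hγ : α < γ) (hγα : γ ≤ 1 - α)
    (hγβ : γ ≤ β) (hγδ : γ ≤ (1 - α) * δ) (hκ : 0 ≤ κ) (hακ : α + κ < 1) (hμ : 1 - α ≤ μ)
    (hg : MemWT α T g) (hσ : HypH1 T β μ δ σ) (hb : HypH2 T (1 / α) μ b) {M : ℝ} (hM : 0 ≤ M) :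
    ∃ C, 0 ≤ C ∧ ∀ (x y : ℝ → E d) (D lam : ℝ), 0 ≤ D → 0 < lam →
      HolderLe (1 - α) T (fun _ => M) x → HolderLe (1 - α) T (fun _ => M) y →
      HolderLe γ T (expWeight 0 D lam) (fun r => x r - y r) → ∀ t ∈ Icc 0 T, ∀ s ∈ Ico 0 t,
      ‖(picard α T b σ g x₀ x t - picard α T b σ g x₀ y t)
        - (picard α T b σ g x₀ x s - picard α T b σ g x₀ y s)‖
        ≤ C * (D * lam ^ (-κ)) * Real.exp (lam * t) * (t - s) ^ (1 - α - κ) := by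
  have hα1 : α < 1 := by linarith
  have hγ0 : 0 < γ := hα.trans hγ
  obtain ⟨C₁, hC₁, H₁⟩ := hb.exists_drift_sub_sub_le (γ := γ) hT hα hκ hακ hM
  obtain ⟨K, K₀, KN, hK, hK₀, hKN, hent⟩ := hσ.exists_diffusionEntry
  obtain ⟨C₄, hC₄, H₄⟩ := exists_kernelLe_comp (d := d) (δ := δ) (KN := KN) hT hα hα1
    hγ0 hγβ hμ hK hK₀
  obtain ⟨C₂, hC₂, H₂⟩ := exists_kernelLe_sub (d := d) (μ := μ) (K₀ := K₀) hT hα hα1 hγ0 hγβ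
    hσ.δ_pos hγδ hK hKN hM
  obtain ⟨Λ, hΛ⟩ := hg.fracIntegrator hα hα1 hT
  obtain ⟨C₃, hC₃, H₃⟩ := exists_stieltjesUpTo_sub_le hα hγ hκ hακ hT.le Λ
  refine ⟨C₁ + d * (m * (C₃ * C₂)), by positivity, ?_⟩
  intro x y D lam hD hl hx hy hz t ht s hs
  have hlk : 0 ≤ lam ^ (-κ) := Real.rpow_nonneg hl.le _
  have h1 := H₁ x y D lam hD hl hx hy hz t ht s hs
  set R := (D * lam ^ (-κ)) * Real.exp (lam * t) * (t - s) ^ (1 - α - κ) with hR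
  have hM' : 0 ≤ M * (1 + T ^ (1 - α - γ)) := by positivity
  have hreg : ∀ {x : ℝ → E d}, HolderLe (1 - α) T (fun _ => M) x → ∀ i j, ∀ t ∈ Icc 0 T,
      FracIntegrable α T ((Ioo 0 t).indicator (fun r => σ t r (x r) i j)) := by
    intro x hx i j t ht
    have hk := H₄ _ _ x _ 0 lam (hent i j) hM' le_rfl hl
      (hx.expWeight_of_const hγ0.le hγα hT hM)
    exact (hk.at_time t ht).fracIntegrable hα hα1 hγ (by positivity) (by positivity) hl le_rfl
      ht.1 ht.2
  have hlin : ∀ i j, ∀ t ∈ Icc 0 T,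
      stieltjesUpTo α T t (fun r => σ t r (x r) i j) (fun r => g r j)
        - stieltjesUpTo α T t (fun r => σ t r (y r) i j) (fun r => g r j)
      = stieltjesUpTo α T t (fun r => σ t r (x r) i j - σ t r (y r) i j) (fun r => g r j) := by
    intro i j t ht
    unfold stieltjesUpTo
    rw [← zahleIntegral_sub hT.le (hΛ j) (hreg hx i j t ht) (hreg hy i j t ht)]
    congr 1
    ext r
    by_cases hr : r ∈ Ioo 0 t <;> simp [hr]
  have hs' : s ∈ Icc 0 T := ⟨hs.1, hs.2.le.trans ht.2⟩
  have h2 : ‖(matrixStieltjesUpTo α T t (fun r => σ t r (x r)) g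
      - matrixStieltjesUpTo α T t (fun r => σ t r (y r)) g)
      - (matrixStieltjesUpTo α T s (fun r => σ s r (x r)) g
      - matrixStieltjesUpTo α T s (fun r => σ s r (y r)) g)‖ ≤ d * (m * (C₃ * C₂ * R)) := by
    refine norm_le_card_mul fun i => ?_
    simp only [matrixStieltjesUpTo, PiLp.sub_apply, ← Finset.sum_sub_distrib]
    refine (Finset.abs_sum_le_sum_abs _ _).trans ?_
    calc _ ≤ ∑ _j : Fin m, C₃ * C₂ * R := by
          refine Finset.sum_le_sum fun j _ => ?_
          rw [hlin i j t ht, hlin i j s hs']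
          have hk := H₂ _ _ x y D lam (hent i j) hD hl hx hy hz
          refine (H₃ _ _ _ _ lam (hΛ j) le_rfl (by positivity) hl hk t ht s hs).trans
            (le_of_eq ?_)
          rw [hR]
          ring
      _ = _ := by simp
  have e : (picard α T b σ g x₀ x t - picard α T b σ g x₀ y t)
        - (picard α T b σ g x₀ x s - picard α T b σ g x₀ y s)
      = (((∫ r in (0 : ℝ)..t, b t r (x r)) - ∫ r in (0 : ℝ)..t, b t r (y r))
        - ((∫ r in (0 : ℝ)..s, b s r (x r)) - ∫ r in (0 : ℝ)..s, b s r (y r)))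
        + ((matrixStieltjesUpTo α T t (fun r => σ t r (x r)) g
      - matrixStieltjesUpTo α T t (fun r => σ t r (y r)) g)
      - (matrixStieltjesUpTo α T s (fun r => σ s r (x r)) g
      - matrixStieltjesUpTo α T s (fun r => σ s r (y r)) g)) := by
    unfold picard
    abel
  rw [e]
  refine (norm_add_le _ _).trans ((add_le_add h1 h2).trans (le_of_eq ?_))
  rw [hR]
  ring

end Picard

/-! ### Existence and uniqueness -/

section FixedPoint

variable {d m : ℕ} {α β γ μ δ T : ℝ} {b : ℝ → ℝ → E d → E d}
  {σ : ℝ → ℝ → E d → Matrix (Fin d) (Fin m) ℝ} {g : ℝ → E m} {x₀ : E d}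

theorem exists_mul_rpow_neg_le {κ : ℝ} (hκ : 0 < κ) (A : ℝ) {ε : ℝ} (hε : 0 < ε) :
    ∃ lam : ℝ, 0 < lam ∧ A * lam ^ (-κ) ≤ ε := by
  have h : Filter.Tendsto (fun lam : ℝ => A * lam ^ (-κ)) Filter.atTop (nhds (A * 0)) :=
    (tendsto_rpow_neg_atTop hκ).const_mul A
  rw [mul_zero] at h
  obtain ⟨lam, h1, h2⟩ := ((h.eventually (ge_mem_nhds hε)).and
    (Filter.eventually_gt_atTop 0)).exists
  exact ⟨lam, h2, h1⟩

/-- For large `λ` the Picard map halves distances in the weighted `γ`-Hölder norm, on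
`(1-α)`-Hölder functions with a common constant `M`. -/
theorem exists_picard_contraction (hT : 0 < T) (hα : 0 < α) (hγ : α < γ) (hγα : γ < 1 - α)
    (hγβ : γ ≤ β) (hγδ : γ ≤ (1 - α) * δ) (hμ : 1 - α ≤ μ)
    (hg : MemWT α T g) (hσ : HypH1 T β μ δ σ) (hb : HypH2 T (1 / α) μ b) {M : ℝ} (hM : 0 ≤ M) :
    ∃ lam, 0 < lam ∧ ∀ (x y : ℝ → E d) (D : ℝ), 0 ≤ D →
      HolderLe (1 - α) T (fun _ => M) x → HolderLe (1 - α) T (fun _ => M) y →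
      HolderLe γ T (expWeight 0 D lam) (fun r => x r - y r) →
      HolderLe γ T (expWeight 0 (D / 2) lam)
        (fun r => picard α T b σ g x₀ x r - picard α T b σ g x₀ y r) := by
  obtain ⟨C, hC, H⟩ := exists_picard_sub_sub_le (κ := 1 - α - γ) (x₀ := x₀) hT hα hγ hγα.le hγβ
    hγδ (by linarith) (by linarith) hμ hg hσ hb hM
  have hTγ : 0 ≤ T ^ γ := Real.rpow_nonneg hT.le _
  obtain ⟨lam, hl, hlam⟩ := exists_mul_rpow_neg_le (κ := 1 - α - γ) (by linarith)
    (C * (1 + T ^ γ)) (by norm_num : (0 : ℝ) < 1 / 2)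
  refine ⟨lam, hl, fun x y D hD hx hy hz => ?_⟩
  have hlk : 0 ≤ lam ^ (-(1 - α - γ)) := Real.rpow_nonneg hl.le _
  have h := HolderLe.of_increments (γ := γ) (lam := lam)
    (f := fun r => picard α T b σ g x₀ x r - picard α T b σ g x₀ y r) (e := 0)
    (D := C * (D * lam ^ (-(1 - α - γ)))) hT.le (by linarith) le_rfl (by positivity)
    (by simp [picard_zero]) (fun t ht s hs => by
      have := H x y D lam hD hl hx hy hz t ht s hs
      rwa [sub_sub_cancel] at this)
  refine h.mono fun r _ => ?_
  unfold expWeight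
  have h2 : C * (D * lam ^ (-(1 - α - γ))) * (1 + T ^ γ) ≤ D / 2 := by
    calc _ = D * (C * (1 + T ^ γ) * lam ^ (-(1 - α - γ))) := by ring
      _ ≤ D * (1 / 2) := by gcongr
      _ = _ := by ring
  gcongr

/-- A set of functions invariant under the Picard map on which the `(1-α)`-Hölder norm is
bounded: a ball of the weighted `γ`-Hölder norm, for a weight in which the growth of the Picard
map is absorbed. -/
theorem exists_picard_invariant (x₀ : E d) (hT : 0 < T) (hα : 0 < α) (hγ : α < γ)
    (hγα : γ < 1 - α) (hγβ : γ ≤ β) (hμ : 1 - α ≤ μ)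
    (hg : MemWT α T g) (hσ : HypH1 T β μ δ σ) (hb : HypH2 T (1 / α) μ b) :
    ∃ (M : ℝ) (w : ℝ → ℝ), 0 ≤ M ∧ (HolderLe γ T w (fun _ => x₀)) ∧
      HolderLe (1 - α) T (fun _ => M) (fun _ => x₀) ∧
      ∀ x : ℝ → E d, HolderLe γ T w x →
        HolderLe γ T w (picard α T b σ g x₀ x) ∧
        HolderLe (1 - α) T (fun _ => M) (picard α T b σ g x₀ x) := by
  obtain ⟨C₁, hC₁, H₁⟩ := exists_picard_sub_le (κ := 1 - α - γ) (x₀ := x₀) hT hα hγ hγβ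
    (by linarith) (by linarith) hμ hg hσ hb
  obtain ⟨C₂, hC₂, H₂⟩ := exists_picard_sub_le (κ := 0) (x₀ := x₀) hT hα hγ hγβ
    le_rfl (by linarith) hμ hg hσ hb
  have hTγ : 0 ≤ T ^ γ := Real.rpow_nonneg hT.le _
  have hTα : 0 ≤ T ^ (1 - α) := Real.rpow_nonneg hT.le _
  -- the radius `R` is stable as soon as `R λ^{-κ} ≤ 1`
  set R := C₁ * (2 + ‖x₀‖) * (1 + T ^ γ) with hR
  have hR0 : 0 ≤ R := by positivity
  obtain ⟨lam, hl, hlam⟩ := exists_mul_rpow_neg_le (κ := 1 - α - γ) (by linarith) R one_pos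
  set M₁ := C₂ * (1 + ‖x₀‖ + R) * Real.exp (lam * T) with hM₁
  have hM₁0 : 0 ≤ M₁ := by positivity
  refine ⟨‖x₀‖ + M₁ * (1 + T ^ (1 - α)), expWeight ‖x₀‖ R lam, by positivity,
    ⟨fun r _ => ?_, fun r _ u hu => ?_⟩, ⟨fun r _ => ?_, fun r _ u hu => ?_⟩,
    fun x hx => ⟨?_, ?_⟩⟩
  · unfold expWeight
    have : 0 ≤ R * Real.exp (lam * r) := by positivity
    linarith
  · rw [sub_self, norm_zero]
    exact mul_nonneg (expWeight_nonneg (norm_nonneg _) hR0)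
      (Real.rpow_nonneg (by linarith [hu.2]) _)
  · have : 0 ≤ M₁ * (1 + T ^ (1 - α)) := by positivity
    linarith
  · rw [sub_self, norm_zero]
    exact mul_nonneg (by positivity) (Real.rpow_nonneg (by linarith [hu.2]) _)
  · have hlk : 0 ≤ lam ^ (-(1 - α - γ)) := Real.rpow_nonneg hl.le _
    have h := HolderLe.of_increments (γ := γ) (lam := lam)
      (f := picard α T b σ g x₀ x) (e := ‖x₀‖)
      (D := C₁ * (1 + ‖x₀‖ + R * lam ^ (-(1 - α - γ)))) hT.le (by linarith) (norm_nonneg _)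
      (by positivity) (by rw [picard_zero]) (fun t ht s hs => by
        have := H₁ x ‖x₀‖ R lam (norm_nonneg _) hR0 hl hx t ht s hs
        rwa [sub_sub_cancel] at this)
    refine h.mono fun r _ => ?_
    unfold expWeight
    have h2 : C₁ * (1 + ‖x₀‖ + R * lam ^ (-(1 - α - γ))) * (1 + T ^ γ) ≤ R := by
      calc _ ≤ C₁ * (1 + ‖x₀‖ + 1) * (1 + T ^ γ) := by gcongr
        _ = R := by rw [hR]; ring
    gcongr
  · have h := HolderLe.of_increments (γ := 1 - α) (lam := 0)
      (f := picard α T b σ g x₀ x) (e := ‖x₀‖) (D := M₁) hT.le (by linarith) (norm_nonneg _)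
      hM₁0 (by rw [picard_zero]) (fun t ht s hs => by
        have h3 := H₂ x ‖x₀‖ R lam (norm_nonneg _) hR0 hl hx t ht s hs
        rw [sub_zero, neg_zero, Real.rpow_zero, mul_one] at h3
        rw [zero_mul, Real.exp_zero, mul_one]
        refine h3.trans (mul_le_mul_of_nonneg_right ?_ (Real.rpow_nonneg (by linarith [hs.2]) _))
        rw [hM₁]
        gcongr
        exact ht.2)
    refine h.mono fun r _ => le_of_eq ?_
    simp [expWeight]

theorem eq_of_forall_norm_sub_le {F : Type*} [NormedAddCommGroup F] {u v : F} {A : ℝ}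
    (h : ∀ n : ℕ, ‖u - v‖ ≤ A / 2 ^ n) : u = v := by
  have h1 : Filter.Tendsto (fun n : ℕ => A / 2 ^ n) Filter.atTop (nhds 0) := by
    have := (tendsto_pow_atTop_nhds_zero_of_lt_one (r := (1 / 2 : ℝ)) (by norm_num)
      (by norm_num)).const_mul A
    simpa [div_eq_mul_inv] using this
  have h2 : ‖u - v‖ ≤ 0 := ge_of_tendsto' h1 h
  exact sub_eq_zero.1 (norm_le_zero_iff.1 h2)

/-- Uniqueness of fixed points of the Picard map among `(1-α)`-Hölder functions. -/
theorem picard_unique (hT : 0 < T) (hα : 0 < α) (hγ : α < γ) (hγα : γ < 1 - α)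
    (hγβ : γ ≤ β) (hγδ : γ ≤ (1 - α) * δ) (hμ : 1 - α ≤ μ)
    (hg : MemWT α T g) (hσ : HypH1 T β μ δ σ) (hb : HypH2 T (1 / α) μ b) {M : ℝ} (hM : 0 ≤ M)
    {x y : ℝ → E d} (hx : HolderLe (1 - α) T (fun _ => M) x)
    (hy : HolderLe (1 - α) T (fun _ => M) y)
    (hxe : ∀ t ∈ Icc 0 T, picard α T b σ g x₀ x t = x t)
    (hye : ∀ t ∈ Icc 0 T, picard α T b σ g x₀ y t = y t) : EqOn x y (Icc 0 T) := by
  obtain ⟨lam, hl, H⟩ := exists_picard_contraction (x₀ := x₀) hT hα hγ hγα hγβ hγδ hμ hg hσ hb hM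
  set D := 2 * M * (1 + T ^ (1 - α - γ)) with hD
  have hD0 : 0 ≤ D := by positivity
  have hn : ∀ n : ℕ, HolderLe γ T (expWeight 0 (D / 2 ^ n) lam) (fun r => x r - y r) := by
    intro n
    induction n with
    | zero =>
      rw [pow_zero, div_one]
      exact hx.sub_expWeight_of_const (by linarith) hγα.le hT hM hl.le hy
    | succ n ih =>
      have h := H x y _ (by positivity) hx hy ih
      rw [div_div, ← pow_succ] at h
      exact h.congr fun r hr => by rw [hxe r hr, hye r hr]
  intro t ht
  refine eq_of_forall_norm_sub_le (A := D * Real.exp (lam * t)) fun n => ?_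
  refine ((hn n).norm_le t ht).trans (le_of_eq ?_)
  unfold expWeight
  ring

/-- A fixed point of the Picard map, as the limit of the Picard iterates. -/
theorem exists_picard_fixed (hT : 0 < T) (hα : 0 < α) (hγ : α < γ) (hγα : γ < 1 - α)
    (hγβ : γ ≤ β) (hγδ : γ ≤ (1 - α) * δ) (hμ : 1 - α ≤ μ)
    (hg : MemWT α T g) (hσ : HypH1 T β μ δ σ) (hb : HypH2 T (1 / α) μ b) :
    ∃ (M : ℝ) (x : ℝ → E d), 0 ≤ M ∧ HolderLe (1 - α) T (fun _ => M) x ∧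
      ∀ t ∈ Icc 0 T, picard α T b σ g x₀ x t = x t := by
  obtain ⟨M, w, hM, hw₀, hM₀, hinv⟩ := exists_picard_invariant x₀ hT hα hγ hγα hγβ hμ hg hσ hb
  obtain ⟨lam, hl, H⟩ := exists_picard_contraction (x₀ := x₀) hT hα hγ hγα hγβ hγδ hμ hg hσ hb hM
  set Φ := picard α T b σ g x₀
  set X : ℕ → ℝ → E d := fun n => Φ^[n] (fun _ => x₀) with hX
  have hXs : ∀ n, X (n + 1) = Φ (X n) := fun n => Function.iterate_succ_apply' _ _ _
  have hXw : ∀ n, HolderLe γ T w (X n) ∧ HolderLe (1 - α) T (fun _ => M) (X n) := by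
    intro n
    induction n with
    | zero => exact ⟨hw₀, hM₀⟩
    | succ n ih => rw [hXs]; exact hinv _ ih.1
  set D := 2 * M * (1 + T ^ (1 - α - γ)) with hD
  have hD0 : 0 ≤ D := by positivity
  have hstep : ∀ n : ℕ, HolderLe γ T (expWeight 0 (D / 2 ^ n) lam)
      (fun r => X (n + 1) r - X n r) := by
    intro n
    induction n with
    | zero =>
      rw [pow_zero, div_one]
      exact (hXw 1).2.sub_expWeight_of_const (by linarith) hγα.le hT hM hl.le (hXw 0).2
    | succ n ih =>
      have h := H _ _ _ (by positivity) (hXw (n + 1)).2 (hXw n).2 ih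
      rw [div_div, ← pow_succ, ← hXs, ← hXs] at h
      exact h
  have hfar : ∀ k n : ℕ, HolderLe γ T (expWeight 0 (2 * (D / 2 ^ n)) lam)
      (fun r => X (n + k) r - X n r) := by
    intro k
    induction k with
    | zero =>
      intro n
      have h0 : 0 ≤ 2 * (D / 2 ^ n) := by positivity
      refine ⟨fun r _ => ?_, fun r _ u hu => ?_⟩
      · simpa using expWeight_nonneg le_rfl h0
      · simpa using mul_nonneg (expWeight_nonneg le_rfl h0)
          (Real.rpow_nonneg (by linarith [hu.2] : 0 ≤ r - u) γ)
    | succ k ih =>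
      intro n
      refine (((ih (n + 1)).add (hstep n)).congr fun r _ => ?_).mono fun r _ => le_of_eq ?_
      · rw [show n + 1 + k = n + (k + 1) by ring]
        abel
      · unfold expWeight
        rw [pow_succ]
        ring
  have hlim : ∀ t, ∃ l, t ∈ Icc 0 T →
      Filter.Tendsto (fun n => X n t) Filter.atTop (nhds l) := by
    intro t
    by_cases ht : t ∈ Icc 0 T
    · have hc : CauchySeq fun n => X n t := by
        refine cauchySeq_of_le_geometric (1 / 2) (D * Real.exp (lam * t)) (by norm_num)
          fun n => ?_
        rw [dist_comm, dist_eq_norm]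
        refine ((hstep n).norm_le t ht).trans (le_of_eq ?_)
        unfold expWeight
        rw [one_div, inv_pow]
        ring
      obtain ⟨l, hl⟩ := cauchySeq_tendsto_of_complete hc
      exact ⟨l, fun _ => hl⟩
    · exact ⟨0, fun h => absurd h ht⟩
  choose x hx using hlim
  have hxM : HolderLe (1 - α) T (fun _ => M) x := HolderLe.of_tendsto (fun n => (hXw n).2) hx
  have hxX : ∀ n, HolderLe γ T (expWeight 0 (2 * (D / 2 ^ n)) lam) (fun r => x r - X n r) := by
    intro n
    refine HolderLe.of_tendsto (fun k => hfar k n) fun r hr => ?_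
    have := (hx r hr).comp (Filter.tendsto_add_atTop_nat n)
    refine Filter.Tendsto.sub_const ?_ _
    simpa [Function.comp_def, add_comm] using this
  refine ⟨M, x, hM, hxM, fun t ht => ?_⟩
  refine eq_of_forall_norm_sub_le (A := 2 * D * Real.exp (lam * t)) fun n => ?_
  have h1 := (H _ _ _ (by positivity) hxM (hXw n).2 (hxX n)).norm_le t ht
  have h2 := (hxX (n + 1)).norm_le t ht
  rw [← hXs] at h1
  have h3 := norm_sub_le (Φ x t - X (n + 1) t) (x t - X (n + 1) t)
  rw [sub_sub_sub_cancel_right] at h3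
  refine h3.trans ((add_le_add h1 h2).trans (le_of_eq ?_))
  unfold expWeight
  rw [pow_succ]
  ring

end FixedPoint

end Volterra

theorem mainTheorem2 {d m : ℕ} (T α β μ δ : ℝ) (hT : 0 < T) (hα : 0 < α)
    (b : ℝ → ℝ → Volterra.E d → Volterra.E d)
    (σ : ℝ → ℝ → Volterra.E d → Matrix (Fin d) (Fin m) ℝ)
    (g : ℝ → Volterra.E m) (x₀ : Volterra.E d)
    (hg : Volterra.MemWT α T g)
    (hσ : Volterra.HypH1 T β μ δ σ)
    (hb : Volterra.HypH2 T (1 / α) μ b)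
    (hμ : 1 - μ < min β (δ / (1 + δ)))
    (hα_lower : 1 - μ < α)
    (hα_upper : α < min (1 / 2) (min β (δ / (1 + δ)))) :
    ∃ x : ℝ → Volterra.E d,
      (Volterra.MemW0 α T x ∧ Volterra.MemHolder (1 - α) T x ∧
        Volterra.IsSolution α T b σ g x₀ x) ∧
      ∀ y : ℝ → Volterra.E d,
        Volterra.MemW0 α T y → Volterra.MemHolder (1 - α) T y →
        Volterra.IsSolution α T b σ g x₀ y → Set.EqOn y x (Set.Icc 0 T) := by
  obtain ⟨h1, h2⟩ := lt_min_iff.1 hα_upper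
  obtain ⟨h2, h3⟩ := lt_min_iff.1 h2
  have hδ := hσ.δ_pos
  have h4 : α < (1 - α) * δ := by
    rw [lt_div_iff₀ (by linarith)] at h3
    linarith
  -- `γ > α` makes the fractional derivative converge, `γ ≤ (1-α)δ` is what the Hölder partial
  -- derivatives of `σ` leave, and `γ < 1-α` gives the contraction
  obtain ⟨γ, hγ, hγ'⟩ := exists_between
    (lt_min (by linarith : α < 1 - α) (lt_min h2 h4))
  obtain ⟨hγα, hγ'⟩ := lt_min_iff.1 hγ'
  obtain ⟨hγβ, hγδ⟩ := lt_min_iff.1 hγ'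
  have hα1 : α < 1 := by linarith
  have hμ' : 1 - α ≤ μ := by linarith
  obtain ⟨M, x, hM, hx, hfix⟩ := Volterra.exists_picard_fixed (x₀ := x₀) hT hα hγ hγα hγβ.le
    hγδ.le hμ' hg hσ hb
  refine ⟨x, ⟨hx.memW0 h1 hM, hx.memHolder, ?_⟩, ?_⟩
  · have h0 : (0 : ℝ) ∈ Set.Icc 0 T := ⟨le_rfl, hT.le⟩
    have hxc := Volterra.continuousOn_of_holder (by linarith) hx.sub_le
    refine ⟨fun t ht => Volterra.intervalIntegrable_of_mem_Icc h0 ht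
      (hb.integrableOn_comp hT hα hα1 hxc ht), fun t ht i j => ?_, fun t ht => (hfix t ht).symm⟩
    obtain ⟨K, K₀, KN, hK, hK₀, -, hent⟩ := hσ.exists_diffusionEntry
    obtain ⟨C, hC, H⟩ := Volterra.exists_kernelLe_comp (d := d) (δ := δ) (KN := KN) hT hα hα1
      (hα.trans hγ) hγβ.le hμ' hK hK₀
    have hk := H _ _ x _ 0 1 (hent i j) (by positivity) le_rfl one_pos
      (hx.expWeight_of_const (by linarith) hγα.le hT hM)
    exact (hk.at_time t ht).memW01 hT.le hα hα1 hγ (by positivity) (by positivity) one_pos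
  · intro y _ hyH hy
    obtain ⟨M', hM', hyM⟩ := hyH.exists_holderLe
    exact Volterra.picard_unique (x₀ := x₀) hT hα hγ hγα hγβ.le hγδ.le hμ' hg hσ hb
      (le_max_of_le_left hM) (hyM.mono fun _ _ => le_max_right M M')
      (hx.mono fun _ _ => le_max_left M M') (fun t ht => (hy.equation t ht).symm) hfix
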